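/- Let $\mathbb{K}$ be a number field with ring of integers $\mathcal{O}$, let $\mathcal{I}$ be the set of nonzero ideals of $\mathcal{O}$, $\mathbb{P}$ the set of nonzero prime ideals, and $\mathcal{N}$ the absolute norm. Let $\prec$ be a total order on $\mathbb{P}$ such that $\mathfrak{p}\prec\mathfrak{q}$ whenever $\mathcal{N}(\mathfrak{p})<\mathcal{N}(\mathfrak{q})$. For $w:\mathcal{I}\to\mathbb{R}$, $\mathfrak{r}\in\mathcal{I}$ and $\mathfrak{q}\in\mathbb{P}$ put $$\Pi(\mathfrak{q})=\prod_{\mathfrak{p}\prec\mathfrak{q}}\mathfrak{p},\qquad \Phi_{\mathfrak{r}}(w,\mathfrak{q})=\sum_{\mathfrak{a}\in\mathcal{I},\ (\mathfrak{a},\Pi(\mathfrak{q}))=1}w(\mathfrak{a}\mathfrak{r}).$$ Let $\mathcal{B}$ be the Buchstab function, the unique continuous function on $[1,\infty)$ with $\mathcal{B}(u)=1/u$ for $1\le u\le 2$ and $\frac{d}{du}(u\mathcal{B}(u))=\mathcal{B}(u-1)$ for $u>2$. Fix $\varepsilon,\xi\in(0,1)$ and $\beta>2>\alpha>1$. Let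 $W=W_N:\mathcal{I}\to\mathbb{R}_{\ge 0}$ be a function depending on a real variable $N\ge 10$ such that, for all $N\ge 10$ and all $\mathfrak{r}\in\mathcal{I}$ with $\mathcal{N}(\mathfrak{r})\le N/2$, the sums below converge and $$\sum_{\mathfrak{s}\in\mathbb{P}}W(\mathfrak{r}\mathfrak{s})=\frac{N/\mathcal{N}(\mathfrak{r})}{\log(N/\mathcal{N}(\mathfrak{r}))}\left(1+O\left(\frac{\log\log N}{\log(N/\mathcal{N}(\mathfrak{r}))}\right)\right),\tag{1}$$ $$\sum_{\mathfrak{s}\in\mathbb{P},\ \mathfrak{s}\prec\mathfrak{p}}W(\mathfrak{r}\mathfrak{s})=O_{\delta}\left(\frac{\mathcal{N}(\mathfrak{p})}{\log\mathcal{N}(\mathfrak{p})}\right)\quad\text{for every }\delta>0\text{ and every }\mathfrak{p}\in\mathbb{P}\text{ with }\mathcal{N}(\mathfrak{p})\ge N^{\delta},\tag{2}$$ $$\sum_{\mathfrak{a}\in\mathcal{I},\ \mathcal{N}(\mathfrak{a}\mathfrak{r})>N\log^{\xi}N}W(\mathfrak{a}\mathfrak{r})=O\left(\frac{N/\mathcal{N}(\mathfrak{r})}{\log^{2}(N/\mathcal{N}(\mathfrak{r}))}\right).\tag{3}$$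 Then there is $N_0$ such that the following holds for all $N\ge\max(10,N_0)$, $\mathfrak{p}\in\mathbb{P}$ and $\mathfrak{r}\in\mathcal{I}$. Set $$y=\frac{N}{\mathcal{N}(\mathfrak{r})},\qquad u=\frac{\log y}{\log\mathcal{N}(\mathfrak{p})},$$ and suppose that $\mathcal{N}(\mathfrak{r})\le N^{1-\varepsilon}$ and $\alpha\le u\le\beta$. Then the series $\Phi_{\mathfrak{r}}(W,\mathfrak{p})$ converges and $$\Phi_{\mathfrak{r}}(W,\mathfrak{p})=W(\mathfrak{r})+\mathcal{B}(u)\cdot\frac{y}{\log\mathcal{N}(\mathfrak{p})}\cdot\left(1+O\left(\log^{\xi-1}y\right)\right).$$ If moreover $W(\mathfrak{r})=O\left(y/\log^{2-\xi}y\right)$, then $$\Phi_{\mathfrak{r}}(W,\mathfrak{p})=\mathcal{B}(u)\cdot\frac{y}{\log\mathcal{N}(\mathfrak{p})}\cdot\left(1+O\left(\log^{\xi-1}y\right)\right).$$ Here $N_0$ and the implied constants in the conclusions depend only on $\mathbb{K},\alpha,\beta,\varepsilon,\xi$ and on the implied constants in the assumptions. -/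

import Mathlib

open scoped NumberField nonZeroDivisors
open IsDedekindDomain

noncomputable section

namespace IdealSieve

/-! ### The Buchstab function -/

/-- `B` is continuous on `[1, ∞)`, equals `1 / u` on `[1, 2]`, and satisfies
`(u B(u))' = B(u - 1)` for `u > 2`. -/
structure IsBuchstab (B : ℝ → ℝ) : Prop where
  continuousOn : ContinuousOn B (Set.Ici 1)
  eq_inv : ∀ u : ℝ, 1 ≤ u → u ≤ 2 → B u = 1 / u
  hasDerivAt : ∀ u : ℝ, 2 < u → HasDerivAt (fun v : ℝ => v * B v) (B (u - 1)) u

/-- Picard-type iterates; for `u ≥ 1` they read `1 / u` and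
`(1 + ∫_1^{max(1, u - 1)} B_n) / u`. The `n`-th iterate is the Buchstab function on `[1, n + 2]`. -/
def buchstabIter : ℕ → ℝ → ℝ
  | 0 => fun u => 1 / max 1 u
  | n + 1 => fun u => (1 + ∫ v in (1 : ℝ)..(max 1 (u - 1)), buchstabIter n v) / max 1 u

/-- The Buchstab function (its values for `u < 1` play no role). -/
def buchstab (u : ℝ) : ℝ := buchstabIter ⌈u⌉₊ u

theorem continuous_buchstabIter (n : ℕ) : Continuous (buchstabIter n) := by
  have hne : ∀ u : ℝ, max 1 u ≠ 0 := fun u =>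
    (lt_of_lt_of_le one_pos (le_max_left 1 u)).ne'
  induction n with
  | zero =>
    show Continuous fun u : ℝ => 1 / max 1 u
    exact continuous_const.div (by fun_prop) hne
  | succ n ih =>
    show Continuous fun u : ℝ =>
      (1 + ∫ v in (1 : ℝ)..(max 1 (u - 1)), buchstabIter n v) / max 1 u
    have h1 : Continuous fun x : ℝ => ∫ v in (1 : ℝ)..x, buchstabIter n v :=
      intervalIntegral.continuous_primitive (fun a b => ih.intervalIntegrable a b) 1
    have h2 : Continuous fun u : ℝ => max 1 (u - 1) := by fun_prop
    exact (continuous_const.add (h1.comp h2)).div (by fun_prop) hne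

theorem buchstabIter_succ_eq (n : ℕ) :
    ∀ u : ℝ, u ≤ n + 2 → buchstabIter (n + 1) u = buchstabIter n u := by
  induction n with
  | zero =>
    intro u hu
    have h : max 1 (u - 1) = 1 := max_eq_left (by norm_num at hu; linarith)
    simp [buchstabIter, h]
  | succ n ih =>
    intro u hu
    push_cast at hu
    have h : (∫ v in (1 : ℝ)..(max 1 (u - 1)), buchstabIter (n + 1) v)
        = ∫ v in (1 : ℝ)..(max 1 (u - 1)), buchstabIter n v := by
      apply intervalIntegral.integral_congr
      intro v hv
      rw [Set.uIcc_of_le (le_max_left _ _)] at hv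
      refine ih v (hv.2.trans (max_le ?_ ?_))
      · have : (0 : ℝ) ≤ n := n.cast_nonneg
        linarith
      · linarith
    show (1 + ∫ v in (1 : ℝ)..(max 1 (u - 1)), buchstabIter (n + 1) v) / max 1 u
      = (1 + ∫ v in (1 : ℝ)..(max 1 (u - 1)), buchstabIter n v) / max 1 u
    rw [h]

theorem buchstabIter_add_eq (n k : ℕ) (u : ℝ) (hu : u ≤ n + 2) :
    buchstabIter (n + k) u = buchstabIter n u := by
  induction k with
  | zero => rfl
  | succ k ih =>
    rw [← ih]
    refine buchstabIter_succ_eq (n + k) u (hu.trans ?_)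
    push_cast
    have : (0 : ℝ) ≤ k := k.cast_nonneg
    linarith

theorem buchstab_eq_iter (n : ℕ) (u : ℝ) (hu : u ≤ n + 2) :
    buchstab u = buchstabIter n u := by
  have hc : u ≤ (⌈u⌉₊ : ℝ) + 2 := (Nat.le_ceil u).trans (by linarith)
  rcases le_total n ⌈u⌉₊ with h | h
  · obtain ⟨k, hk⟩ := Nat.exists_eq_add_of_le h
    rw [buchstab, hk]
    exact buchstabIter_add_eq n k u hu
  · obtain ⟨k, hk⟩ := Nat.exists_eq_add_of_le h
    rw [buchstab, hk]
    exact (buchstabIter_add_eq _ k u hc).symm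

/-- The function `buchstab` solves the defining system. -/
theorem isBuchstab_buchstab : IsBuchstab buchstab := by
  have hloc : ∀ u : ℝ, ∀ᶠ v in nhds u, buchstab v = buchstabIter ⌈u⌉₊ v := by
    intro u
    have hu : u < (⌈u⌉₊ : ℝ) + 2 := (Nat.le_ceil u).trans_lt (by linarith)
    filter_upwards [Iio_mem_nhds hu] with v hv
    exact buchstab_eq_iter _ v (le_of_lt hv)
  refine ⟨?_, ?_, ?_⟩
  · intro u _
    exact ((continuous_buchstabIter ⌈u⌉₊).continuousAt.congr
      ((hloc u).mono fun _ h => h.symm)).continuousWithinAt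
  · intro u h1 h2
    rw [buchstab_eq_iter 0 u (by simpa using h2)]
    simp [buchstabIter, max_eq_right h1]
  · intro u hu
    set n := ⌈u⌉₊ with hn
    have hun : u ≤ (n : ℝ) := Nat.le_ceil u
    have hB : buchstab (u - 1) = buchstabIter n (u - 1) :=
      buchstab_eq_iter n _ (by linarith)
    have hF : HasDerivAt (fun x : ℝ => ∫ v in (1 : ℝ)..x, buchstabIter n v)
        (buchstabIter n (u - 1)) (u - 1) :=
      intervalIntegral.integral_hasDerivAt_right
        ((continuous_buchstabIter n).intervalIntegrable _ _)
        ((continuous_buchstabIter n).stronglyMeasurableAtFilter _ _)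
        (continuous_buchstabIter n).continuousAt
    have hG : HasDerivAt (fun x : ℝ => 1 + ∫ v in (1 : ℝ)..(x - 1), buchstabIter n v)
        (buchstabIter n (u - 1)) u :=
      (hF.comp_sub_const u 1).const_add 1
    rw [hB]
    refine hG.congr_of_eventuallyEq ?_
    have hlt : u < (n : ℝ) + 1 := by linarith
    filter_upwards [Ioo_mem_nhds hu hlt] with v hv
    have h1 : max 1 (v - 1) = v - 1 := max_eq_right (by linarith [hv.1])
    have h2 : max 1 v = v := max_eq_right (by linarith [hv.1])
    have h3 : v ≠ 0 := by linarith [hv.1]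
    rw [buchstab_eq_iter (n + 1) v (by push_cast; linarith [hv.2])]
    simp only [buchstabIter, h1, h2]
    field_simp

/-- The defining system has only one solution on `[1, ∞)`. -/
theorem IsBuchstab.unique {B B' : ℝ → ℝ} (h : IsBuchstab B) (h' : IsBuchstab B') :
    ∀ u : ℝ, 1 ≤ u → B u = B' u := by
  have key : ∀ n : ℕ, ∀ u : ℝ, 1 ≤ u → u ≤ n + 2 → B u = B' u := by
    intro n
    induction n with
    | zero =>
      intro u h1 h2
      rw [h.eq_inv u h1 (by simpa using h2), h'.eq_inv u h1 (by simpa using h2)]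
    | succ n ih =>
      intro u h1 h2
      push_cast at h2
      rcases le_or_gt u 2 with hu | hu
      · rw [h.eq_inv u h1 hu, h'.eq_inv u h1 hu]
      · have hcont : ∀ {D : ℝ → ℝ}, IsBuchstab D →
            ContinuousOn (fun v : ℝ => v * D v) (Set.Icc 2 u) := fun hD =>
          continuousOn_id.mul (hD.continuousOn.mono fun v hv =>
            Set.mem_Ici.2 (by linarith [hv.1]))
        have hc : ContinuousOn (fun v : ℝ => v * B v - v * B' v) (Set.Icc 2 u) :=
          (hcont h).sub (hcont h')
        have hd : ∀ v ∈ Set.Ioo 2 u,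
            HasDerivAt (fun v : ℝ => v * B v - v * B' v) (0 : ℝ) v := by
          intro v hv
          have hh := (h.hasDerivAt v hv.1).sub (h'.hasDerivAt v hv.1)
          rw [ih (v - 1) (by linarith [hv.1]) (by linarith [hv.2]), sub_self] at hh
          exact hh
        obtain ⟨c, hc1, hc2⟩ := exists_hasDerivAt_eq_slope
          (fun v : ℝ => v * B v - v * B' v) (fun _ => 0) hu hc hd
        have hne : u - 2 ≠ 0 := by linarith
        have h2eq : B 2 = B' 2 := by
          rw [h.eq_inv 2 (by norm_num) le_rfl, h'.eq_inv 2 (by norm_num) le_rfl]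
        have h0 : (u * B u - u * B' u) - (2 * B 2 - 2 * B' 2) = 0 := by
          rcases div_eq_zero_iff.1 hc2.symm with h0 | h0
          · exact h0
          · exact absurd h0 hne
        have h00 : u * (B u - B' u) = 0 := by rw [h2eq] at h0; linarith
        rcases mul_eq_zero.1 h00 with h1' | h1'
        · linarith
        · linarith
  intro u hu
  exact key ⌈u⌉₊ u hu ((Nat.le_ceil u).trans (by linarith))

/-! ### Ideals, prime ideals, and the sifted sums -/

variable (K : Type*) [Field K] [NumberField K]

/-- The (multiplicative monoid of) nonzero ideals of the ring of integers of `K`. -/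
abbrev NzIdeal : Type _ := (Ideal (𝓞 K))⁰

/-- The nonzero prime ideals of the ring of integers of `K`. -/
abbrev PrimeId : Type _ := HeightOneSpectrum (𝓞 K)

variable {K}

/-- A nonzero prime ideal, as a nonzero ideal. -/
def PrimeId.toNz (p : PrimeId K) : NzIdeal K :=
  ⟨p.asIdeal, mem_nonZeroDivisors_of_ne_zero p.ne_bot⟩

/-- The absolute norm of a nonzero ideal, as a real number. -/
def nrm (a : NzIdeal K) : ℝ := (Ideal.absNorm (a : Ideal (𝓞 K)) : ℝ)

/-- `prec` is a (strict) total order on the nonzero prime ideals that refines the comparison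
of norms. -/
structure IsNormOrder (prec : PrimeId K → PrimeId K → Prop) : Prop where
  strictTotal : IsStrictTotalOrder (PrimeId K) prec
  of_nrm_lt : ∀ p q : PrimeId K, nrm p.toNz < nrm q.toNz → prec p q

/-- Only finitely many primes precede a given one, so the product and the sum over
`{s | prec s q}` below are finite. -/
theorem IsNormOrder.finite_setOf_prec {prec : PrimeId K → PrimeId K → Prop}
    (h : IsNormOrder prec) (q : PrimeId K) : {s : PrimeId K | prec s q}.Finite := by
  have hf := Ideal.finite_setOfPred_absNorm_le (S := 𝓞 K) (Ideal.absNorm q.asIdeal)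
  have hinj : Function.Injective (fun s : PrimeId K => s.asIdeal) := fun s t hst =>
    HeightOneSpectrum.ext hst
  refine (hf.preimage hinj.injOn).subset ?_
  intro s hs
  show Ideal.absNorm s.asIdeal ≤ Ideal.absNorm q.asIdeal
  by_contra hlt
  have hqs : prec q s := h.of_nrm_lt q s (by
    show ((Ideal.absNorm q.asIdeal : ℕ) : ℝ) < ((Ideal.absNorm s.asIdeal : ℕ) : ℝ)
    exact_mod_cast not_le.1 hlt)
  have := h.strictTotal
  exact irrefl_of prec q (trans_of prec hqs hs)

/-- `Π(q)`, the product of all nonzero prime ideals preceding `q`. -/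
def primeProd (prec : PrimeId K → PrimeId K → Prop) (q : PrimeId K) : Ideal (𝓞 K) :=
  ∏ᶠ s ∈ {s : PrimeId K | prec s q}, s.asIdeal

/-- The nonzero ideals coprime to `Π(q)`. -/
def sifted (prec : PrimeId K → PrimeId K → Prop) (q : PrimeId K) : Set (NzIdeal K) :=
  {a | IsCoprime (a : Ideal (𝓞 K)) (primeProd prec q)}

/-- `Φ_r(w, q)`, the sum of `w(a r)` over all nonzero ideals `a` coprime to `Π(q)`. -/
def Phi (prec : PrimeId K → PrimeId K → Prop) (w : NzIdeal K → ℝ) (r : NzIdeal K)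
    (q : PrimeId K) : ℝ :=
  ∑' a : sifted prec q, w ((a : NzIdeal K) * r)

/-! ### The three conditions on a weight -/

/-- For `N(r) ≤ N / 2` and `y = N / N(r)`, the sum of `w(r s)` over all nonzero primes `s` converges
to `y / log y * (1 + E)` with `|E| ≤ A * log log N / log y`. -/
def PrimeAverageCond (A N : ℝ) (w : NzIdeal K → ℝ) : Prop :=
  ∀ r : NzIdeal K, nrm r ≤ N / 2 →
    ∃ E : ℝ, |E| ≤ A * (Real.log (Real.log N) / Real.log (N / nrm r)) ∧
      HasSum (fun s : PrimeId K => w (r * s.toNz))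
        (N / nrm r / Real.log (N / nrm r) * (1 + E))

/-- For every `δ > 0`: if `N(p) ≥ N ^ δ` and `N(r) ≤ N / 2`, the sum of `w(r s)` over all primes
`s` preceding `p` is at most `A δ * N(p) / log N(p)`. -/
def PartialSumCond (prec : PrimeId K → PrimeId K → Prop) (A : ℝ → ℝ) (N : ℝ)
    (w : NzIdeal K → ℝ) : Prop :=
  ∀ δ : ℝ, 0 < δ → ∀ (p : PrimeId K) (r : NzIdeal K), N ^ δ ≤ nrm p.toNz → nrm r ≤ N / 2 →
    ∑' s : {s : PrimeId K | prec s p}, w (r * (s : PrimeId K).toNz)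
      ≤ A δ * (nrm p.toNz / Real.log (nrm p.toNz))

/-- For `N(r) ≤ N / 2` and `y = N / N(r)`, the sum of `w(a r)` over all nonzero ideals `a` with
`N(a r) > N (log N) ^ ξ` converges and is at most `A * y / (log y) ^ 2`. -/
def TailCond (ξ A N : ℝ) (w : NzIdeal K → ℝ) : Prop :=
  ∀ r : NzIdeal K, nrm r ≤ N / 2 →
    Summable (fun a : {a : NzIdeal K | N * Real.log N ^ ξ < nrm (a * r)} =>
      w ((a : NzIdeal K) * r)) ∧
    ∑' a : {a : NzIdeal K | N * Real.log N ^ ξ < nrm (a * r)}, w ((a : NzIdeal K) * r)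
      ≤ A * (N / nrm r / Real.log (N / nrm r) ^ 2)

end IdealSieve

end

/-! The engine is Buchstab's identity. Every ideal other than 1 that is coprime to Π(p) is, in
exactly one way, s·b with s its least prime divisor, s not before p, and b free of primes before s.
The ideals with b = 1 give the sum of W over primes, which (1) and (2) evaluate as y / log y. If b ≠
1 then N(s)² ≤ N(sb), so either the ideal falls into the tail (3) or N(s)² ≤ y (log N)^ξ; in the
latter case the terms with a given s add up to Φ_{rs}(s) − W(rs). Keeping this difference together
means that no bound for W(rs) is ever needed.

This allows an induction on n with u ≤ n (`SieveEstimate`, `SieveEstimate.succ`): passing from (r,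
p) to (rs, s) replaces y by y / N(s) and u by log y / log N(s) − 1. Since y / N(s) ≥ √y when N(s)² ≤
y, only N^(ε/2) remains as a lower bound, so the induction hypothesis is taken for all ε. The window
y < N(s)² ≤ y (log N)^ξ has Mertens mass O(log log N), and there Φ_{rs}(s) − W(rs) is bounded
crudely by (1) and (3).

Summing the main terms needs only Mertens' theorem for prime ideals with error O(1)
(`exists_abs_sum_log_nrm_div_sub_log_le`): the weight B(Y/t − 1)/t², with Y = log y and t = log
N(s), is Lipschitz, so partial summation turns the sum into an integral that equals (u B(u) − 1)/Y,
with error O(1/Y²) (`abs_sum_buchstab_sub_le`). Adding 1/Y gives B(u) / log N(p).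

The estimate carries a second error N(p) / log N(p), coming from (2). Summed over N(s) ≤ √y it is
O(y / log² y) by a Chebyshev bound; in the theorem itself u ≥ α > 1 makes it a power of y smaller
than y.

Mertens' theorem comes from evaluating the sum of log N(a) over N(a) ≤ x in two ways, which uses the
ideal count κx + O(x^(1−η)). That count is a lattice point count in a dilated fundamental domain
whose boundary layer of width δ has volume O(√δ) (`exists_volume_boundaryLayer_normLeOne_le`). -/

noncomputable section

namespace IdealSieve

open MeasureTheory Pointwise Bornology

/-! ### Lattice points in dilated bounded sets -/

section LatticeCount

variable {E : Type*} [NormedAddCommGroup E]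

/-- The points `x` for which some translate `x + h` with `‖h‖ ≤ δ` lies on the other side of the
boundary of `S`. -/
def boundaryLayer (S : Set E) (δ : ℝ) : Set E :=
  {x | ∃ h, ‖h‖ ≤ δ ∧ ¬(x ∈ S ↔ x + h ∈ S)}

theorem boundaryLayer_subset_closedBall {S : Set E} {ρ δ : ℝ}
    (hS : ∀ x ∈ S, ‖x‖ ≤ ρ) : boundaryLayer S δ ⊆ Metric.closedBall 0 (ρ + δ) := by
  rintro x ⟨h, hh, hx⟩
  rw [mem_closedBall_zero_iff]
  have h0 : 0 ≤ δ := (norm_nonneg h).trans hh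
  by_cases hxS : x ∈ S
  · linarith [hS x hxS]
  · have hxh : x + h ∈ S := by tauto
    have h1 := hS _ hxh
    have h2 : ‖x‖ ≤ ‖x + h‖ + ‖h‖ := by simpa using norm_sub_le (x + h) h
    linarith

variable [NormedSpace ℝ E]

theorem boundaryLayer_smul (S : Set E) (δ : ℝ) {t : ℝ} (ht : 0 < t) :
    boundaryLayer (t • S) δ = t • boundaryLayer S (δ / t) := by
  ext x
  rw [Set.mem_smul_set_iff_inv_smul_mem₀ ht.ne']
  simp only [boundaryLayer, Set.mem_ofPred_eq, Set.mem_smul_set_iff_inv_smul_mem₀ ht.ne', smul_add]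
  constructor
  · rintro ⟨h, hh, hx⟩
    refine ⟨t⁻¹ • h, ?_, hx⟩
    rw [norm_smul, norm_inv, Real.norm_of_nonneg ht.le, inv_mul_eq_div]
    gcongr
  · rintro ⟨h, hh, hx⟩
    refine ⟨t • h, ?_, ?_⟩
    · rw [norm_smul, Real.norm_of_nonneg ht.le, mul_comm]
      exact (le_div_iff₀ ht).1 hh
    · rwa [inv_smul_smul₀ ht.ne']

variable [FiniteDimensional ℝ E] [MeasurableSpace E] [BorelSpace E] (μ : Measure E)
  [μ.IsAddHaarMeasure]

/-- Attach to each lattice point of S its translated fundamental domain. The union has volume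
(number of points) · vol(F), and it differs from S only at points whose cell corner, at distance at
most R, lies on the other side of the boundary of S. -/
theorem abs_card_inter_span_mul_sub_le {ι : Type*} [Fintype ι] (b : Module.Basis ι ℝ E) {R : ℝ}
    (hR : ∀ x ∈ ZSpan.fundamentalDomain b, ‖x‖ ≤ R) {S : Set E}
    (hSb : IsBounded S) :
    |(Nat.card (S ∩ (Submodule.span ℤ (Set.range b) : Set E) : Set E) : ℝ) *
        μ.real (ZSpan.fundamentalDomain b) - μ.real S| ≤ μ.real (boundaryLayer S R) := by
  set L := Submodule.span ℤ (Set.range b)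
  set F := ZSpan.fundamentalDomain b
  have hfin : (S ∩ (L : Set E)).Finite := ZSpan.setFinite_inter b hSb
  have hFm : MeasurableSet F := ZSpan.fundamentalDomain_measurableSet b
  have hFb : IsBounded F := ZSpan.fundamentalDomain_isBounded b
  set T := hfin.toFinset with hT
  have hTm : ∀ ℓ, ℓ ∈ T ↔ ℓ ∈ S ∧ ℓ ∈ L := fun ℓ => by simp [hT]
  set U : Set E := ⋃ ℓ ∈ T, (ℓ +ᵥ F)
  obtain ⟨ρ, hρ⟩ := hSb.exists_norm_le
  have hVfin : μ (boundaryLayer S R) ≠ ⊤ :=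
    ((measure_mono (boundaryLayer_subset_closedBall hρ)).trans_lt
      (Metric.isBounded_closedBall.measure_lt_top)).ne
  have hSfin : μ S ≠ ⊤ := hSb.measure_lt_top.ne
  have hdisj : Set.PairwiseDisjoint (T : Set E) (fun ℓ => ℓ +ᵥ F) := by
    intro a ha c hc hac
    rw [Function.onFun, Set.disjoint_left]
    intro x hxa hxc
    rw [Set.mem_vadd_set_iff_neg_vadd_mem] at hxa hxc
    have huniq := (ZSpan.exist_unique_vadd_mem_fundamentalDomain b x).unique
      (y₁ := ⟨-a, neg_mem ((hTm a).1 ha).2⟩) (y₂ := ⟨-c, neg_mem ((hTm c).1 hc).2⟩) hxa hxc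
    exact hac (neg_injective (Subtype.ext_iff.1 huniq))
  have hUeq : μ.real U = (T.card : ℝ) * μ.real F := by
    rw [measureReal_biUnion_finset hdisj (fun ℓ _ => hFm.const_vadd ℓ)
      (fun ℓ _ => by rw [measure_vadd]; exact hFb.measure_lt_top.ne)]
    simp [measureReal_def, measure_vadd]
  have hUfin : μ U ≠ ⊤ := by
    refine (measure_biUnion_lt_top T.finite_toSet fun ℓ _ => ?_).ne
    rw [measure_vadd]
    exact hFb.measure_lt_top
  have hUS : U \ S ⊆ boundaryLayer S R := by
    rintro x ⟨hxU, hxS⟩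
    obtain ⟨ℓ, hℓ, hx⟩ := Set.mem_iUnion₂.1 hxU
    obtain ⟨f, hf, rfl⟩ := Set.mem_vadd_set.1 hx
    refine ⟨-f, by rw [norm_neg]; exact hR f hf, ?_⟩
    have := ((hTm ℓ).1 hℓ).1
    simp only [vadd_eq_add] at hxS ⊢
    rw [add_neg_cancel_right]
    tauto
  have hSU : S \ U ⊆ boundaryLayer S R := by
    rintro x ⟨hxS, hxU⟩
    have hfl : x = (ZSpan.floor b x : E) + ZSpan.fract b x := by
      rw [ZSpan.fract_apply]; abel
    have hfr : ZSpan.fract b x ∈ F := ZSpan.fract_mem_fundamentalDomain b x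
    refine ⟨-ZSpan.fract b x, by rw [norm_neg]; exact hR _ hfr, fun hiff => hxU ?_⟩
    have h1 : (ZSpan.floor b x : E) ∈ S := by
      have := hiff.1 hxS
      rwa [← sub_eq_add_neg, show x - ZSpan.fract b x = (ZSpan.floor b x : E) from by
        rw [ZSpan.fract_apply]; abel] at this
    refine Set.mem_iUnion₂.2 ⟨_, (hTm _).2 ⟨h1, (ZSpan.floor b x).2⟩, ?_⟩
    exact Set.mem_vadd_set.2 ⟨_, hfr, hfl.symm⟩
  have hcard : (Nat.card (S ∩ (L : Set E) : Set E) : ℝ) = T.card := by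
    rw [Nat.card_coe_set_eq, Set.ncard_eq_toFinset_card _ hfin]
  rw [hcard, ← hUeq, abs_sub_le_iff]
  constructor
  · have h1 : μ.real U ≤ μ.real S + μ.real (U \ S) := by
      refine (measureReal_mono (s₂ := S ∪ (U \ S)) (by intro x hx; by_cases h : x ∈ S <;> simp [h, hx])
        (measure_union_ne_top hSfin (ne_top_of_le_ne_top hUfin (measure_mono Set.sdiff_subset)))).trans
        (measureReal_union_le _ _)
    have h2 := measureReal_mono hUS hVfin
    linarith
  · have h1 : μ.real S ≤ μ.real U + μ.real (S \ U) := by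
      refine (measureReal_mono (s₂ := U ∪ (S \ U)) (by intro x hx; by_cases h : x ∈ U <;> simp [h, hx])
        (measure_union_ne_top hUfin (ne_top_of_le_ne_top hSfin (measure_mono Set.sdiff_subset)))).trans
        (measureReal_union_le _ _)
    have h2 := measureReal_mono hSU hVfin
    linarith

/-- Dilating by t turns width R into width R / t, so the boundary error is t^d · O(√(R / t)). -/
theorem exists_abs_card_smul_inter_span_sub_le {ι : Type*} [Fintype ι] (b : Module.Basis ι ℝ E)
    {S : Set E} (hSb : IsBounded S)
    (hbd : ∃ C : ℝ, ∀ δ : ℝ, 0 < δ → δ ≤ 1 → μ.real (boundaryLayer S δ) ≤ C * √δ) :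
    ∃ κ C : ℝ, ∀ t : ℝ, 1 ≤ t →
      |(Nat.card (t • S ∩ (Submodule.span ℤ (Set.range b) : Set E) : Set E) : ℝ) -
        κ * t ^ Module.finrank ℝ E| ≤ C * (t ^ Module.finrank ℝ E / √t) := by
  obtain ⟨C, hC⟩ := hbd
  obtain ⟨R₀, hR₀⟩ := (ZSpan.fundamentalDomain_isBounded b).exists_norm_le
  set R := max 1 R₀
  have hR1 : 1 ≤ R := le_max_left _ _
  have hR : ∀ x ∈ ZSpan.fundamentalDomain b, ‖x‖ ≤ R := fun x hx => (hR₀ x hx).trans (le_max_right _ _)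
  obtain ⟨ρ, hρ⟩ := hSb.exists_norm_le
  set m := μ.real (ZSpan.fundamentalDomain b)
  have hm : 0 < m := ENNReal.toReal_pos (ZSpan.measure_fundamentalDomain_ne_zero b)
    (ZSpan.fundamentalDomain_isBounded b).measure_lt_top.ne
  set V := μ.real (Metric.closedBall (0 : E) (ρ + R))
  set d := Module.finrank ℝ E
  -- For 1 ≤ t < R the width R / t exceeds 1, where the hypothesis is silent; the volume of a large
  -- ball serves there.
  have hall : ∀ δ : ℝ, 0 < δ → δ ≤ R → μ.real (boundaryLayer S δ) ≤ (|C| + V) * √δ := by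
    intro δ h0 hδ
    rcases le_or_gt δ 1 with h1 | h1
    · refine (hC δ h0 h1).trans ?_
      have : 0 ≤ V := measureReal_nonneg
      gcongr
      linarith [le_abs_self C]
    · have h2 : μ.real (boundaryLayer S δ) ≤ V := by
        refine measureReal_mono ((boundaryLayer_subset_closedBall hρ).trans
          (Metric.closedBall_subset_closedBall (by linarith)))
          Metric.isBounded_closedBall.measure_lt_top.ne
      have h3 : 1 ≤ √δ := by rw [Real.one_le_sqrt]; exact h1.le
      have : 0 ≤ V := measureReal_nonneg
      nlinarith [abs_nonneg C]
  refine ⟨μ.real S / m, (|C| + V) * √R / m, fun t ht => ?_⟩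
  have ht0 : 0 < t := by linarith
  have h1 := abs_card_inter_span_mul_sub_le μ b hR (S := t • S) (hSb.smul₀ t)
  have hsm : ∀ A : Set E, μ.real (t • A) = t ^ d * μ.real A := by
    intro A
    rw [measureReal_def, Measure.addHaar_smul, ENNReal.toReal_mul,
      ENNReal.toReal_ofReal (abs_nonneg _), abs_of_nonneg (by positivity), measureReal_def]
  rw [boundaryLayer_smul _ _ ht0, hsm, hsm] at h1
  have h2 := hall (R / t) (by positivity) (div_le_self (by linarith) ht)
  rw [Real.sqrt_div (by linarith)] at h2
  set n := (Nat.card (t • S ∩ (Submodule.span ℤ (Set.range b) : Set E) : Set E) : ℝ)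
  have h3 : n - μ.real S / m * t ^ d = (n * m - t ^ d * μ.real S) / m := by
    field_simp
  rw [h3, abs_div, abs_of_pos hm, div_le_iff₀ hm]
  refine h1.trans ?_
  calc t ^ d * μ.real (boundaryLayer S (R / t)) ≤ t ^ d * ((|C| + V) * (√R / √t)) := by gcongr
    _ = _ := by field_simp

end LatticeCount

/-! ### Thin sets via disjoint copies -/

section DisjointCopies

/-- A packing argument: n disjoint copies, none smaller than T, fit into B. It bounds the volume of
a slab of width η by O(η) without Fubini or a change of variables. -/
theorem nsmul_measureReal_le_of_disjoint_images {E : Type*} [MeasurableSpace E] (μ : Measure E)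
    {T B : Set E} (n : ℕ) (D : ℕ → E → E) (hm : ∀ j < n, MeasurableSet (D j '' T))
    (hd : ∀ i j, i < j → j < n → Disjoint (D i '' T) (D j '' T))
    (hB : ∀ j < n, D j '' T ⊆ B) (hBfin : μ B ≠ ⊤)
    (hμ : ∀ j < n, μ.real T ≤ μ.real (D j '' T)) : n * μ.real T ≤ μ.real B := by
  have h1 : μ.real (⋃ j ∈ Finset.range n, D j '' T) = ∑ j ∈ Finset.range n, μ.real (D j '' T) := by
    refine measureReal_biUnion_finset ?_ (fun j hj => hm j (Finset.mem_range.1 hj))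
      (fun j hj => ne_top_of_le_ne_top hBfin (measure_mono (hB j (Finset.mem_range.1 hj))))
    intro i hi j hj hij
    rw [Finset.mem_coe, Finset.mem_range] at hi hj
    rcases lt_or_gt_of_ne hij with h | h
    · exact hd i j h hj
    · exact (hd j i h hi).symm
  calc (n : ℝ) * μ.real T = ∑ j ∈ Finset.range n, μ.real T := by simp
    _ ≤ ∑ j ∈ Finset.range n, μ.real (D j '' T) :=
      Finset.sum_le_sum fun j hj => hμ j (Finset.mem_range.1 hj)
    _ = _ := h1.symm
    _ ≤ μ.real B := measureReal_mono (Set.iUnion₂_subset fun j hj => hB j (Finset.mem_range.1 hj)) hBfin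

end DisjointCopies

end IdealSieve
end

noncomputable section

namespace IdealSieve

/-! ### The boundary layer of the norm-one part of the fundamental cone -/

section NormLeOneBoundary

open scoped Classical

open MeasureTheory NumberField NumberField.InfinitePlace NumberField.mixedEmbedding
  NumberField.Units NumberField.mixedEmbedding.fundamentalCone
  NumberField.Units.dirichletUnitTheorem

variable {K : Type*} [Field K] [NumberField K]

/-- The coordinates of the logarithmic embedding of `x` in the basis formed of `(mult w)_w` and of
the fundamental units. -/
def logCoord (x : mixedSpace K) (i : InfinitePlace K) : ℝ :=
  (completeBasis K).equivFun (fun w => w.mult * Real.log (normAtPlace w x)) i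

theorem expMapBasis_logCoord {x : mixedSpace K} (hx : ∀ w, 0 < normAtPlace w x) :
    expMapBasis (logCoord x) = normAtAllPlaces x := by
  have h : logCoord x = (completeBasis K).equivFun (expMap.symm (normAtAllPlaces x)) := rfl
  rw [expMapBasis_apply, h, LinearEquiv.symm_apply_apply]
  exact expMap.right_inv (by
    rw [expMap_target]
    exact Set.mem_univ_pi.2 fun w => hx w)

/-- In logarithmic coordinates the set is a box, because `expMapBasis` is injective. Leaving it
means that a single coordinate crosses 0 or 1. -/
theorem mem_normLeOne_iff_logCoord {x : mixedSpace K} (hx : ∀ w, 0 < normAtPlace w x) :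
    x ∈ normLeOne K ↔
      ∀ w, logCoord x w ∈ (if w = w₀ then Set.Iic 0 else Set.Ico 0 1 : Set ℝ) := by
  rw [normLeOne_eq_preimage, Set.mem_preimage, ← expMapBasis_logCoord hx,
    (injective_expMapBasis K).mem_set_image]
  simp [paramSet]

theorem exists_abs_logCoord_sub_le (K : Type*) [Field K] [NumberField K] :
    ∃ C : ℝ, 0 < C ∧ ∀ (x y : mixedSpace K) (η : ℝ),
      (∀ w, |Real.log (normAtPlace w x) - Real.log (normAtPlace w y)| ≤ η) →
      ∀ i, |logCoord x i - logCoord y i| ≤ C * η := by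
  -- The 2 bounds the multiplicity of a place; the 1 only makes the constant positive.
  refine ⟨‖((completeBasis K).equivFunL : realSpace K →L[ℝ] realSpace K)‖ * 2 + 1, by positivity,
    fun x y η h i => ?_⟩
  have hη : 0 ≤ η := (abs_nonneg _).trans (h i)
  set f : mixedSpace K → realSpace K := fun x w => w.mult * Real.log (normAtPlace w x) with hf
  have h1 : logCoord x i - logCoord y i = ((completeBasis K).equivFunL (f x - f y)) i := by
    rw [map_sub]; rfl
  have h2 : ‖f x - f y‖ ≤ 2 * η := by
    refine (pi_norm_le_iff_of_nonneg (by positivity)).2 fun w => ?_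
    have h3 : (f x - f y) w = w.mult * (Real.log (normAtPlace w x) - Real.log (normAtPlace w y)) := by
      simp [hf, mul_sub]
    have h4 : (w.mult : ℝ) ≤ 2 := by
      have : w.mult ≤ 2 := by unfold InfinitePlace.mult; split_ifs <;> norm_num
      exact_mod_cast this
    rw [h3, Real.norm_eq_abs, abs_mul, abs_of_nonneg (Nat.cast_nonneg _)]
    gcongr
    exact h w
  rw [h1, ← Real.norm_eq_abs]
  refine (norm_le_pi_norm _ i).trans ?_
  refine (((completeBasis K).equivFunL : realSpace K →L[ℝ] realSpace K).le_opNorm _).trans ?_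
  have : 0 ≤ ‖((completeBasis K).equivFunL : realSpace K →L[ℝ] realSpace K)‖ := norm_nonneg _
  nlinarith

theorem norm_le_iff_normAtPlace {x : mixedSpace K} {ρ : ℝ} :
    ‖x‖ ≤ ρ ↔ ∀ w, normAtPlace w x ≤ ρ := by
  rw [norm_eq_sup'_normAtPlace]
  simp

/-- The element of `mixedSpace K` which is `a` at the place `w` and `b` at the other places. -/
def placeVec (w : InfinitePlace K) (a b : ℝ) : mixedSpace K :=
  mixedSpaceOfRealSpace fun v => if v = w then a else b

omit [NumberField K] in
theorem normAtPlace_placeVec (w v : InfinitePlace K) {a b : ℝ} (ha : 0 ≤ a) (hb : 0 ≤ b) :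
    normAtPlace v (placeVec w a b) = if v = w then a else b := by
  rw [placeVec, normAtPlace_mixedSpaceOfRealSpace]
  split_ifs <;> assumption

theorem measurable_normAtPlace (w : InfinitePlace K) :
    Measurable (fun x : mixedSpace K => normAtPlace w x) :=
  (continuous_normAtPlace w).measurable

/-- Translates by multiples of 4η along the place w are disjoint, since two points of the set differ
by less than 4η at w. About 1 / (4η) of them stay in the ball of radius ρ + 1. -/
theorem exists_volume_normAtPlace_lt_le (w : InfinitePlace K) (ρ : ℝ) :
    ∃ C : ℝ, 0 ≤ C ∧ ∀ η : ℝ, 0 < η →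
      volume.real {x : mixedSpace K | ‖x‖ ≤ ρ ∧ normAtPlace w x < 2 * η} ≤ C * η := by
  set V := volume.real (Metric.closedBall (0 : mixedSpace K) (ρ + 1))
  have hV : 0 ≤ V := measureReal_nonneg
  refine ⟨4 * V, by positivity, fun η hη => ?_⟩
  set T := {x : mixedSpace K | ‖x‖ ≤ ρ ∧ normAtPlace w x < 2 * η}
  have hTm : MeasurableSet T :=
    (measurableSet_le measurable_norm measurable_const).inter
      (measurableSet_lt (measurable_normAtPlace w) measurable_const)
  set n := ⌈1 / (4 * η)⌉₊
  have hn : 1 / (4 * η) ≤ n := Nat.le_ceil _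
  set D : ℕ → mixedSpace K → mixedSpace K := fun j x => (4 * η * j) • placeVec w 1 0 + x with hD
  have hDi : ∀ j, D j '' T = (fun x => (4 * η * j) • placeVec w 1 0 + x) '' T := fun j => rfl
  have hpv : ‖(placeVec w 1 0 : mixedSpace K)‖ ≤ 1 := norm_le_iff_normAtPlace.2 fun v => by
    rw [normAtPlace_placeVec _ _ zero_le_one le_rfl]; split_ifs <;> norm_num
  have key := nsmul_measureReal_le_of_disjoint_images volume (T := T)
    (B := Metric.closedBall (0 : mixedSpace K) (ρ + 1)) n D (fun j _ => ?_) ?_ ?_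
    Metric.isBounded_closedBall.measure_lt_top.ne (fun j _ => ?_)
  · have h1 : 1 / (4 * η) * volume.real T ≤ V :=
      (mul_le_mul_of_nonneg_right hn measureReal_nonneg).trans key
    rw [div_mul_eq_mul_div, one_mul, div_le_iff₀ (by positivity)] at h1
    linarith
  · rw [hDi, Set.image_add_left]
    exact measurable_const_add _ hTm
  · intro i j hij hj
    rw [Set.disjoint_left]
    rintro _ ⟨x, hx, rfl⟩ ⟨y, hy, hxy⟩
    have h1 : x - y = (4 * η * ((j : ℝ) - i)) • placeVec w 1 0 := by
      simp only [hD] at hxy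
      rw [mul_sub, sub_smul, sub_eq_sub_iff_add_eq_add, add_comm, ← hxy, add_comm]
    have hij' : (1 : ℝ) ≤ (j : ℝ) - i := by
      have : (i : ℝ) + 1 ≤ j := by exact_mod_cast hij
      linarith
    have h2 : normAtPlace w (x - y) = 4 * η * ((j : ℝ) - i) := by
      rw [h1, normAtPlace_smul, normAtPlace_placeVec _ _ zero_le_one le_rfl, if_pos rfl, mul_one,
        abs_of_nonneg (by positivity)]
    have h3 : normAtPlace w (x - y) ≤ normAtPlace w x + normAtPlace w y := by
      rw [sub_eq_add_neg, ← normAtPlace_neg w y]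
      exact normAtPlace_add_le w x (-y)
    have h4 := hx.2
    have h5 := hy.2
    nlinarith
  · rintro j hj _ ⟨x, hx, rfl⟩
    rw [mem_closedBall_zero_iff]
    have hj1 : (j : ℝ) * (4 * η) < 1 := by
      have := Nat.lt_ceil.1 hj
      rwa [lt_div_iff₀ (by positivity)] at this
    calc ‖D j x‖ ≤ ‖(4 * η * j) • placeVec w 1 0‖ + ‖x‖ := norm_add_le _ _
      _ ≤ 1 + ρ := by
        refine add_le_add ?_ hx.1
        rw [_root_.norm_smul, Real.norm_of_nonneg (by positivity)]
        nlinarith [norm_nonneg (placeVec w 1 0 : mixedSpace K)]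
      _ = ρ + 1 := add_comm _ _
  · rw [hDi, measureReal_def, measureReal_def, Set.image_add_left, measure_preimage_add]

/-- Otherwise the i-th coordinate functional would vanish on the standard basis, yet it is 1 on the
i-th vector of `completeBasis K`. -/
theorem exists_equivFun_single_ne_zero (i : InfinitePlace K) :
    ∃ w : InfinitePlace K, (completeBasis K).equivFun (Pi.single w 1) i ≠ 0 := by
  by_contra! h
  have h0 : (LinearMap.proj i : realSpace K →ₗ[ℝ] ℝ) ∘ₗ
      ((completeBasis K).equivFun : realSpace K →ₗ[ℝ] realSpace K) = 0 := by
    refine LinearMap.pi_ext' fun w => LinearMap.ext_ring ?_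
    simpa using! h w
  have h1 := LinearMap.congr_fun h0 (completeBasis K i)
  simp at h1

/-- The increment of the `i`-th logarithmic coordinate when the coordinate at `w` is multiplied
by `e`. -/
def logCoordStep (w i : InfinitePlace K) : ℝ :=
  w.mult * (completeBasis K).equivFun (Pi.single w 1) i

theorem exists_logCoordStep_ne_zero (i : InfinitePlace K) :
    ∃ w : InfinitePlace K, logCoordStep w i ≠ 0 := by
  obtain ⟨w, hw⟩ := exists_equivFun_single_ne_zero i
  exact ⟨w, mul_ne_zero mult_coe_ne_zero hw⟩

omit [NumberField K] in
theorem normAtPlace_placeVec_exp_pos (w v : InfinitePlace K) (θ : ℝ) :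
    0 < normAtPlace v (placeVec w (Real.exp θ) 1 : mixedSpace K) := by
  rw [normAtPlace_placeVec _ _ (Real.exp_pos _).le zero_le_one]
  split_ifs <;> positivity

theorem logCoord_placeVec_mul (w : InfinitePlace K) (θ : ℝ) {x : mixedSpace K}
    (hx : ∀ w, 0 < normAtPlace w x) (i : InfinitePlace K) :
    logCoord (placeVec w (Real.exp θ) 1 * x) i = logCoord x i + θ * logCoordStep w i := by
  have h : (fun v : InfinitePlace K =>
      (v.mult : ℝ) * Real.log (normAtPlace v (placeVec w (Real.exp θ) 1 * x))) =
      (fun v : InfinitePlace K => (v.mult : ℝ) * Real.log (normAtPlace v x)) +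
        (θ * w.mult) • Pi.single w 1 := by
    funext v
    rw [map_mul, Real.log_mul (normAtPlace_placeVec_exp_pos w v θ).ne' (hx v).ne',
      normAtPlace_placeVec _ _ (Real.exp_pos _).le zero_le_one]
    by_cases hv : v = w
    · subst hv; simp; ring
    · simp [hv]
  rw [logCoord, h, map_add, map_smul, logCoord, logCoordStep]
  simp only [Pi.add_apply, Pi.smul_apply, smul_eq_mul]
  ring

theorem measurable_logCoord (i : InfinitePlace K) :
    Measurable (fun x : mixedSpace K => logCoord x i) := by
  have h1 : Measurable (fun x : mixedSpace K => fun w : InfinitePlace K =>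
      (w.mult : ℝ) * Real.log (normAtPlace w x)) :=
    measurable_pi_lambda _ fun w =>
      (Real.measurable_log.comp (measurable_normAtPlace w)).const_mul _
  exact (measurable_pi_apply i).comp
    ((completeBasis K).equivFunL.continuous.measurable.comp h1)

omit [NumberField K] in
theorem placeVec_exp_mul (w : InfinitePlace K) (θ θ' : ℝ) :
    (placeVec w (Real.exp θ) 1 * placeVec w (Real.exp θ') 1 : mixedSpace K) =
      placeVec w (Real.exp (θ + θ')) 1 := by
  rw [placeVec, placeVec, placeVec]
  ext v
  · simp only [mixedSpaceOfRealSpace_apply, Prod.fst_mul, Pi.mul_apply]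
    split_ifs <;> simp [Real.exp_add]
  · simp only [mixedSpaceOfRealSpace_apply, Prod.snd_mul, Pi.mul_apply]
    split_ifs <;> simp [Complex.exp_add]

omit [NumberField K] in
theorem placeVec_one_one (w : InfinitePlace K) : (placeVec w 1 1 : mixedSpace K) = 1 := by
  rw [placeVec]
  ext v
  · simp [mixedSpaceOfRealSpace_apply]
  · simp [mixedSpaceOfRealSpace_apply]

/-- The inverse multiplication maps the unit ball into itself, so its determinant is at most 1 in
absolute value; the determinant need not be computed. -/
theorem volume_le_volume_placeVec_mul_image (w : InfinitePlace K) {θ : ℝ} (hθ : 0 ≤ θ)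
    (T : Set (mixedSpace K)) :
    volume T ≤ volume ((fun x => placeVec w (Real.exp θ) 1 * x) '' T) := by
  set f : mixedSpace K →ₗ[ℝ] mixedSpace K := LinearMap.mulLeft ℝ (placeVec w (Real.exp (-θ)) 1)
  have hdet : ENNReal.ofReal |LinearMap.det f| ≤ 1 := by
    have h1 := Measure.addHaar_image_linearMap volume f (Metric.closedBall (0 : mixedSpace K) 1)
    have h2 : volume (f '' Metric.closedBall (0 : mixedSpace K) 1) ≤
        volume (Metric.closedBall (0 : mixedSpace K) 1) := by
      refine measure_mono ?_
      rintro _ ⟨x, hx, rfl⟩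
      rw [mem_closedBall_zero_iff, norm_le_iff_normAtPlace] at hx ⊢
      intro v
      have h3 : normAtPlace v (placeVec w (Real.exp (-θ)) 1 : mixedSpace K) ≤ 1 := by
        rw [normAtPlace_placeVec _ _ (Real.exp_pos _).le zero_le_one]
        split_ifs
        · exact Real.exp_le_one_iff.2 (by linarith)
        · exact le_rfl
      rw [LinearMap.mulLeft_apply, map_mul]
      exact mul_le_one₀ h3 (normAtPlace_nonneg _ _) (hx v)
    rw [h1] at h2
    by_contra! h4
    have h5 := ENNReal.mul_lt_mul_left
      (Metric.measure_closedBall_pos volume (0 : mixedSpace K) one_pos).ne'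
      (Metric.isBounded_closedBall.measure_lt_top
        (μ := volume) (s := Metric.closedBall (0 : mixedSpace K) 1)).ne h4
    rw [one_mul] at h5
    exact absurd h2 (not_le.2 h5)
  have hT : T = f '' ((fun x => placeVec w (Real.exp θ) 1 * x) '' T) := by
    rw [Set.image_image]
    simp [f, ← mul_assoc, placeVec_exp_mul, placeVec_one_one]
  calc volume T = ENNReal.ofReal |LinearMap.det f| *
        volume ((fun x => placeVec w (Real.exp θ) 1 * x) '' T) := by
        conv_lhs => rw [hT, Measure.addHaar_image_linearMap]
    _ ≤ 1 * _ := by gcongr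
    _ = _ := one_mul _

/-- Multiplying one suitable place by exp(3ηj / a) moves the i-th logarithmic coordinate by 3ηj in
absolute value, more than the slab's width 2η, so the images are disjoint. Taking j < a / (3η)
enlarges norms at most by the factor e. -/
theorem exists_volume_logCoord_slab_le (i : InfinitePlace K) (ρ : ℝ) :
    ∃ C : ℝ, 0 ≤ C ∧ ∀ c η : ℝ, 0 < η →
      volume.real {x : mixedSpace K | ‖x‖ ≤ ρ ∧ (∀ w, 0 < normAtPlace w x) ∧
        |logCoord x i - c| ≤ η} ≤ C * η := by
  obtain ⟨w, hw⟩ := exists_logCoordStep_ne_zero i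
  set a := |logCoordStep w i| with ha_def
  have ha : 0 < a := abs_pos.2 hw
  set B := Metric.closedBall (0 : mixedSpace K) (Real.exp 1 * ρ)
  set V := volume.real B
  have hV : 0 ≤ V := measureReal_nonneg
  refine ⟨3 * V / a, by positivity, fun c η hη => ?_⟩
  set T := {x : mixedSpace K | ‖x‖ ≤ ρ ∧ (∀ w, 0 < normAtPlace w x) ∧ |logCoord x i - c| ≤ η}
  have hTm : MeasurableSet T := by
    refine (measurableSet_le measurable_norm measurable_const).inter (MeasurableSet.inter ?_
      (measurableSet_le (((measurable_logCoord i).sub_const c).abs) measurable_const))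
    have : {x : mixedSpace K | ∀ w, 0 < normAtPlace w x} =
        ⋂ w, {x : mixedSpace K | 0 < normAtPlace w x} := by ext; simp
    change MeasurableSet {x : mixedSpace K | ∀ w, 0 < normAtPlace w x}
    rw [this]
    exact MeasurableSet.iInter fun w => measurableSet_lt measurable_const (measurable_normAtPlace w)
  set n := ⌈a / (3 * η)⌉₊
  have hn : a / (3 * η) ≤ n := Nat.le_ceil _
  set D : ℕ → mixedSpace K → mixedSpace K :=
    fun j x => placeVec w (Real.exp (3 * η * j / a)) 1 * x with hD
  have hDi : ∀ j, D j '' T = (fun x => placeVec w (Real.exp (3 * η * j / a)) 1 * x) '' T :=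
    fun j => rfl
  have hθ1 : ∀ j < n, 3 * η * j / a ≤ 1 := by
    intro j hj
    have := Nat.lt_ceil.1 hj
    rw [lt_div_iff₀ (by positivity)] at this
    rw [div_le_one ha]
    linarith
  have hDB : ∀ j < n, D j '' T ⊆ B := by
    rintro j hj _ ⟨x, hx, rfl⟩
    rw [mem_closedBall_zero_iff, norm_le_iff_normAtPlace]
    intro v
    have h3 : normAtPlace v (placeVec w (Real.exp (3 * η * j / a)) 1 : mixedSpace K) ≤ Real.exp 1 := by
      rw [normAtPlace_placeVec _ _ (Real.exp_pos _).le zero_le_one]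
      split_ifs
      · exact Real.exp_le_exp.2 (hθ1 j hj)
      · exact Real.one_le_exp zero_le_one
    rw [hD, map_mul]
    exact mul_le_mul h3 (norm_le_iff_normAtPlace.1 hx.1 v) (normAtPlace_nonneg _ _)
      (Real.exp_pos _).le
  have hBfin : volume B ≠ ⊤ := Metric.isBounded_closedBall.measure_lt_top.ne
  have key := nsmul_measureReal_le_of_disjoint_images volume (T := T)
    (B := B) n D (fun j _ => ?_) ?_ hDB hBfin (fun j hj => ?_)
  · have h1 : a / (3 * η) * volume.real T ≤ V :=
      (mul_le_mul_of_nonneg_right hn measureReal_nonneg).trans key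
    rw [div_mul_eq_mul_div, div_le_iff₀ (by positivity)] at h1
    rw [div_mul_eq_mul_div, le_div_iff₀ ha]
    linarith
  · have : D j '' T = (fun x => placeVec w (Real.exp (-(3 * η * j / a))) 1 * x) ⁻¹' T := by
      refine congrFun (Set.image_eq_preimage_of_inverse (f := D j) (fun x => ?_) (fun x => ?_)) T
      · simp [hD, ← mul_assoc, placeVec_exp_mul, placeVec_one_one]
      · simp [hD, ← mul_assoc, placeVec_exp_mul, placeVec_one_one]
    rw [this]
    exact (measurable_const_mul _) hTm
  · intro k j hkj hj
    rw [Set.disjoint_left]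
    rintro _ ⟨x, hx, rfl⟩ ⟨y, hy, hxy⟩
    have h1 := congrArg (fun z => logCoord z i) hxy
    simp only [hD] at h1
    rw [logCoord_placeVec_mul w _ hx.2.1, logCoord_placeVec_mul w _ hy.2.1] at h1
    have hkj' : (1 : ℝ) ≤ (j : ℝ) - k := by
      have : (k : ℝ) + 1 ≤ j := by exact_mod_cast hkj
      linarith
    have h2 : logCoord x i - logCoord y i = 3 * η * ((j : ℝ) - k) / a * logCoordStep w i := by
      linear_combination (exp := 1) -h1
    have h3 : |logCoord x i - logCoord y i| = 3 * η * ((j : ℝ) - k) := by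
      rw [h2, abs_mul, abs_of_nonneg (by positivity), ← ha_def]
      field_simp
    have h4 : |logCoord x i - logCoord y i| ≤ |logCoord x i - c| + |logCoord y i - c| := by
      have := abs_sub (logCoord x i - c) (logCoord y i - c)
      simpa using this
    have h5 := hx.2.2
    have h6 := hy.2.2
    nlinarith
  · exact ENNReal.toReal_mono (ne_top_of_le_ne_top hBfin (measure_mono (hDB j hj)))
      (volume_le_volume_placeVec_mul_image w (by positivity) T)

/-- The relative change is at most δ / η ≤ η. Balancing it against the volume of the region where a
place is below 2η forces η = √δ, hence the √δ in the boundary estimate. -/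
theorem abs_log_sub_log_le {a b δ η : ℝ} (hη : 0 < η) (hδ : δ ≤ η * η) (ha : η ≤ a) (hb : η ≤ b)
    (hab : |a - b| ≤ δ) : |Real.log a - Real.log b| ≤ η := by
  have key : ∀ u v : ℝ, η ≤ u → η ≤ v → |u - v| ≤ δ → Real.log u - Real.log v ≤ η := by
    intro u v hu hv huv
    have hu0 : 0 < u := hη.trans_le hu
    have hv0 : 0 < v := hη.trans_le hv
    rw [← Real.log_div hu0.ne' hv0.ne']
    refine (Real.log_le_sub_one_of_pos (by positivity)).trans ?_
    rw [div_sub_one hv0.ne', div_le_iff₀ hv0]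
    nlinarith [le_abs_self (u - v)]
  rw [abs_sub_le_iff]
  exact ⟨key a b ha hb hab, key b a hb ha (by rwa [abs_sub_comm])⟩

theorem abs_normAtPlace_add_sub_le (w : InfinitePlace K) (x h : mixedSpace K) :
    |normAtPlace w (x + h) - normAtPlace w x| ≤ ‖h‖ := by
  have h0 : normAtPlace w h ≤ ‖h‖ := norm_le_iff_normAtPlace.1 le_rfl w
  have h1 := normAtPlace_add_le w x h
  have h2 := normAtPlace_add_le w (x + h) (-h)
  rw [add_neg_cancel_right, normAtPlace_neg] at h2
  rw [abs_sub_le_iff]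
  constructor <;> linarith

/-- With η = √δ, a point of the layer either has a place of size below 2η, or a shift by δ moves its
logarithmic coordinates by O(η), so that one of them is within O(η) of 0 or 1. Both kinds of sets
have volume O(η). -/
theorem exists_volume_boundaryLayer_normLeOne_le (K : Type*) [Field K] [NumberField K] :
    ∃ C : ℝ, ∀ δ : ℝ, 0 < δ → δ ≤ 1 →
      volume.real (boundaryLayer (normLeOne K) δ) ≤ C * √δ := by
  obtain ⟨ρ, hρ⟩ := (isBounded_normLeOne K).exists_norm_le
  obtain ⟨C₁, hC₁, hlip⟩ := exists_abs_logCoord_sub_le K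
  choose A hA0 hA using fun w : InfinitePlace K => exists_volume_normAtPlace_lt_le w (ρ + 1)
  choose B hB0 hB using fun i : InfinitePlace K => exists_volume_logCoord_slab_le i (ρ + 1)
  refine ⟨∑ w, (A w + 2 * (B w * C₁)), fun δ hδ hδ1 => ?_⟩
  set η := √δ with hη_def
  have hη : 0 < η := Real.sqrt_pos.2 hδ
  have hη2 : η * η = δ := Real.mul_self_sqrt hδ.le
  have hη1 : η ≤ 1 := Real.sqrt_le_one.2 hδ1
  set slab : InfinitePlace K → ℝ → Set (mixedSpace K) := fun i c =>
    {x | ‖x‖ ≤ ρ + 1 ∧ (∀ w, 0 < normAtPlace w x) ∧ |logCoord x i - c| ≤ C₁ * η}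
  set U : InfinitePlace K → Set (mixedSpace K) := fun w =>
    {x | ‖x‖ ≤ ρ + 1 ∧ normAtPlace w x < 2 * η} ∪ (slab w 0 ∪ slab w 1)
  have hsub : boundaryLayer (normLeOne K) δ ⊆ ⋃ w, U w := by
    intro x hx
    have hxρ : ‖x‖ ≤ ρ + 1 := by
      have := boundaryLayer_subset_closedBall hρ hx
      rw [mem_closedBall_zero_iff] at this
      linarith
    obtain ⟨h, hh, hne⟩ := hx
    by_cases hsmall : ∃ w, normAtPlace w x < 2 * η
    · obtain ⟨w, hw⟩ := hsmall
      exact Set.mem_iUnion.2 ⟨w, Or.inl ⟨hxρ, hw⟩⟩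
    push Not at hsmall
    have hdiff : ∀ w, |normAtPlace w (x + h) - normAtPlace w x| ≤ δ := fun w =>
      (abs_normAtPlace_add_sub_le w x h).trans hh
    have hbig : ∀ w, η ≤ normAtPlace w (x + h) := fun w => by
      have h1 := (abs_sub_le_iff.1 (hdiff w)).2
      nlinarith [hsmall w]
    have hx0 : ∀ w, 0 < normAtPlace w x := fun w => by linarith [hsmall w]
    have hxh0 : ∀ w, 0 < normAtPlace w (x + h) := fun w => hη.trans_le (hbig w)
    have hcoord := hlip (x + h) x η fun w =>
      abs_log_sub_log_le hη hη2.ge (hbig w) (by linarith [hsmall w]) (hdiff w)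
    rw [mem_normLeOne_iff_logCoord hx0, mem_normLeOne_iff_logCoord hxh0] at hne
    obtain ⟨i, hi⟩ : ∃ i, ¬(logCoord x i ∈ (if i = w₀ then Set.Iic 0 else Set.Ico 0 1 : Set ℝ) ↔
        logCoord (x + h) i ∈ (if i = w₀ then Set.Iic 0 else Set.Ico 0 1 : Set ℝ)) := by
      by_contra! hall
      exact hne (forall_congr' hall)
    have hci := abs_sub_le_iff.1 (hcoord i)
    refine Set.mem_iUnion.2 ⟨i, Or.inr ?_⟩
    suffices |logCoord x i - 0| ≤ C₁ * η ∨ |logCoord x i - 1| ≤ C₁ * η from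
      this.imp (fun h => ⟨hxρ, hx0, h⟩) (fun h => ⟨hxρ, hx0, h⟩)
    generalize logCoord x i = s at hi hci ⊢
    generalize logCoord (x + h) i = t at hi hci
    rw [abs_sub_le_iff, abs_sub_le_iff]
    split_ifs at hi <;> simp only [Set.mem_Iic, Set.mem_Ico] at hi <;> by_contra! hcon <;>
      apply hi <;> grind
  have hUfin : ∀ w, volume (U w) ≠ ⊤ := fun w => by
    refine ((measure_mono ?_).trans_lt
      (Metric.isBounded_closedBall (x := (0 : mixedSpace K)) (r := ρ + 1)).measure_lt_top).ne
    rintro x (hx | hx | hx) <;> exact mem_closedBall_zero_iff.2 hx.1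
  calc volume.real (boundaryLayer (normLeOne K) δ) ≤ volume.real (⋃ w, U w) :=
        measureReal_mono hsub ((measure_iUnion_fintype_le _ _).trans_lt
          (ENNReal.sum_lt_top.2 fun w _ => (hUfin w).lt_top)).ne
    _ ≤ ∑ w, volume.real (U w) := measureReal_iUnion_fintype_le _
    _ ≤ ∑ w, (A w + 2 * (B w * C₁)) * η := by
        refine Finset.sum_le_sum fun w _ => ?_
        have h1 := hA w η hη
        have h2 := hB w 0 (C₁ * η) (by positivity)
        have h3 := hB w 1 (C₁ * η) (by positivity)
        have h4 := measureReal_union_le (μ := volume)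
          {x : mixedSpace K | ‖x‖ ≤ ρ + 1 ∧ normAtPlace w x < 2 * η} (slab w 0 ∪ slab w 1)
        have h5 := measureReal_union_le (μ := volume) (slab w 0) (slab w 1)
        change volume.real (slab w 0) ≤ _ at h2
        change volume.real (slab w 1) ≤ _ at h3
        change volume.real (U w) ≤ _ at h4
        linarith
    _ = _ := by rw [Finset.sum_mul]

end NormLeOneBoundary
end IdealSieve
end

noncomputable section

namespace IdealSieve

/-! ### Counting ideals with a power saving -/

section IdealCount

open MeasureTheory NumberField NumberField.InfinitePlace NumberField.mixedEmbedding
  NumberField.Units NumberField.mixedEmbedding.fundamentalCone Filter Topology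
open Ideal (absNorm absNorm_pos_of_nonZeroDivisors finite_setOfPred_absNorm_le₀)
open scoped Classical Pointwise

variable (K : Type*) [Field K] [NumberField K]

theorem smul_normLeOne {t : ℝ} (ht : 0 < t) :
    t • normLeOne K =
      {x | x ∈ fundamentalCone K ∧ mixedEmbedding.norm x ≤ t ^ Module.finrank ℚ K} := by
  ext x
  rw [Set.mem_smul_set_iff_inv_smul_mem₀ ht.ne', mem_normLeOne, smul_mem_iff_mem (inv_ne_zero ht.ne'),
    Set.mem_ofPred_eq, mixedEmbedding.norm_smul, abs_of_pos (inv_pos.2 ht), inv_pow,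
    inv_mul_le_iff₀ (by positivity), mul_one]

theorem exists_abs_card_idealSet_sub_le (J : (Ideal (𝓞 K))⁰) :
    ∃ κ C : ℝ, ∀ t : ℝ, 1 ≤ t →
      |(Nat.card {a : idealSet K J // mixedEmbedding.norm (a : mixedSpace K) ≤
          t ^ Module.finrank ℚ K} : ℝ) - κ * t ^ Module.finrank ℚ K| ≤
        C * (t ^ Module.finrank ℚ K / √t) := by
  obtain ⟨κ, C, h⟩ := exists_abs_card_smul_inter_span_sub_le volume
    (fractionalIdealLatticeBasis K (FractionalIdeal.mk0 K J)) (isBounded_normLeOne K)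
    (exists_volume_boundaryLayer_normLeOne_le K)
  refine ⟨κ, C, fun t ht => ?_⟩
  have h1 := h t ht
  rw [mixedEmbedding.finrank, span_idealLatticeBasis, smul_normLeOne K (by linarith)] at h1
  have hcard := (Nat.card_congr ((Equiv.subtypeSubtypeEquivSubtypeInter
    (· ∈ idealSet K J) (mixedEmbedding.norm · ≤ t ^ Module.finrank ℚ K)).trans
    (Equiv.subtypeEquivRight (q := fun x => x ∈ {x | x ∈ fundamentalCone K ∧
      mixedEmbedding.norm x ≤ t ^ Module.finrank ℚ K} ∩
      (idealLattice K (FractionalIdeal.mk0 K J) : Set (mixedSpace K))) fun x => by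
      simp only [idealSet, Set.mem_inter_iff, Set.mem_ofPred_eq]
      tauto)))
  rw [hcard]
  exact h1

/-- Multiplication by J identifies the class C with the principal multiples of J and scales norms by
N(J). -/
theorem card_norm_le_and_mk_eq {C : ClassGroup (𝓞 K)} {J : (Ideal (𝓞 K))⁰} {s : ℝ}
    (hJ : ClassGroup.mk0 J = C⁻¹) :
    Nat.card {I : (Ideal (𝓞 K))⁰ // absNorm (I : Ideal (𝓞 K)) ≤ s ∧ ClassGroup.mk0 I = C}
      = Nat.card {I : (Ideal (𝓞 K))⁰ // (J : Ideal (𝓞 K)) ∣ I ∧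
        Submodule.IsPrincipal (I : Ideal (𝓞 K)) ∧
        absNorm (I : Ideal (𝓞 K)) ≤ s * absNorm (J : Ideal (𝓞 K))} := by
  simp_rw [← nonZeroDivisors_dvd_iff_dvd_coe]
  refine Nat.card_congr ?_
  refine ((Equiv.dvd J).subtypeEquiv fun I ↦ ?_).trans
    (Equiv.subtypeSubtypeEquivSubtypeInter (fun I : (Ideal (𝓞 K))⁰ ↦ J ∣ I) _)
  rw [← ClassGroup.mk0_eq_one_iff (SetLike.coe_mem _)]
  simp_rw [Equiv.dvd_apply, Submonoid.coe_mul, ← Submonoid.mul_def, _root_.map_mul, hJ,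
    inv_mul_eq_one, Nat.cast_mul, mul_comm s, eq_comm, and_comm, and_congr_left_iff]
  exact fun _ ↦
    (mul_le_mul_iff_of_pos_left (Nat.cast_pos.mpr (absNorm_pos_of_nonZeroDivisors J))).symm

/-- The exponent of the power saving in the count of ideals. -/
def countSaving : ℝ := 1 / (2 * Module.finrank ℚ K)

theorem countSaving_pos : 0 < countSaving K := by
  have : (0 : ℝ) < Module.finrank ℚ K := by exact_mod_cast Module.finrank_pos
  unfold countSaving
  positivity

/-- A principal ideal has `torsionOrder K` generators in the fundamental cone, so the lattice count
applies with t = (x N(J))^(1/d), d being the degree. Then t^d / √t is the power 1 − 1 / (2d) of x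
N(J). -/
theorem exists_abs_card_norm_le_and_mk_eq_sub_le (C : ClassGroup (𝓞 K)) :
    ∃ κ B : ℝ, ∀ x : ℝ, 1 ≤ x →
      |(Nat.card {I : (Ideal (𝓞 K))⁰ //
          absNorm (I : Ideal (𝓞 K)) ≤ x ∧ ClassGroup.mk0 I = C} : ℝ) - κ * x| ≤
        B * x ^ (1 - countSaving K) := by
  obtain ⟨J, hJ⟩ := ClassGroup.mk0_surjective C⁻¹
  obtain ⟨κ, B, h⟩ := exists_abs_card_idealSet_sub_le K J
  set d := Module.finrank ℚ K
  have hd : (0 : ℝ) < d := by exact_mod_cast Module.finrank_pos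
  set m : ℝ := (absNorm (J : Ideal (𝓞 K)) : ℝ)
  have hm : 1 ≤ m := by
    have := absNorm_pos_of_nonZeroDivisors J
    exact Nat.one_le_cast.2 this
  have htor : (0 : ℝ) < torsionOrder K := by
    exact_mod_cast Nat.pos_of_ne_zero (torsionOrder_ne_zero K)
  refine ⟨κ * m / torsionOrder K, B * m ^ (1 - countSaving K) / torsionOrder K, fun x hx => ?_⟩
  have hxm : 1 ≤ x * m := one_le_mul_of_one_le_of_one_le hx hm
  have hxm0 : 0 ≤ x * m := by linarith
  have h1 := h ((x * m) ^ (d : ℝ)⁻¹) (Real.one_le_rpow hxm (by positivity))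
  have h2 : ((x * m) ^ (d : ℝ)⁻¹) ^ d = x * m := by
    rw [← Real.rpow_natCast, Real.rpow_inv_rpow hxm0 hd.ne']
  have h3 : x * m / √((x * m) ^ (d : ℝ)⁻¹) = x ^ (1 - countSaving K) * m ^ (1 - countSaving K) := by
    rw [Real.sqrt_eq_rpow, ← Real.rpow_mul hxm0, ← Real.mul_rpow (by linarith) (by linarith),
      Real.rpow_sub (by linarith), Real.rpow_one]
    congr 2
    unfold countSaving
    change (d : ℝ)⁻¹ * (1 / 2) = 1 / (2 * d)
    field_simp
  rw [h2, h3, ← card_isPrincipal_dvd_norm_le, ← card_norm_le_and_mk_eq K hJ, Nat.cast_mul] at h1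
  set n := (Nat.card {I : (Ideal (𝓞 K))⁰ //
          absNorm (I : Ideal (𝓞 K)) ≤ x ∧ ClassGroup.mk0 I = C} : ℝ)
  have h4 : n - κ * m / torsionOrder K * x =
      (n * torsionOrder K - κ * (x * m)) / torsionOrder K := by
    field_simp
  rw [h4, abs_div, abs_of_pos htor, div_le_iff₀ htor]
  refine h1.trans (le_of_eq ?_)
  field_simp

/-- The number of nonzero ideals of norm at most `x`. -/
def idealCount (x : ℝ) : ℝ := Nat.card {I : (Ideal (𝓞 K))⁰ // absNorm (I : Ideal (𝓞 K)) ≤ x}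

theorem finite_absNorm_le (x : ℝ) : {I : (Ideal (𝓞 K))⁰ | (absNorm (I : Ideal (𝓞 K)) : ℝ) ≤ x}.Finite := by
  rcases le_or_gt 0 x with hx | hx
  · simp_rw [← Nat.le_floor_iff hx]
    exact finite_setOfPred_absNorm_le₀ ⌊x⌋₊
  · convert Set.finite_empty
    ext I
    simp only [Set.mem_ofPred_eq, Set.mem_empty_iff_false, iff_false, not_le]
    exact hx.trans_le (Nat.cast_nonneg _)

theorem exists_abs_idealCount_sub_le :
    ∃ κ B : ℝ, 0 < κ ∧ 0 < B ∧ ∀ x : ℝ, 1 ≤ x →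
      |idealCount K x - κ * x| ≤ B * x ^ (1 - countSaving K) := by
  choose κ B h using exists_abs_card_norm_le_and_mk_eq_sub_le K
  have hsum : ∀ x : ℝ, idealCount K x = ∑ C, (Nat.card {I : (Ideal (𝓞 K))⁰ //
      absNorm (I : Ideal (𝓞 K)) ≤ x ∧ ClassGroup.mk0 I = C} : ℝ) := by
    intro s
    have : Fintype {I : (Ideal (𝓞 K))⁰ // absNorm (I : Ideal (𝓞 K)) ≤ s} :=
      (finite_absNorm_le K s).fintype
    let e := fun C : ClassGroup (𝓞 K) ↦ Equiv.subtypeSubtypeEquivSubtypeInter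
      (fun I : (Ideal (𝓞 K))⁰ ↦ absNorm I.1 ≤ s) (fun I ↦ ClassGroup.mk0 I = C)
    simp_rw [← Nat.card_congr (e _), idealCount, Nat.card_eq_fintype_card, Fintype.subtype_card]
    rw [Fintype.card, Finset.card_eq_sum_card_fiberwise (f := fun I ↦ ClassGroup.mk0 I.1)
      (t := Finset.univ) (fun _ _ ↦ Finset.mem_univ _), Nat.cast_sum]
  have hmain : ∀ x : ℝ, 1 ≤ x →
      |idealCount K x - (∑ C, κ C) * x| ≤ (∑ C, |B C| + 1) * x ^ (1 - countSaving K) := by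
    intro x hx
    have hx0 : 0 ≤ x ^ (1 - countSaving K) := by positivity
    rw [hsum, Finset.sum_mul, ← Finset.sum_sub_distrib]
    refine (Finset.abs_sum_le_sum_abs _ _).trans ?_
    rw [add_mul, Finset.sum_mul]
    have : ∀ C, _ ≤ |B C| * x ^ (1 - countSaving K) := fun C =>
      (h C x hx).trans (by gcongr; exact le_abs_self _)
    have := Finset.sum_le_sum fun C (_ : C ∈ Finset.univ) => this C
    linarith
  refine ⟨∑ C, κ C, ∑ C, |B C| + 1, ?_, by positivity, hmain⟩
  -- The lattice argument does not show that the density is positive; comparison with the class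
  -- number formula does.
  have hlim := NumberField.Ideal.tendsto_norm_le_div_atTop₀ K
  have hlim' : Tendsto (fun x => idealCount K x / x) atTop (𝓝 (∑ C, κ C)) := by
    rw [tendsto_iff_norm_sub_tendsto_zero]
    have h0 : Tendsto (fun x : ℝ => (∑ C, |B C| + 1) * x ^ (-countSaving K)) atTop (𝓝 0) := by
      simpa using (tendsto_rpow_neg_atTop (countSaving_pos K)).const_mul (∑ C, |B C| + 1)
    refine squeeze_zero' (Eventually.of_forall fun x => norm_nonneg _) ?_ h0
    filter_upwards [eventually_ge_atTop 1] with x hx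
    have hx0 : 0 < x := by linarith
    have h1 : idealCount K x / x - ∑ C, κ C = (idealCount K x - (∑ C, κ C) * x) / x := by
      field_simp
    rw [Real.norm_eq_abs, h1, abs_div, abs_of_pos hx0, div_le_iff₀ hx0]
    refine (hmain x hx).trans (le_of_eq ?_)
    rw [mul_assoc, ← Real.rpow_add_one hx0.ne']
    ring_nf
  have heq := tendsto_nhds_unique hlim' hlim
  rw [heq]
  have h1 := regulator_pos K
  have h2 : (0 : ℝ) < torsionOrder K := by
    exact_mod_cast Nat.pos_of_ne_zero (torsionOrder_ne_zero K)
  have h3 : (0 : ℝ) < classNumber K := by exact_mod_cast Fintype.card_pos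
  have h4 : (0 : ℝ) < |(discr K : ℝ)| := by
    have := discr_ne_zero K
    positivity
  positivity

end IdealCount
end IdealSieve
end

noncomputable section

namespace IdealSieve

/-! ### Norms, prime factorization and a Chebyshev bound -/

section NormBasics

open NumberField

variable {K : Type*} [Field K] [NumberField K]

theorem nrm_mul (a b : NzIdeal K) : nrm (a * b) = nrm a * nrm b := by
  simp [nrm]

theorem nrm_one : nrm (1 : NzIdeal K) = 1 := by
  simp [nrm]

theorem nrm_pow (a : NzIdeal K) (k : ℕ) : nrm (a ^ k) = nrm a ^ k := by
  simp [nrm]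

theorem one_le_nrm (a : NzIdeal K) : 1 ≤ nrm a :=
  Nat.one_le_cast.2 (Ideal.absNorm_pos_of_nonZeroDivisors a)

theorem nrm_pos (a : NzIdeal K) : 0 < nrm a := one_pos.trans_le (one_le_nrm a)

theorem two_le_nrm {a : NzIdeal K} (ha : a ≠ 1) : 2 ≤ nrm a := by
  have h1 : Ideal.absNorm (a : Ideal (𝓞 K)) ≠ 1 := fun h =>
    ha (Subtype.ext (by rw [Ideal.absNorm_eq_one_iff.1 h, OneMemClass.coe_one, Ideal.one_eq_top]))
  have h2 := Ideal.absNorm_pos_of_nonZeroDivisors a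
  have h3 : 2 ≤ Ideal.absNorm (a : Ideal (𝓞 K)) := by omega
  simpa [nrm] using (Nat.cast_le (α := ℝ)).2 h3

omit [NumberField K] in
theorem PrimeId.toNz_ne_one (p : PrimeId K) : p.toNz ≠ 1 := fun h =>
  p.isPrime.ne_top (by
    rw [← Ideal.one_eq_top]
    exact congrArg Subtype.val h)

theorem PrimeId.two_le_nrm (p : PrimeId K) : 2 ≤ nrm p.toNz := IdealSieve.two_le_nrm p.toNz_ne_one

theorem PrimeId.log_nrm_pos (p : PrimeId K) : 0 < Real.log (nrm p.toNz) :=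
  Real.log_pos (by linarith [p.two_le_nrm])

omit [NumberField K] in
theorem PrimeId.toNz_injective : Function.Injective (PrimeId.toNz (K := K)) := fun _ _ h =>
  HeightOneSpectrum.ext (congrArg Subtype.val h)

theorem nrm_le_of_dvd {a b : NzIdeal K} (h : a ∣ b) : nrm a ≤ nrm b := by
  obtain ⟨c, rfl⟩ := h
  rw [nrm_mul]
  nlinarith [one_le_nrm a, one_le_nrm c]

theorem exists_prime_dvd {a : NzIdeal K} (ha : a ≠ 1) : ∃ p : PrimeId K, p.toNz ∣ a := by
  have h1 : (a : Ideal (𝓞 K)) ≠ ⊤ := fun h => ha (Subtype.ext (by rw [h, OneMemClass.coe_one, Ideal.one_eq_top]))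
  obtain ⟨m, hm, ham⟩ := Ideal.exists_le_maximal _ h1
  have hbot : m ≠ ⊥ := fun h =>
    nonZeroDivisors.coe_ne_zero a (le_bot_iff.1 (h ▸ ham))
  exact ⟨⟨m, hm.isPrime, hbot⟩,
    nonZeroDivisors_dvd_iff_dvd_coe.2 (Ideal.dvd_iff_le.2 ham)⟩

theorem finite_setOf_nrm_le (x : ℝ) : {a : NzIdeal K | nrm a ≤ x}.Finite := finite_absNorm_le K x

theorem finite_setOf_prime_nrm_le (x : ℝ) : {p : PrimeId K | nrm p.toNz ≤ x}.Finite :=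
  (finite_setOf_nrm_le x).preimage PrimeId.toNz_injective.injOn

variable (K) in
/-- The nonzero ideals of norm at most `x`. -/
def idealsLE (x : ℝ) : Finset (NzIdeal K) := (finite_setOf_nrm_le x).toFinset

variable (K) in
/-- The nonzero prime ideals of norm at most `x`. -/
def primesLE (x : ℝ) : Finset (PrimeId K) := (finite_setOf_prime_nrm_le x).toFinset

@[simp]
theorem mem_idealsLE {x : ℝ} {a : NzIdeal K} : a ∈ idealsLE K x ↔ nrm a ≤ x := by
  simp [idealsLE]

@[simp]
theorem mem_primesLE {x : ℝ} {p : PrimeId K} : p ∈ primesLE K x ↔ nrm p.toNz ≤ x := by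
  simp [primesLE]

theorem idealCount_eq_card (x : ℝ) : idealCount K x = (idealsLE K x).card := by
  rw [idealCount]
  norm_cast
  exact Nat.card_eq_card_finite_toFinset (finite_setOf_nrm_le x)

open scoped Classical in
theorem card_filter_dvd_idealsLE (c : NzIdeal K) (x : ℝ) :
    (((idealsLE K x).filter (c ∣ ·)).card : ℝ) = idealCount K (x / nrm c) := by
  rw [idealCount_eq_card]
  norm_cast
  symm
  refine Finset.card_bij (fun b _ => c * b) (fun b hb => ?_) (fun b _ b' _ h => ?_) (fun a ha => ?_)
  · rw [mem_idealsLE, le_div_iff₀ (nrm_pos c)] at hb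
    rw [Finset.mem_filter, mem_idealsLE, nrm_mul, mul_comm]
    exact ⟨hb, dvd_mul_right _ _⟩
  · exact mul_left_cancel h
  · rw [Finset.mem_filter, mem_idealsLE] at ha
    obtain ⟨h1, b, rfl⟩ := ha
    refine ⟨b, ?_, rfl⟩
    rw [mem_idealsLE, le_div_iff₀ (nrm_pos c), mul_comm, ← nrm_mul]
    exact h1

open scoped Classical in
/-- The exponent of `p` in the factorization of `a`. -/
def primeExp (p : PrimeId K) (a : NzIdeal K) : ℕ :=
  (Associates.mk p.asIdeal).count (Associates.mk (a : Ideal (𝓞 K))).factors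

theorem le_primeExp_iff {p : PrimeId K} {a : NzIdeal K} {k : ℕ} :
    k ≤ primeExp p a ↔ p.toNz ^ k ∣ a := by
  classical
  rw [primeExp, ← Associates.prime_pow_dvd_iff_le
    (Associates.mk_ne_zero.2 (nonZeroDivisors.coe_ne_zero a)) p.associates_irreducible,
    ← Associates.mk_pow, Associates.mk_le_mk_iff_dvd, nonZeroDivisors_dvd_iff_dvd_coe]
  rfl

theorem log_nrm_eq_sum {x : ℝ} {a : NzIdeal K} (ha : nrm a ≤ x) :
    Real.log (nrm a) = ∑ p ∈ primesLE K x, primeExp p a * Real.log (nrm p.toNz) := by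
  classical
  have h0 : (a : Ideal (𝓞 K)) ≠ 0 := nonZeroDivisors.coe_ne_zero a
  have h1 := Ideal.finprod_heightOneSpectrum_factorization h0
  rw [finprod_eq_prod_of_mulSupport_subset (s := primesLE K x)] at h1
  · have h2 : nrm a = ∏ p ∈ primesLE K x, nrm p.toNz ^ primeExp p a := by
      rw [nrm, ← h1, map_prod]
      push_cast
      refine Finset.prod_congr rfl fun p _ => ?_
      rw [HeightOneSpectrum.maxPowDividing, map_pow]
      push_cast
      rfl
    rw [h2, Real.log_prod (fun p _ => (pow_pos (nrm_pos _) _).ne')]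
    exact Finset.sum_congr rfl fun p _ => by rw [Real.log_pow]
  · intro p hp
    rw [Finset.mem_coe, mem_primesLE]
    refine le_trans (nrm_le_of_dvd ?_) ha
    have h3 : 1 ≤ primeExp p a := by
      by_contra! h
      apply hp
      change p.asIdeal ^ primeExp p a = 1
      rw [Nat.lt_one_iff.1 h, pow_zero]
    simpa using le_primeExp_iff.1 h3

theorem primeExp_le {a : NzIdeal K} {x : ℝ} {n : ℕ} (hx : x < 2 ^ n) (ha : nrm a ≤ x) (p : PrimeId K) :
    primeExp p a ≤ n := by
  by_contra! h
  have h1 := nrm_le_of_dvd (le_primeExp_iff.1 h.le)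
  rw [nrm_pow] at h1
  have h2 : (2 : ℝ) ^ n ≤ nrm p.toNz ^ n := pow_le_pow_left₀ (by norm_num) p.two_le_nrm n
  linarith

/-- Legendre's identity: the exponent of p in a counts the k ≥ 1 with p^k ∣ a, and all exponents are
at most n because norms of primes are at least 2. -/
theorem sum_log_nrm_eq {x : ℝ} {n : ℕ} (hx : x < 2 ^ n) :
    ∑ a ∈ idealsLE K x, Real.log (nrm a) =
      ∑ p ∈ primesLE K x, Real.log (nrm p.toNz) *
        ∑ k ∈ Finset.Icc 1 n, idealCount K (x / nrm p.toNz ^ k) := by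
  classical
  have h1 : ∀ a ∈ idealsLE K x, Real.log (nrm a) = ∑ p ∈ primesLE K x,
      Real.log (nrm p.toNz) * ∑ k ∈ Finset.Icc 1 n, (if p.toNz ^ k ∣ a then 1 else 0 : ℝ) := by
    intro a ha
    rw [mem_idealsLE] at ha
    rw [log_nrm_eq_sum ha]
    refine Finset.sum_congr rfl fun p _ => ?_
    rw [mul_comm, Finset.sum_boole]
    congr 2
    have : (Finset.Icc 1 n).filter (fun k => p.toNz ^ k ∣ a) = Finset.Icc 1 (primeExp p a) := by
      ext k
      rw [Finset.mem_filter, ← le_primeExp_iff, Finset.mem_Icc, Finset.mem_Icc]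
      have := primeExp_le hx ha p
      omega
    rw [this]
    simp
  rw [Finset.sum_congr rfl h1, Finset.sum_comm]
  refine Finset.sum_congr rfl fun p _ => ?_
  rw [← Finset.mul_sum, Finset.sum_comm]
  congr 1
  refine Finset.sum_congr rfl fun k _ => ?_
  rw [Finset.sum_boole, card_filter_dvd_idealsLE, nrm_pow]

theorem exists_prime_natCast_mem (p : PrimeId K) :
    ∃ ℓ : ℕ, ℓ.Prime ∧ ℓ ≤ Ideal.absNorm p.asIdeal ∧ (ℓ : 𝓞 K) ∈ p.asIdeal := by
  have key : ∀ n : ℕ, n ≠ 0 → (n : 𝓞 K) ∈ p.asIdeal →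
      ∃ ℓ : ℕ, ℓ.Prime ∧ ℓ ≤ n ∧ (ℓ : 𝓞 K) ∈ p.asIdeal := by
    intro n
    induction n using Nat.recOnMul with
    | zero => intro h; exact absurd rfl h
    | one =>
      intro _ h
      rw [Nat.cast_one] at h
      exact absurd ((Ideal.eq_top_iff_one _).2 h) p.isPrime.ne_top
    | prime ℓ hℓ => intro _ h; exact ⟨ℓ, hℓ, le_rfl, h⟩
    | mul a b iha ihb =>
      intro h0 h
      have ha : a ≠ 0 := left_ne_zero_of_mul h0
      have hb : b ≠ 0 := right_ne_zero_of_mul h0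
      rw [Nat.cast_mul] at h
      rcases p.isPrime.mem_or_mem h with h | h
      · obtain ⟨ℓ, h1, h2, h3⟩ := iha ha h
        exact ⟨ℓ, h1, h2.trans (Nat.le_mul_of_pos_right a (Nat.pos_of_ne_zero hb)), h3⟩
      · obtain ⟨ℓ, h1, h2, h3⟩ := ihb hb h
        exact ⟨ℓ, h1, h2.trans (Nat.le_mul_of_pos_left b (Nat.pos_of_ne_zero ha)), h3⟩
  exact key _ (Ideal.absNorm_pos_of_nonZeroDivisors p.toNz).ne' (Ideal.absNorm_mem _)

/-- Each prime ideal of norm at most x contains a rational prime at most x, so the product of these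
ideals divides the ideal of the primorial, which is at most 4^x. Taking norms raises this to the
power of the degree. -/
theorem sum_log_nrm_primesLE_le {x : ℝ} (hx : 0 ≤ x) :
    ∑ p ∈ primesLE K x, Real.log (nrm p.toNz) ≤ Module.finrank ℚ K * Real.log 4 * x := by
  classical
  set n := primorial ⌊x⌋₊
  have hn : 0 < n := primorial_pos _
  have hdvd : ∏ p ∈ primesLE K x, p.asIdeal ∣ Ideal.span {(n : 𝓞 K)} := by
    rw [← Finset.prod_image (f := fun I : Ideal (𝓞 K) => I) (g := HeightOneSpectrum.asIdeal)
      fun p _ q _ h => HeightOneSpectrum.ext h]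
    refine Finset.prod_primes_dvd _ (fun I hI => ?_) (fun I hI => ?_)
    · obtain ⟨p, -, rfl⟩ := Finset.mem_image.1 hI
      exact p.prime
    · obtain ⟨p, hp, rfl⟩ := Finset.mem_image.1 hI
      rw [mem_primesLE] at hp
      obtain ⟨ℓ, hℓ, hℓN, hℓp⟩ := exists_prime_natCast_mem p
      have h1 : ℓ ∣ n := by
        refine Finset.dvd_prod_of_mem (fun i => i) (Finset.mem_filter.2 ⟨?_, hℓ⟩)
        rw [Finset.mem_range, Nat.lt_succ_iff, Nat.le_floor_iff hx]
        exact (Nat.cast_le.2 hℓN).trans hp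
      rw [Ideal.dvd_span_singleton]
      obtain ⟨c, hc⟩ := h1
      rw [hc, Nat.cast_mul]
      exact Ideal.mul_mem_right _ _ hℓp
  have h1 : ∏ p ∈ primesLE K x, nrm p.toNz ≤ (n : ℝ) ^ Module.finrank ℚ K := by
    have h2 := map_dvd Ideal.absNorm hdvd
    have h3 : Ideal.absNorm (Ideal.span {(n : 𝓞 K)}) = n ^ Module.finrank ℚ K := by
      rw [Ideal.absNorm_span_singleton, ← RingOfIntegers.rank K,
        ← map_natCast (algebraMap ℤ (𝓞 K)), Algebra.norm_algebraMap]
      simp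
    rw [h3, map_prod] at h2
    have h4 := Nat.le_of_dvd (by positivity) h2
    have h5 := (Nat.cast_le (α := ℝ)).2 h4
    rw [Nat.cast_prod, Nat.cast_pow] at h5
    exact h5
  rw [← Real.log_prod (fun p _ => (nrm_pos _).ne')]
  have h5 : (n : ℝ) ≤ 4 ^ ⌊x⌋₊ := by exact_mod_cast primorial_le_four_pow _
  calc Real.log (∏ p ∈ primesLE K x, nrm p.toNz) ≤ Real.log ((n : ℝ) ^ Module.finrank ℚ K) :=
        Real.log_le_log (Finset.prod_pos fun p _ => nrm_pos _) h1
    _ = Module.finrank ℚ K * Real.log n := Real.log_pow _ _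
    _ ≤ Module.finrank ℚ K * Real.log (4 ^ ⌊x⌋₊) := by
        gcongr
    _ = Module.finrank ℚ K * Real.log 4 * ⌊x⌋₊ := by rw [Real.log_pow]; ring
    _ ≤ _ := by
        gcongr
        exact Nat.floor_le hx

end NormBasics
end IdealSieve
end

noncomputable section

namespace IdealSieve

/-! ### Dyadic summation -/

section Dyadic

variable {ι : Type*} {s : Finset ι} {c f : ι → ℝ} {A x : ℝ}

/-- The layer with x / f of size 2^j has mass at most A x / 2^j and weight O(2^(σj)); since σ < 1
the layers form a convergent geometric series. -/
theorem sum_mul_rpow_le_of_sum_le (hA : 0 ≤ A) (hc : ∀ i ∈ s, 0 ≤ c i) (hf : ∀ i ∈ s, 1 ≤ f i)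
    (hfx : ∀ i ∈ s, f i ≤ x) (hx : 1 ≤ x)
    (hsum : ∀ t, 1 ≤ t → ∑ i ∈ s with f i ≤ t, c i ≤ A * t) {σ : ℝ} (hσ0 : 0 ≤ σ) (hσ : σ < 1) :
    ∑ i ∈ s, c i * (x / f i) ^ σ ≤ A * (2 / (1 - 2 ^ (σ - 1))) * x := by
  have hx0 : 0 < x := by linarith
  obtain ⟨J, hJ⟩ := pow_unbounded_of_one_lt x (one_lt_two)
  have hσ2 : (2 : ℝ) ^ σ ≤ 2 := by
    simpa using Real.rpow_le_rpow_of_exponent_le (one_le_two (α := ℝ)) hσ.le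
  have hr1 : (2 : ℝ) ^ (σ - 1) < 1 := Real.rpow_lt_one_of_one_lt_of_neg one_lt_two (by linarith)
  have hr0 : (0 : ℝ) ≤ 2 ^ (σ - 1) := by positivity
  have h1 : ∀ i ∈ s, (x / f i) ^ σ ≤
      ∑ j ∈ Finset.range J, if f i ≤ x / 2 ^ j then 2 * ((2 : ℝ) ^ σ) ^ j else 0 := by
    intro i hi
    have hfi : 0 < f i := by linarith [hf i hi]
    obtain ⟨j, hj1, hj2⟩ := exists_nat_pow_near ((one_le_div hfi).2 (hfx i hi)) one_lt_two
    have hjJ : j < J := by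
      by_contra! h
      have h2 : (2 : ℝ) ^ J ≤ 2 ^ j := pow_le_pow_right₀ one_le_two h
      have h3 : x / f i ≤ x := div_le_self hx0.le (hf i hi)
      linarith
    have hcond : f i ≤ x / 2 ^ j := by
      rw [le_div_iff₀ hfi] at hj1
      rw [le_div_iff₀ (by positivity)]
      linarith
    calc (x / f i) ^ σ ≤ ((2 : ℝ) ^ (j + 1)) ^ σ := by gcongr
      _ = 2 ^ σ * ((2 : ℝ) ^ σ) ^ j := by
        rw [← Real.rpow_natCast, ← Real.rpow_natCast, ← Real.rpow_mul (by norm_num),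
          ← Real.rpow_mul (by norm_num), ← Real.rpow_add (by norm_num)]
        push_cast
        ring_nf
      _ ≤ 2 * ((2 : ℝ) ^ σ) ^ j := by gcongr
      _ = if f i ≤ x / 2 ^ j then 2 * ((2 : ℝ) ^ σ) ^ j else 0 := by rw [if_pos hcond]
      _ ≤ _ := Finset.single_le_sum
        (f := fun j => if f i ≤ x / 2 ^ j then 2 * ((2 : ℝ) ^ σ) ^ j else 0)
        (fun k _ => by positivity) (Finset.mem_range.2 hjJ)
  calc ∑ i ∈ s, c i * (x / f i) ^ σ
      ≤ ∑ i ∈ s, c i *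
        ∑ j ∈ Finset.range J, (if f i ≤ x / 2 ^ j then 2 * ((2 : ℝ) ^ σ) ^ j else 0) :=
        Finset.sum_le_sum fun i hi => mul_le_mul_of_nonneg_left (h1 i hi) (hc i hi)
    _ = ∑ j ∈ Finset.range J, 2 * ((2 : ℝ) ^ σ) ^ j * ∑ i ∈ s with f i ≤ x / 2 ^ j, c i := by
        simp_rw [Finset.mul_sum]
        rw [Finset.sum_comm]
        refine Finset.sum_congr rfl fun j _ => ?_
        rw [Finset.sum_filter]
        refine Finset.sum_congr rfl fun i _ => ?_
        split_ifs <;> ring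
    _ ≤ ∑ j ∈ Finset.range J, 2 * ((2 : ℝ) ^ σ) ^ j * (A * (x / 2 ^ j)) := by
        refine Finset.sum_le_sum fun j _ => mul_le_mul_of_nonneg_left ?_ (by positivity)
        rcases le_or_gt 1 (x / 2 ^ j) with h | h
        · exact hsum _ h
        · rw [Finset.filter_false_of_mem fun i hi => by linarith [hf i hi], Finset.sum_empty]
          positivity
    _ = A * 2 * x * ∑ j ∈ Finset.range J, ((2 : ℝ) ^ (σ - 1)) ^ j := by
        rw [Finset.mul_sum]
        refine Finset.sum_congr rfl fun j _ => ?_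
        rw [Real.rpow_sub_one (by norm_num), div_pow]
        field_simp
    _ ≤ A * 2 * x * (1 - 2 ^ (σ - 1))⁻¹ := by
        gcongr
        rw [← tsum_geometric_of_lt_one hr0 hr1]
        exact (summable_geometric_of_lt_one hr0 hr1).sum_le_tsum _ fun j _ => by positivity
    _ = _ := by ring

theorem sum_div_sq_le_of_sum_le (hA : 0 ≤ A) (hc : ∀ i ∈ s, 0 ≤ c i) (hf : ∀ i ∈ s, 1 ≤ f i)
    (hsum : ∀ t, 1 ≤ t → ∑ i ∈ s with f i ≤ t, c i ≤ A * t) :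
    ∑ i ∈ s, c i / f i ^ 2 ≤ 4 * A := by
  obtain ⟨x, hfx⟩ : ∃ x, ∀ i ∈ s, f i ≤ x := by
    obtain ⟨x, hx⟩ := (s.image f).exists_le
    exact ⟨x, fun i hi => hx _ (Finset.mem_image_of_mem f hi)⟩
  obtain ⟨J, hJ⟩ := pow_unbounded_of_one_lt x (one_lt_two)
  have h1 : ∀ i ∈ s, 1 / f i ^ 2 ≤
      ∑ j ∈ Finset.range J, if f i ≤ 2 ^ (j + 1) then (1 / 4 : ℝ) ^ j else 0 := by
    intro i hi
    have hfi : 0 < f i := by linarith [hf i hi]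
    obtain ⟨j, hj1, hj2⟩ := exists_nat_pow_near (hf i hi) one_lt_two
    have hjJ : j < J := by
      by_contra! h
      have h2 : (2 : ℝ) ^ J ≤ 2 ^ j := pow_le_pow_right₀ one_le_two h
      linarith [hfx i hi]
    calc 1 / f i ^ 2 ≤ 1 / ((2 : ℝ) ^ j) ^ 2 := by gcongr
      _ = (1 / 4 : ℝ) ^ j := by rw [← pow_mul, mul_comm, pow_mul, one_div_pow]; norm_num
      _ = if f i ≤ 2 ^ (j + 1) then (1 / 4 : ℝ) ^ j else 0 := by rw [if_pos hj2.le]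
      _ ≤ _ := Finset.single_le_sum (f := fun j => if f i ≤ 2 ^ (j + 1) then (1 / 4 : ℝ) ^ j else 0)
        (fun k _ => by positivity) (Finset.mem_range.2 hjJ)
  calc ∑ i ∈ s, c i / f i ^ 2 = ∑ i ∈ s, c i * (1 / f i ^ 2) := by simp [div_eq_mul_inv]
    _ ≤ ∑ i ∈ s, c i *
        ∑ j ∈ Finset.range J, (if f i ≤ 2 ^ (j + 1) then (1 / 4 : ℝ) ^ j else 0) :=
        Finset.sum_le_sum fun i hi => mul_le_mul_of_nonneg_left (h1 i hi) (hc i hi)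
    _ = ∑ j ∈ Finset.range J, (1 / 4 : ℝ) ^ j * ∑ i ∈ s with f i ≤ 2 ^ (j + 1), c i := by
        simp_rw [Finset.mul_sum]
        rw [Finset.sum_comm]
        refine Finset.sum_congr rfl fun j _ => ?_
        rw [Finset.sum_filter]
        refine Finset.sum_congr rfl fun i _ => ?_
        split_ifs <;> ring
    _ ≤ ∑ j ∈ Finset.range J, (1 / 4 : ℝ) ^ j * (A * 2 ^ (j + 1)) := by
        refine Finset.sum_le_sum fun j _ => mul_le_mul_of_nonneg_left ?_ (by positivity)
        exact hsum _ (one_le_pow₀ one_le_two)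
    _ = 2 * A * ∑ j ∈ Finset.range J, (1 / 2 : ℝ) ^ j := by
        rw [Finset.mul_sum]
        refine Finset.sum_congr rfl fun j _ => ?_
        rw [show (1 / 4 : ℝ) = 1 / 2 * (1 / 2) by norm_num, mul_pow, pow_succ, one_div_pow]
        field_simp
    _ ≤ 2 * A * 2 := by
        gcongr
        exact (summable_geometric_two.sum_le_tsum _ fun j _ => by positivity).trans_eq
          tsum_geometric_two
    _ = _ := by ring

theorem sum_Icc_two_inv_pow_le {q : ℝ} (hq : 2 ≤ q) (n : ℕ) :
    ∑ k ∈ Finset.Icc 2 n, 1 / q ^ k ≤ 2 / q ^ 2 := by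
  have hq0 : 0 < q := by linarith
  have h1 : ∀ k ∈ Finset.Icc 2 n, 1 / q ^ k ≤ 1 / q ^ 2 * (1 / 2) ^ (k - 2) := by
    intro k hk
    obtain ⟨m, rfl⟩ := Nat.exists_eq_add_of_le (Finset.mem_Icc.1 hk).1
    rw [Nat.add_sub_cancel_left, pow_add, one_div_pow, one_div_mul_one_div]
    gcongr
  have h2 : ∑ k ∈ Finset.Icc 2 n, (1 / 2 : ℝ) ^ (k - 2) ≤ 2 := by
    have h3 : ∑ k ∈ Finset.Icc 2 n, (1 / 2 : ℝ) ^ (k - 2) =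
        ∑ m ∈ (Finset.Icc 2 n).image (· - 2), (1 / 2 : ℝ) ^ m := by
      rw [Finset.sum_image]
      intro a ha b hb hab
      have := (Finset.mem_Icc.1 ha).1
      have := (Finset.mem_Icc.1 hb).1
      simp only at hab
      omega
    rw [h3]
    exact (summable_geometric_two.sum_le_tsum _ fun j _ => by positivity).trans_eq
      tsum_geometric_two
  calc ∑ k ∈ Finset.Icc 2 n, 1 / q ^ k ≤ ∑ k ∈ Finset.Icc 2 n, 1 / q ^ 2 * (1 / 2) ^ (k - 2) :=
        Finset.sum_le_sum h1
    _ = 1 / q ^ 2 * ∑ k ∈ Finset.Icc 2 n, (1 / 2 : ℝ) ^ (k - 2) := by rw [Finset.mul_sum]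
    _ ≤ 1 / q ^ 2 * 2 := by gcongr
    _ = _ := by ring

end Dyadic

/-! ### Mertens' theorem for prime ideals -/

section Mertens

variable (K : Type*) [Field K] [NumberField K]

theorem sum_log_div_nrm_sq_le (x : ℝ) :
    ∑ p ∈ primesLE K x, Real.log (nrm p.toNz) / nrm p.toNz ^ 2 ≤
      4 * (Module.finrank ℚ K * Real.log 4) := by
  have h4 : 0 ≤ Real.log 4 := Real.log_nonneg (by norm_num)
  refine sum_div_sq_le_of_sum_le (by positivity) (fun p _ => p.log_nrm_pos.le)
    (fun p _ => one_le_nrm _) (fun t ht => ?_)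
  refine le_trans (Finset.sum_le_sum_of_subset_of_nonneg (t := primesLE K t) (fun p hp => ?_)
    fun p _ _ => p.log_nrm_pos.le) (sum_log_nrm_primesLE_le (by linarith))
  exact mem_primesLE.2 (Finset.mem_filter.1 hp).2

theorem exists_sum_log_mul_rpow_le {σ : ℝ} (hσ0 : 0 ≤ σ) (hσ : σ < 1) :
    ∃ C : ℝ, ∀ x : ℝ, 1 ≤ x →
      ∑ p ∈ primesLE K x, Real.log (nrm p.toNz) * (x / nrm p.toNz) ^ σ ≤ C * x := by
  have h4 : 0 ≤ Real.log 4 := Real.log_nonneg (by norm_num)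
  refine ⟨_, fun x hx => sum_mul_rpow_le_of_sum_le (A := Module.finrank ℚ K * Real.log 4)
    (by positivity) (fun p _ => p.log_nrm_pos.le)
    (fun p _ => one_le_nrm _) (fun p hp => mem_primesLE.1 hp) hx (fun t ht => ?_) hσ0 hσ⟩
  refine le_trans (Finset.sum_le_sum_of_subset_of_nonneg (t := primesLE K t) (fun p hp => ?_)
    fun p _ _ => p.log_nrm_pos.le) (sum_log_nrm_primesLE_le (by linarith))
  exact mem_primesLE.2 (Finset.mem_filter.1 hp).2

theorem idealCount_eq_zero {x : ℝ} (hx : x < 1) : idealCount K x = 0 := by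
  rw [idealCount_eq_card]
  have : idealsLE K x = ∅ := by
    ext a
    simp only [mem_idealsLE, Finset.notMem_empty, iff_false, not_le]
    linarith [one_le_nrm a]
  simp [this]

theorem exists_idealCount_le : ∃ A : ℝ, 0 < A ∧ ∀ x : ℝ, 0 ≤ x → idealCount K x ≤ A * x := by
  obtain ⟨κ, B, hκ, hB, h⟩ := exists_abs_idealCount_sub_le K
  refine ⟨κ + B, by positivity, fun x hx => ?_⟩
  rcases lt_or_ge x 1 with h1 | h1
  · rw [idealCount_eq_zero K h1]
    positivity
  · have h2 := (abs_sub_le_iff.1 (h x h1)).1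
    have h3 : x ^ (1 - countSaving K) ≤ x := by
      simpa using Real.rpow_le_rpow_of_exponent_le h1
        (show 1 - countSaving K ≤ 1 by linarith [countSaving_pos K])
    nlinarith

theorem exists_sum_log_div_nrm_ideals_le :
    ∃ C : ℝ, ∀ x : ℝ, 1 ≤ x → ∑ a ∈ idealsLE K x, Real.log (x / nrm a) ≤ C * x := by
  obtain ⟨A, hA, h⟩ := exists_idealCount_le K
  refine ⟨2 * (A * (2 / (1 - 2 ^ ((1 / 2 : ℝ) - 1)))), fun x hx => ?_⟩
  have h1 := sum_mul_rpow_le_of_sum_le (s := idealsLE K x) (c := fun _ => 1) (f := nrm) hA.le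
    (fun _ _ => zero_le_one) (fun a _ => one_le_nrm a) (fun a ha => mem_idealsLE.1 ha) hx
    (fun t ht => ?_) (σ := 1 / 2) (by norm_num) (by norm_num)
  · rw [mul_assoc]
    refine le_trans ?_ (mul_le_mul_of_nonneg_left h1 zero_le_two)
    rw [Finset.mul_sum]
    refine Finset.sum_le_sum fun a _ => ?_
    have h2 := Real.log_le_rpow_div (x := x / nrm a) (by have := nrm_pos a; positivity)
      (ε := 1 / 2) (by norm_num)
    linarith
  · refine le_trans ?_ (h t (by linarith))
    rw [idealCount_eq_card, Finset.sum_const, nsmul_eq_mul, mul_one]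
    gcongr
    intro a ha
    exact mem_idealsLE.2 (Finset.mem_filter.1 ha).2

/-- Write log N(a) = log x − log(x / N(a)): the second part sums to O(x), and the power saving in
the ideal count absorbs the factor log x. -/
theorem exists_abs_sum_log_nrm_sub_le {κ B : ℝ} (hκB : 0 < B ∧ ∀ x : ℝ, 1 ≤ x →
    |idealCount K x - κ * x| ≤ B * x ^ (1 - countSaving K)) :
    ∃ C : ℝ, ∀ x : ℝ, 1 ≤ x →
      |∑ a ∈ idealsLE K x, Real.log (nrm a) - κ * x * Real.log x| ≤ C * x := by
  obtain ⟨C, hC⟩ := exists_sum_log_div_nrm_ideals_le K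
  set η := countSaving K
  have hη : 0 < η := countSaving_pos K
  refine ⟨B / η + |C|, fun x hx => ?_⟩
  have hx0 : 0 < x := by linarith
  have hlog : 0 ≤ Real.log x := Real.log_nonneg hx
  have h1 : ∑ a ∈ idealsLE K x, Real.log (nrm a) =
      idealCount K x * Real.log x - ∑ a ∈ idealsLE K x, Real.log (x / nrm a) := by
    rw [idealCount_eq_card, ← nsmul_eq_mul, ← Finset.sum_const, ← Finset.sum_sub_distrib]
    refine Finset.sum_congr rfl fun a _ => ?_
    rw [Real.log_div hx0.ne' (nrm_pos a).ne']
    ring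
  have h2 : 0 ≤ ∑ a ∈ idealsLE K x, Real.log (x / nrm a) :=
    Finset.sum_nonneg fun a ha => Real.log_nonneg
      ((one_le_div (nrm_pos a)).2 (mem_idealsLE.1 ha))
  have h3 : B * x ^ (1 - η) * Real.log x ≤ B / η * x := by
    have h4 := Real.log_le_rpow_div hx0.le hη
    calc B * x ^ (1 - η) * Real.log x ≤ B * x ^ (1 - η) * (x ^ η / η) := by
          have := hκB.1
          gcongr
      _ = B / η * (x ^ (1 - η) * x ^ η) := by ring
      _ = B / η * x := by rw [← Real.rpow_add hx0]; simp
  have h5 : |(idealCount K x - κ * x) * Real.log x| ≤ B / η * x := by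
    rw [abs_mul, abs_of_nonneg hlog]
    exact (mul_le_mul_of_nonneg_right (hκB.2 x hx) hlog).trans h3
  rw [h1, show idealCount K x * Real.log x - ∑ a ∈ idealsLE K x, Real.log (x / nrm a) -
    κ * x * Real.log x = (idealCount K x - κ * x) * Real.log x -
      ∑ a ∈ idealsLE K x, Real.log (x / nrm a) by ring]
  refine (abs_sub _ _).trans ?_
  rw [abs_of_nonneg h2, add_mul]
  gcongr
  exact (hC x hx).trans (by gcongr; exact le_abs_self C)

/-- Mertens' first theorem for prime ideals. -/
theorem exists_abs_sum_log_nrm_div_sub_log_le :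
    ∃ C : ℝ, ∀ x : ℝ, 1 ≤ x →
      |∑ p ∈ primesLE K x, Real.log (nrm p.toNz) / nrm p.toNz - Real.log x| ≤ C := by
  obtain ⟨κ, B, hκ, hB, hZ⟩ := exists_abs_idealCount_sub_le K
  obtain ⟨A, hA, hZA⟩ := exists_idealCount_le K
  obtain ⟨C₁, hC₁⟩ := exists_abs_sum_log_nrm_sub_le K ⟨hB, hZ⟩
  have hη := countSaving_pos K
  have hη1 : 0 ≤ 1 - countSaving K := by
    have : (1 : ℝ) ≤ Module.finrank ℚ K := Nat.one_le_cast.2 Module.finrank_pos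
    unfold countSaving
    rw [sub_nonneg, div_le_one (by positivity)]
    linarith
  obtain ⟨C₂, hC₂⟩ := exists_sum_log_mul_rpow_le K hη1 (by linarith)
  set D := 4 * (Module.finrank ℚ K * Real.log 4)
  refine ⟨(C₁ + B * C₂ + 2 * A * D) / κ, fun x hx => ?_⟩
  have hx0 : 0 < x := by linarith
  obtain ⟨m, hm⟩ := pow_unbounded_of_one_lt x (one_lt_two (α := ℝ))
  -- The exponent m + 1 is at least 1, so the term k = 1 can be split off.
  have hm1 : x < 2 ^ (m + 1) := hm.trans_le (pow_le_pow_right₀ one_le_two (Nat.le_succ m))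
  set M := ∑ p ∈ primesLE K x, Real.log (nrm p.toNz) / nrm p.toNz
  set T := ∑ a ∈ idealsLE K x, Real.log (nrm a)
  set S₁ := ∑ p ∈ primesLE K x, Real.log (nrm p.toNz) * idealCount K (x / nrm p.toNz)
  set S₂ := ∑ p ∈ primesLE K x, Real.log (nrm p.toNz) *
        ∑ k ∈ Finset.Icc 2 (m + 1), idealCount K (x / nrm p.toNz ^ k)
  have hT : T = S₁ + S₂ := by
    rw [← Finset.sum_add_distrib]
    refine (sum_log_nrm_eq hm1).trans (Finset.sum_congr rfl fun p _ => ?_)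
    rw [← mul_add, ← Finset.add_sum_Ioc_eq_sum_Icc (by omega : 1 ≤ m + 1), pow_one]
    rfl
  have hS₂0 : 0 ≤ S₂ := Finset.sum_nonneg fun p _ =>
    mul_nonneg p.log_nrm_pos.le (Finset.sum_nonneg fun k _ => Nat.cast_nonneg _)
  have hS₂ : S₂ ≤ 2 * A * D * x := by
    calc S₂ ≤ ∑ p ∈ primesLE K x, Real.log (nrm p.toNz) * (A * x * (2 / nrm p.toNz ^ 2)) := by
          refine Finset.sum_le_sum fun p _ => mul_le_mul_of_nonneg_left ?_ p.log_nrm_pos.le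
          refine le_trans ?_ (mul_le_mul_of_nonneg_left
            (sum_Icc_two_inv_pow_le p.two_le_nrm (m + 1)) (by positivity))
          rw [Finset.mul_sum]
          refine Finset.sum_le_sum fun k _ => ?_
          have := nrm_pos p.toNz
          refine (hZA _ (by positivity)).trans (le_of_eq (by ring))
      _ = 2 * A * x * ∑ p ∈ primesLE K x, Real.log (nrm p.toNz) / nrm p.toNz ^ 2 := by
          rw [Finset.mul_sum]
          exact Finset.sum_congr rfl fun p _ => by ring
      _ ≤ 2 * A * x * D := by
          gcongr
          exact sum_log_div_nrm_sq_le K x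
      _ = _ := by ring
  -- The power saving matters here: an error O(x / N(p)) in the ideal count would sum to order x log
  -- x, whereas (x / N(p))^(1−η) sums to O(x).
  have hS₁ : |S₁ - κ * x * M| ≤ B * C₂ * x := by
    have h1 : S₁ - κ * x * M = ∑ p ∈ primesLE K x, Real.log (nrm p.toNz) *
        (idealCount K (x / nrm p.toNz) - κ * (x / nrm p.toNz)) := by
      rw [Finset.mul_sum, ← Finset.sum_sub_distrib]
      exact Finset.sum_congr rfl fun p _ => by ring
    rw [h1]
    refine (Finset.abs_sum_le_sum_abs _ _).trans ?_
    calc _ ≤ ∑ p ∈ primesLE K x, B *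
          (Real.log (nrm p.toNz) * (x / nrm p.toNz) ^ (1 - countSaving K)) := by
          refine Finset.sum_le_sum fun p hp => ?_
          rw [abs_mul, abs_of_pos p.log_nrm_pos]
          have h2 := hZ (x / nrm p.toNz) ((one_le_div (nrm_pos _)).2 (mem_primesLE.1 hp))
          have := mul_le_mul_of_nonneg_left h2 p.log_nrm_pos.le
          linarith
      _ ≤ B * (C₂ * x) := by
          rw [← Finset.mul_sum]
          exact mul_le_mul_of_nonneg_left (hC₂ x hx) hB.le
      _ = _ := by ring
  have hT' := hC₁ x hx
  rw [le_div_iff₀ hκ]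
  have hkey : |κ * x * (M - Real.log x)| ≤ (C₁ + B * C₂ + 2 * A * D) * x := by
    rw [abs_le]
    rw [abs_le] at hS₁ hT'
    constructor <;> nlinarith
  rw [abs_mul, abs_of_pos (by positivity)] at hkey
  nlinarith

end Mertens
end IdealSieve
end

noncomputable section

namespace IdealSieve

/-! ### Bounds for the Buchstab function -/

section BuchstabBounds

open MeasureTheory intervalIntegral

theorem intervalIntegrable_buchstab {a b : ℝ} (ha : 1 ≤ a) (hb : 1 ≤ b) :
    IntervalIntegrable buchstab volume a b :=
  (isBuchstab_buchstab.continuousOn.mono fun _ hx =>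
    (le_min ha hb).trans hx.1).intervalIntegrable

theorem mul_buchstab_eq {u : ℝ} (hu : 1 ≤ u) :
    u * buchstab u = 1 + ∫ v in (1 : ℝ)..(max 1 (u - 1)), buchstab v := by
  set n := ⌈u⌉₊
  have hun : u ≤ n := Nat.le_ceil u
  have h1 : (∫ v in (1 : ℝ)..(max 1 (u - 1)), buchstabIter n v) =
      ∫ v in (1 : ℝ)..(max 1 (u - 1)), buchstab v := by
    refine integral_congr fun v hv => ?_
    rw [Set.uIcc_of_le (le_max_left _ _)] at hv
    refine (buchstab_eq_iter n v (hv.2.trans (max_le ?_ ?_))).symm <;> linarith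
  rw [buchstab_eq_iter (n + 1) u (by push_cast; linarith), ← h1]
  simp only [buchstabIter, max_eq_right hu]
  field_simp

/-- For u > 2 the integral equation and the bounds on [1, u − 1] place u B(u) between 1 + (u − 2)/2
= u/2 and u − 1, so both bounds propagate by unit steps. The lower bound lets the final error be
written as relative. -/
theorem buchstab_mem_Icc {u : ℝ} (hu : 1 ≤ u) : buchstab u ∈ Set.Icc (1 / 2) 1 := by
  have key : ∀ n : ℕ, ∀ u : ℝ, 1 ≤ u → u ≤ n + 2 → buchstab u ∈ Set.Icc (1 / 2) 1 := by
    intro n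
    induction n with
    | zero =>
      intro u h1 h2
      rw [isBuchstab_buchstab.eq_inv u h1 (by simpa using h2)]
      have h2' : u ≤ 2 := by simpa using h2
      exact ⟨by gcongr, (div_le_one (by linarith)).2 h1⟩
    | succ n ih =>
      intro u h1 h2
      rcases le_or_gt u 2 with hu2 | hu2
      · exact ih u h1 (hu2.trans (by have : (0 : ℝ) ≤ n := n.cast_nonneg; linarith))
      push_cast at h2
      have hmax : max 1 (u - 1) = u - 1 := max_eq_right (by linarith)
      have hmul := mul_buchstab_eq h1
      rw [hmax] at hmul
      have hint := intervalIntegrable_buchstab le_rfl (show 1 ≤ u - 1 by linarith)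
      have hbd : ∀ v ∈ Set.Icc 1 (u - 1), buchstab v ∈ Set.Icc (1 / 2) 1 := fun v hv =>
        ih v hv.1 (by linarith [hv.2])
      have hlow : (u - 2) * (1 / 2) ≤ ∫ v in (1 : ℝ)..(u - 1), buchstab v := by
        have := integral_mono_on (show 1 ≤ u - 1 by linarith) intervalIntegrable_const hint
          fun v hv => (hbd v hv).1
        rw [intervalIntegral.integral_const, smul_eq_mul] at this
        linarith
      have hup : ∫ v in (1 : ℝ)..(u - 1), buchstab v ≤ u - 2 := by
        have := integral_mono_on (show 1 ≤ u - 1 by linarith) hint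
          (intervalIntegrable_const (c := (1 : ℝ))) fun v hv => (hbd v hv).2
        rw [intervalIntegral.integral_const, smul_eq_mul] at this
        linarith
      constructor <;> nlinarith
  exact key ⌈u⌉₊ u hu ((Nat.le_ceil u).trans (by linarith))

/-- The integral equation makes u B(u) Lipschitz with constant 1; passing from u B(u) to B(u) costs
one more |u − v|, as B ≤ 1 and u ≥ 1. -/
theorem abs_buchstab_sub_le {u v : ℝ} (hu : 1 ≤ u) (hv : 1 ≤ v) :
    |buchstab u - buchstab v| ≤ 2 * |u - v| := by
  have hI : |(∫ x in (max 1 (v - 1))..(max 1 (u - 1)), buchstab x)| ≤ |u - v| := by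
    have h1 := intervalIntegral.norm_integral_le_of_norm_le_const (C := 1) (f := buchstab)
      (a := max 1 (v - 1)) (b := max 1 (u - 1)) (fun x hx => by
        have hx1 : 1 ≤ x := ((le_min (le_max_left _ _) (le_max_left _ _)).trans hx.1.le)
        have := buchstab_mem_Icc hx1
        rw [Real.norm_eq_abs, abs_le]
        constructor <;> linarith [this.1, this.2])
    rw [Real.norm_eq_abs, one_mul] at h1
    refine h1.trans ((abs_max_sub_max_le_max _ _ _ _).trans ?_)
    simp
  have h2 : u * buchstab u - v * buchstab v =
      ∫ x in (max 1 (v - 1))..(max 1 (u - 1)), buchstab x := by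
    rw [mul_buchstab_eq hu, mul_buchstab_eq hv, add_sub_add_left_eq_sub]
    exact integral_interval_sub_left (intervalIntegrable_buchstab le_rfl (le_max_left _ _))
      (intervalIntegrable_buchstab le_rfl (le_max_left _ _))
  have hBv := buchstab_mem_Icc hv
  have h3 : u * (buchstab u - buchstab v) =
      (u * buchstab u - v * buchstab v) - buchstab v * (u - v) := by ring
  have h4 : u * |buchstab u - buchstab v| ≤ 2 * |u - v| := by
    have h5 : u * |buchstab u - buchstab v| = |u * (buchstab u - buchstab v)| := by
      rw [abs_mul, abs_of_pos (show 0 < u by linarith)]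
    rw [h5, h3]
    refine (abs_sub _ _).trans ?_
    rw [h2, abs_mul, abs_of_nonneg (show 0 ≤ buchstab v by linarith [hBv.1])]
    nlinarith [abs_nonneg (u - v), hBv.2]
  nlinarith [abs_nonneg (buchstab u - buchstab v)]

end BuchstabBounds

/-! ### Partial summation against Mertens' theorem -/

section PartialSummation

open MeasureTheory intervalIntegral

/-- With D(x) the deviation of the mass up to x from x − a, the difference is g(b) D(b) − ∫ D g'.
Only a Lipschitz g is required, since the Buchstab function has a corner at 2; absolute continuity
provides g' almost everywhere. -/
theorem abs_sum_mul_sub_integral_le {ι : Type*} {S : Finset ι} {c τ : ι → ℝ} {a b R L : ℝ}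
    (hab : a ≤ b) (hτ : ∀ i ∈ S, τ i ∈ Set.Icc a b)
    (hR : ∀ x ∈ Set.Icc a b, |∑ i ∈ S with τ i ≤ x, c i - (x - a)| ≤ R) {g : ℝ → ℝ} (hL : 0 ≤ L)
    (hg : ∀ x ∈ Set.Icc a b, ∀ z ∈ Set.Icc a b, |g x - g z| ≤ L * |x - z|) :
    |∑ i ∈ S, c i * g (τ i) - ∫ x in a..b, g x| ≤ R * |g b| + R * L * (b - a) := by
  have hlip : LipschitzOnWith L.toNNReal g (Set.Icc a b) :=
    LipschitzOnWith.of_dist_le_mul fun x hx z hz => by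
      rw [Real.dist_eq, Real.dist_eq, Real.coe_toNNReal _ hL]
      exact hg x hx z hz
  have hac : AbsolutelyContinuousOnInterval g a b :=
    LipschitzOnWith.absolutelyContinuousOnInterval (by rwa [Set.uIcc_of_le hab])
  have hint : IntegrableOn (deriv g) (Set.Icc a b) :=
    (intervalIntegrable_iff_integrableOn_Icc_of_le hab).1 hac.intervalIntegrable_deriv
  set D : ℝ → ℝ := fun x => ∑ i ∈ S with τ i ≤ x, c i - (x - a)
  have hder : ∀ᵐ x ∂(volume.restrict (Set.Icc a b)), |deriv g x| ≤ L := by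
    rw [← restrict_Ioo_eq_restrict_Icc]
    filter_upwards [ae_restrict_mem measurableSet_Ioo] with x hx
    have h1 := norm_deriv_le_of_lipschitzOn (Icc_mem_nhds hx.1 hx.2) hlip
    rwa [Real.coe_toNNReal _ hL] at h1
  have hrep : ∀ i ∈ S, g (τ i) = g b - ∫ x in Set.Icc a b, (Set.Ici (τ i)).indicator (deriv g) x := by
    intro i hi
    have hi' := hτ i hi
    have h1 := (hac.mono (c := τ i) (d := b) (by
      rw [Set.uIcc_of_le hab, Set.uIcc_of_le hi'.2]
      exact Set.Icc_subset_Icc_left hi'.1)).integral_deriv_eq_sub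
    rw [integral_of_le hi'.2, ← integral_Icc_eq_integral_Ioc] at h1
    rw [setIntegral_indicator measurableSet_Ici]
    have h2 : Set.Icc a b ∩ Set.Ici (τ i) = Set.Icc (τ i) b := by
      ext x
      simp only [Set.mem_inter_iff, Set.mem_Icc, Set.mem_Ici]
      constructor
      · rintro ⟨h3, h4⟩; exact ⟨h4, h3.2⟩
      · rintro ⟨h3, h4⟩; exact ⟨⟨hi'.1.trans h3, h4⟩, h3⟩
    rw [h2, h1]
    ring
  have hsum : ∑ i ∈ S, c i * g (τ i) = g b * ∑ i ∈ S, c i -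
      ∫ x in Set.Icc a b, (∑ i ∈ S with τ i ≤ x, c i) * deriv g x := by
    have h1 : (∫ x in Set.Icc a b, (∑ i ∈ S with τ i ≤ x, c i) * deriv g x) =
        ∑ i ∈ S, c i * ∫ x in Set.Icc a b, (Set.Ici (τ i)).indicator (deriv g) x := by
      simp_rw [← MeasureTheory.integral_const_mul]
      rw [← MeasureTheory.integral_finsetSum]
      · refine integral_congr_ae (Filter.Eventually.of_forall fun x => ?_)
        simp only
        rw [Finset.sum_filter, Finset.sum_mul]
        refine Finset.sum_congr rfl fun i _ => ?_
        by_cases h : τ i ≤ x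
        · simp [h]
        · simp [h]
      · intro i _
        exact (hint.indicator measurableSet_Ici).const_mul _
    rw [h1, Finset.mul_sum, ← Finset.sum_sub_distrib]
    refine Finset.sum_congr rfl fun i hi => ?_
    rw [hrep i hi]
    ring
  have hparts : ∫ x in a..b, g x = g b * (b - a) - ∫ x in Set.Icc a b, (x - a) * deriv g x := by
    have hid : AbsolutelyContinuousOnInterval (fun x : ℝ => x - a) a b :=
      LipschitzOnWith.absolutelyContinuousOnInterval (K := 1)
        (LipschitzOnWith.of_dist_le_mul fun x _ z _ => by simp)
    have h1 := hac.integral_mul_deriv_eq_deriv_mul hid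
    have h2 : deriv (fun x : ℝ => x - a) = fun _ => 1 := by
      funext x
      simp
    rw [h2] at h1
    simp only [mul_one, sub_self, mul_zero, sub_zero] at h1
    rw [h1, integral_of_le hab, ← integral_Icc_eq_integral_Ioc]
    simp_rw [mul_comm]
  have hall : ∑ i ∈ S with τ i ≤ b, c i = ∑ i ∈ S, c i := by
    rw [Finset.filter_true_of_mem fun i hi => (hτ i hi).2]
  have hi1 : IntegrableOn (fun x => (∑ i ∈ S with τ i ≤ x, c i) * deriv g x) (Set.Icc a b) := by
    have : (fun x => (∑ i ∈ S with τ i ≤ x, c i) * deriv g x) =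
        fun x => ∑ i ∈ S, c i * (Set.Ici (τ i)).indicator (deriv g) x := by
      funext x
      rw [Finset.sum_filter, Finset.sum_mul]
      refine Finset.sum_congr rfl fun i _ => ?_
      by_cases h : τ i ≤ x
      · simp [h]
      · simp [h]
    rw [this]
    exact integrable_finsetSum _ fun i _ => (hint.indicator measurableSet_Ici).const_mul _
  have hi2 : IntegrableOn (fun x => (x - a) * deriv g x) (Set.Icc a b) := by
    have := hac.intervalIntegrable_deriv.continuousOn_mul
      (g := fun x => x - a) (by fun_prop)
    exact (intervalIntegrable_iff_integrableOn_Icc_of_le hab).1 this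
  have hmain : ∑ i ∈ S, c i * g (τ i) - ∫ x in a..b, g x =
      g b * D b - ∫ x in Set.Icc a b, D x * deriv g x := by
    have h1 : (∫ x in Set.Icc a b, D x * deriv g x) =
        (∫ x in Set.Icc a b, (∑ i ∈ S with τ i ≤ x, c i) * deriv g x) -
          ∫ x in Set.Icc a b, (x - a) * deriv g x := by
      rw [← MeasureTheory.integral_sub hi1 hi2]
      simp only [D, sub_mul]
    rw [h1, hsum, hparts]
    simp only [D, hall]
    ring
  have hbound : |∫ x in Set.Icc a b, D x * deriv g x| ≤ R * L * (b - a) := by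
    have h1 := norm_setIntegral_le_of_norm_le_const_ae (μ := volume) (s := Set.Icc a b)
      (f := fun x => D x * deriv g x) (C := R * L) (by simp) (by
        filter_upwards [hder, ae_restrict_mem measurableSet_Icc] with x hx hx2
        rw [Real.norm_eq_abs, abs_mul]
        exact mul_le_mul (hR x hx2) hx (abs_nonneg _) ((abs_nonneg _).trans (hR x hx2)))
    simpa [hab] using h1
  rw [hmain]
  refine (abs_sub _ _).trans (add_le_add ?_ hbound)
  rw [abs_mul, mul_comm]
  exact mul_le_mul_of_nonneg_right (hR b ⟨hab, le_rfl⟩) (abs_nonneg _)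

/-- The differential equation gives the antiderivative −(ℓ/x) B(ℓ/x) / ℓ; at the upper end 2 B(2) =
1. -/
theorem integral_buchstab_div_sq {ℓ u : ℝ} (hℓ : 0 < ℓ) (hu : 2 ≤ u) :
    ∫ x in (ℓ / u)..(ℓ / 2), buchstab (ℓ / x - 1) / x ^ 2 = (u * buchstab u - 1) / ℓ := by
  have hu0 : 0 < u := by linarith
  have ht0 : 0 < ℓ / u := by positivity
  have hle : ℓ / u ≤ ℓ / 2 := by gcongr
  have hv : ∀ x ∈ Set.Icc (ℓ / u) (ℓ / 2), 2 ≤ ℓ / x := fun x hx => by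
    rw [le_div_iff₀ (ht0.trans_le hx.1)]
    linarith [hx.2]
  have hcd : ContinuousOn (fun x : ℝ => ℓ / x) (Set.Icc (ℓ / u) (ℓ / 2)) :=
    continuousOn_const.div continuousOn_id fun x hx => (ht0.trans_le hx.1).ne'
  have hB := isBuchstab_buchstab
  rw [integral_eq_sub_of_hasDerivAt_of_le (f := fun x => -(ℓ / x * buchstab (ℓ / x)) / ℓ) hle]
  · have h2 : buchstab 2 = 1 / 2 := hB.eq_inv 2 (by norm_num) le_rfl
    rw [div_div_cancel₀ hℓ.ne', div_div_cancel₀ hℓ.ne', h2]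
    ring
  · refine ((hcd.mul (hB.continuousOn.comp hcd fun x hx => ?_)).neg).div_const _
    exact Set.mem_Ici.2 (by linarith [hv x hx])
  · intro x hx
    have hx0 : 0 < x := ht0.trans hx.1
    have h2 : 2 < ℓ / x := by
      rw [lt_div_iff₀ hx0]
      linarith [hx.2]
    have h3 : HasDerivAt (fun x : ℝ => ℓ / x) (-ℓ / x ^ 2) x := by
      simpa [div_eq_mul_inv, neg_mul] using (hasDerivAt_inv hx0.ne').const_mul ℓ
    have h4 := (((hB.hasDerivAt (ℓ / x) h2).comp x h3).neg).div_const ℓ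
    refine h4.congr_deriv ?_
    field_simp
  · refine ContinuousOn.intervalIntegrable ?_
    rw [Set.uIcc_of_le hle]
    refine (hB.continuousOn.comp (hcd.sub continuousOn_const) fun x hx => ?_).div
      (continuousOn_id.pow 2) fun x hx => (pow_pos (ht0.trans_le hx.1) 2).ne'
    have := hv x hx
    simp only [Pi.sub_apply, Set.mem_Ici]
    linarith

theorem abs_sum_buchstab_sub_le {ι : Type*} {S : Finset ι} {c τ : ι → ℝ} {ℓ u β R : ℝ}
    (hℓ : 0 < ℓ) (hu : 2 ≤ u) (huβ : u ≤ β) (hτ : ∀ i ∈ S, τ i ∈ Set.Icc (ℓ / u) (ℓ / 2))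
    (hR : ∀ x ∈ Set.Icc (ℓ / u) (ℓ / 2), |∑ i ∈ S with τ i ≤ x, c i - (x - ℓ / u)| ≤ R) :
    |∑ i ∈ S, c i * (buchstab (ℓ / τ i - 1) / τ i ^ 2) - (u * buchstab u - 1) / ℓ| ≤
      R * (4 + β ^ 4 + β ^ 3) / ℓ ^ 2 := by
  have hu0 : 0 < u := by linarith
  have hβ0 : 0 < β := by linarith
  set t := ℓ / u
  have ht0 : 0 < t := by positivity
  have htβ : ℓ / β ≤ t := by simp only [t]; gcongr
  have htβ' : 1 / t ≤ β / ℓ := by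
    rw [div_le_div_iff₀ ht0 hℓ]
    rw [div_le_iff₀ hβ0] at htβ
    linarith
  have hle : t ≤ ℓ / 2 := by simp only [t]; gcongr
  have hv : ∀ x ∈ Set.Icc t (ℓ / 2), 1 ≤ ℓ / x - 1 := fun x hx => by
    have : 2 ≤ ℓ / x := by
      rw [le_div_iff₀ (ht0.trans_le hx.1)]
      linarith [hx.2]
    linarith
  have hR0 : 0 ≤ R := (abs_nonneg _).trans (hR t ⟨le_rfl, hle⟩)
  have hinv : ∀ x ∈ Set.Icc t (ℓ / 2), 0 ≤ 1 / x ∧ 1 / x ≤ β / ℓ := fun x hx => by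
    have hx0 : 0 < x := ht0.trans_le hx.1
    exact ⟨by positivity, (one_div_le_one_div_of_le ht0 hx.1).trans htβ'⟩
  -- On the interval 1/x ≤ β/ℓ. The term with β⁴ comes from varying B, that with β³ from varying
  -- 1/x².
  set L := (2 * β ^ 4 + 2 * β ^ 3) / ℓ ^ 3
  have key := abs_sum_mul_sub_integral_le (g := fun x => buchstab (ℓ / x - 1) / x ^ 2) (L := L)
    hle hτ hR (by positivity) ?_
  · rw [integral_buchstab_div_sq hℓ hu] at key
    refine key.trans ?_
    have h1 : buchstab (ℓ / (ℓ / 2) - 1) = 1 := by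
      rw [div_div_cancel₀ hℓ.ne', isBuchstab_buchstab.eq_inv _ (by norm_num) (by norm_num)]
      norm_num
    have h2 : L * (ℓ / 2 - t) ≤ (β ^ 4 + β ^ 3) / ℓ ^ 2 := by
      calc L * (ℓ / 2 - t) ≤ L * (ℓ / 2) := by gcongr; linarith
        _ = _ := by simp only [L]; field_simp
    simp only [h1]
    calc R * |1 / (ℓ / 2) ^ 2| + R * L * (ℓ / 2 - t)
        = R * (4 / ℓ ^ 2) + R * (L * (ℓ / 2 - t)) := by
          rw [abs_of_nonneg (by positivity)]
          field_simp
          norm_num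
      _ ≤ R * (4 / ℓ ^ 2) + R * ((β ^ 4 + β ^ 3) / ℓ ^ 2) := by gcongr
      _ = _ := by ring
  · intro x hx z hz
    have hx0 : 0 < x := ht0.trans_le hx.1
    have hz0 : 0 < z := ht0.trans_le hz.1
    obtain ⟨ha0, ha⟩ := hinv x hx
    obtain ⟨hb0, hb⟩ := hinv z hz
    have hBz := buchstab_mem_Icc (hv z hz)
    have h1 : |buchstab (ℓ / x - 1) - buchstab (ℓ / z - 1)| ≤ 2 * (ℓ * (β / ℓ) ^ 2 * |x - z|) := by
      refine (abs_buchstab_sub_le (hv x hx) (hv z hz)).trans ?_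
      have : ℓ / x - 1 - (ℓ / z - 1) = -(ℓ * (1 / x * (1 / z)) * (x - z)) := by
        field_simp
        ring
      rw [this, abs_neg, abs_mul, abs_of_nonneg (by positivity), pow_two]
      gcongr
    have h2 : |1 / x ^ 2 - 1 / z ^ 2| ≤ 2 * (β / ℓ) ^ 3 * |x - z| := by
      have : 1 / x ^ 2 - 1 / z ^ 2 =
          -((1 / x * (1 / z) * (1 / z) + 1 / x * (1 / x) * (1 / z)) * (x - z)) := by
        field_simp
        ring
      rw [this, abs_neg, abs_mul, abs_of_nonneg (by positivity)]
      gcongr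
      calc _ ≤ β / ℓ * (β / ℓ) * (β / ℓ) + β / ℓ * (β / ℓ) * (β / ℓ) := by gcongr
        _ = _ := by ring
    have h3 : buchstab (ℓ / x - 1) / x ^ 2 - buchstab (ℓ / z - 1) / z ^ 2 =
        (buchstab (ℓ / x - 1) - buchstab (ℓ / z - 1)) * (1 / x) ^ 2 +
          buchstab (ℓ / z - 1) * (1 / x ^ 2 - 1 / z ^ 2) := by ring
    rw [h3]
    refine (abs_add_le _ _).trans ?_
    rw [abs_mul, abs_mul, abs_of_nonneg (show 0 ≤ (1 / x) ^ 2 by positivity),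
      abs_of_nonneg (show 0 ≤ buchstab (ℓ / z - 1) by linarith [hBz.1])]
    calc _ ≤ 2 * (ℓ * (β / ℓ) ^ 2 * |x - z|) * (β / ℓ) ^ 2 + 1 * (2 * (β / ℓ) ^ 3 * |x - z|) := by
          gcongr
          exact hBz.2
      _ = L * |x - z| := by
          simp only [L]
          field_simp

end PartialSummation
end IdealSieve
end

noncomputable section

namespace IdealSieve

/-! ### Buchstab's identity -/

section Sieve

variable {K : Type*} [Field K] [NumberField K] {prec : PrimeId K → PrimeId K → Prop}

theorem IsNormOrder.irrefl (h : IsNormOrder prec) (p : PrimeId K) : ¬ prec p p := by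
  have := h.strictTotal
  exact irrefl_of prec p

theorem IsNormOrder.trans (h : IsNormOrder prec) {p q s : PrimeId K} (h1 : prec p q)
    (h2 : prec q s) : prec p s := by
  have := h.strictTotal
  exact trans_of prec h1 h2

theorem IsNormOrder.trichotomy (h : IsNormOrder prec) (p q : PrimeId K) :
    prec p q ∨ p = q ∨ prec q p := by
  have := h.strictTotal
  exact trichotomous_of prec p q

theorem IsNormOrder.nrm_le (h : IsNormOrder prec) {p q : PrimeId K} (hpq : ¬ prec q p) :
    nrm p.toNz ≤ nrm q.toNz := by
  by_contra! hlt
  exact hpq (h.of_nrm_lt q p hlt)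

theorem IsNormOrder.nrm_le_of_prec (h : IsNormOrder prec) {p q : PrimeId K} (hpq : prec p q) :
    nrm p.toNz ≤ nrm q.toNz :=
  h.nrm_le fun hqp => h.irrefl p (h.trans hpq hqp)

theorem PrimeId.dvd_mul_iff {s : PrimeId K} {a b : NzIdeal K} :
    s.toNz ∣ a * b ↔ s.toNz ∣ a ∨ s.toNz ∣ b := by
  simp only [nonZeroDivisors_dvd_iff_dvd_coe]
  exact s.prime.dvd_mul

theorem PrimeId.toNz_dvd_toNz_iff {s t : PrimeId K} : s.toNz ∣ t.toNz ↔ s = t := by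
  refine ⟨fun h => ?_, fun h => h ▸ dvd_rfl⟩
  rw [nonZeroDivisors_dvd_iff_dvd_coe] at h
  exact HeightOneSpectrum.ext ((t.isMaximal.eq_of_le s.isPrime.ne_top (Ideal.dvd_iff_le.1 h)).symm)

theorem PrimeId.not_dvd_one (s : PrimeId K) : ¬ s.toNz ∣ 1 := fun h =>
  absurd ((nrm_le_of_dvd h).trans_eq nrm_one) (by linarith [s.two_le_nrm])

theorem mem_sifted_iff (h : IsNormOrder prec) {p : PrimeId K} {a : NzIdeal K} :
    a ∈ sifted prec p ↔ ∀ s : PrimeId K, s.toNz ∣ a → ¬ prec s p := by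
  have h1 : primeProd prec p = ∏ s ∈ (h.finite_setOf_prec p).toFinset, s.asIdeal :=
    finprod_mem_eq_finite_toFinset_prod _ _
  change IsCoprime (a : Ideal (𝓞 K)) (primeProd prec p) ↔ _
  rw [h1, IsCoprime.prod_right_iff]
  simp only [Set.Finite.mem_toFinset, Set.mem_ofPred_eq]
  have h2 : ∀ s : PrimeId K, IsCoprime (a : Ideal (𝓞 K)) s.asIdeal ↔ ¬ s.toNz ∣ a := by
    intro s
    rw [nonZeroDivisors_dvd_iff_dvd_coe, Ideal.isCoprime_iff_sup_eq]
    change _ ↔ ¬ s.asIdeal ∣ _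
    rw [Ideal.dvd_iff_le]
    constructor
    · intro h3 h4
      rw [sup_eq_right.2 h4] at h3
      exact s.isPrime.ne_top h3
    · intro h3
      refine s.isMaximal.1.2 _ (lt_of_le_of_ne le_sup_right fun h4 => h3 ?_)
      rw [h4]
      exact le_sup_left
  simp only [h2]
  exact forall_congr' fun s => ⟨fun h3 h4 h5 => h3 h5 h4, fun h3 h4 h5 => h3 h5 h4⟩

theorem one_mem_sifted (h : IsNormOrder prec) (p : PrimeId K) : (1 : NzIdeal K) ∈ sifted prec p :=
  (mem_sifted_iff h).2 fun s hs => absurd hs s.not_dvd_one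

theorem toNz_mem_sifted_iff (h : IsNormOrder prec) {p s : PrimeId K} :
    s.toNz ∈ sifted prec p ↔ ¬ prec s p := by
  rw [mem_sifted_iff h]
  simp [PrimeId.toNz_dvd_toNz_iff]

/-- A nonzero ideal different from `1` is the product of its least prime divisor `s` and an ideal
without prime divisors below `s`. -/
theorem exists_eq_least_prime_mul (h : IsNormOrder prec) {a : NzIdeal K} (ha : a ≠ 1) :
    ∃ (s : PrimeId K) (b : NzIdeal K), a = s.toNz * b ∧ b ∈ sifted prec s := by
  have hfin : {s : PrimeId K | s.toNz ∣ a}.Finite :=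
    (finite_setOf_prime_nrm_le (nrm a)).subset fun s hs => nrm_le_of_dvd hs
  have hne : hfin.toFinset.Nonempty := by
    obtain ⟨s, hs⟩ := exists_prime_dvd ha
    exact ⟨s, by simpa using hs⟩
  -- The least prime divisor is the one with the fewest predecessors, a finite number for every
  -- prime.
  obtain ⟨s, hs, hmin⟩ := hfin.toFinset.exists_min_image
    (fun s => {t : PrimeId K | prec t s}.ncard) hne
  simp only [Set.Finite.mem_toFinset, Set.mem_ofPred_eq] at hs hmin
  obtain ⟨b, rfl⟩ := hs
  refine ⟨s, b, rfl, (mem_sifted_iff h).2 fun t ht hts => ?_⟩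
  have h1 : {t' : PrimeId K | prec t' t}.ncard < {t' : PrimeId K | prec t' s}.ncard := by
    refine Set.ncard_lt_ncard ⟨fun t' ht' => h.trans ht' hts, fun hsub => ?_⟩
      (h.finite_setOf_prec s)
    exact h.irrefl t (hsub hts)
  exact absurd (hmin t (ht.mul_left _)) (not_le.2 h1)

/-- If s preceded s', then s, dividing s'·b', would equal s' or divide b', which has no prime
divisor before s'. -/
theorem least_prime_unique (h : IsNormOrder prec) {s s' : PrimeId K} {b b' : NzIdeal K}
    (hb : b ∈ sifted prec s) (hb' : b' ∈ sifted prec s') (heq : s.toNz * b = s'.toNz * b') :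
    s = s' := by
  have key : ∀ {t t' : PrimeId K} {c c' : NzIdeal K}, c' ∈ sifted prec t' →
      t.toNz * c = t'.toNz * c' → ¬ prec t t' := by
    intro t t' c c' hc' he
    have h1 : t.toNz ∣ t'.toNz * c' := he ▸ dvd_mul_right _ _
    rcases PrimeId.dvd_mul_iff.1 h1 with h2 | h2
    · rw [PrimeId.toNz_dvd_toNz_iff.1 h2]
      exact h.irrefl t'
    · exact (mem_sifted_iff h).1 hc' t h2
  rcases h.trichotomy s s' with h1 | h1 | h1
  · exact absurd h1 (key hb' heq)
  · exact h1
  · exact absurd h1 (key hb heq.symm)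

theorem mul_mem_sifted (h : IsNormOrder prec) {p s : PrimeId K} {b : NzIdeal K}
    (hs : ¬ prec s p) (hb : b ∈ sifted prec s) : s.toNz * b ∈ sifted prec p := by
  refine (mem_sifted_iff h).2 fun t ht htp => ?_
  rcases PrimeId.dvd_mul_iff.1 ht with h1 | h1
  · rw [PrimeId.toNz_dvd_toNz_iff.1 h1] at htp
    exact hs htp
  · have h2 := (mem_sifted_iff h).1 hb t h1
    rcases h.trichotomy s t with h3 | h3 | h3
    · exact hs (h.trans h3 htp)
    · exact hs (h3 ▸ htp)
    · exact h2 h3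

theorem sq_le_nrm_mul (h : IsNormOrder prec) {s : PrimeId K} {b : NzIdeal K}
    (hb : b ∈ sifted prec s) (hb1 : b ≠ 1) : nrm s.toNz ^ 2 ≤ nrm (s.toNz * b) := by
  obtain ⟨t, ht⟩ := exists_prime_dvd hb1
  have h1 := h.nrm_le ((mem_sifted_iff h).1 hb t ht)
  have h2 := nrm_le_of_dvd ht
  rw [nrm_mul, pow_two]
  exact mul_le_mul_of_nonneg_left (h1.trans h2) (nrm_pos _).le

theorem tsum_union_four {ι : Type*} {f : ι → ℝ} (hf : Summable f) {A B C D : Set ι}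
    (h1 : Disjoint A B) (h2 : Disjoint (A ∪ B) C) (h3 : Disjoint (A ∪ B ∪ C) D) :
    ∑' a : (A ∪ B ∪ C ∪ D : Set ι), f a
      = ∑' a : A, f a + ∑' a : B, f a + ∑' a : C, f a + ∑' a : D, f a := by
  have hsub : ∀ A : Set ι, Summable fun a : A => f a := fun A => hf.subtype A
  rw [(hsub _).tsum_union_disjoint h3 (hsub _), (hsub _).tsum_union_disjoint h2 (hsub _),
    (hsub _).tsum_union_disjoint h1 (hsub _)]

/-- Buchstab's identity, with the contribution of the ideals of large norm estimated. -/
theorem abs_Phi_sub_le (h : IsNormOrder prec) {w : NzIdeal K → ℝ} (hw : ∀ a, 0 ≤ w a)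
    {r : NzIdeal K} (hsum : Summable fun a : NzIdeal K => w (a * r)) {X E : ℝ}
    (hE : ∑' a : {a : NzIdeal K | X < nrm (a * r)}, w ((a : NzIdeal K) * r) ≤ E)
    {p : PrimeId K} {F : Finset (PrimeId K)} (hF : ∀ s ∈ F, ¬ prec s p)
    (hF' : ∀ s, ¬ prec s p → s ∉ F → X < nrm s.toNz ^ 2 * nrm r) :
    |Phi prec w r p - w r - ∑' s : {s : PrimeId K | ¬ prec s p}, w (r * (s : PrimeId K).toNz) -
      ∑ s ∈ F, (Phi prec w (r * s.toNz) s - w (r * s.toNz))| ≤ E := by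
  classical
  set f : NzIdeal K → ℝ := fun a => w (a * r) with hf
  have hsub : ∀ A : Set (NzIdeal K), Summable fun a : A => f a := fun A => hsum.subtype A
  -- The sifted ideals are split into 1, the primes P, the ideals Q having least prime s in F and
  -- nontrivial cofactor, and the rest T.
  set P : Set (NzIdeal K) := PrimeId.toNz '' {s : PrimeId K | ¬ prec s p}
  set M : PrimeId K → Set (NzIdeal K) := fun s => (s.toNz * ·) '' (sifted prec s \ {1})
  set Q : Set (NzIdeal K) := ⋃ s ∈ F, M s
  set T : Set (NzIdeal K) := sifted prec p \ ({1} ∪ P ∪ Q)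
  have hMprime : ∀ s t : PrimeId K, t.toNz ∉ M s := by
    rintro s t ⟨b, ⟨hb, hb1⟩, he⟩
    have he' : s.toNz * b = t.toNz := he
    have h1 : s = t := PrimeId.toNz_dvd_toNz_iff.1 (he' ▸ dvd_mul_right _ _)
    subst h1
    exact hb1 (mul_eq_left.1 he')
  have hMone : ∀ s : PrimeId K, 1 ∉ M s := by
    rintro s ⟨b, -, he⟩
    exact s.not_dvd_one ⟨b, he.symm⟩
  have hd1 : Disjoint ({1} : Set (NzIdeal K)) P := by
    rw [Set.disjoint_singleton_left]
    rintro ⟨s, -, hs⟩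
    exact s.toNz_ne_one hs
  have hd2 : Disjoint ({1} ∪ P) Q := by
    rw [Set.disjoint_left]
    intro a ha haQ
    obtain ⟨s, -, has⟩ := Set.mem_iUnion₂.1 haQ
    rcases ha with rfl | ⟨t, -, rfl⟩
    · exact hMone s has
    · exact hMprime s t has
  have hd3 : Disjoint ({1} ∪ P ∪ Q) T := Set.disjoint_sdiff_right
  have hQsub : {1} ∪ P ∪ Q ⊆ sifted prec p := by
    rintro a ((rfl | ⟨s, hs, rfl⟩) | ha)
    · exact one_mem_sifted h p
    · exact (toNz_mem_sifted_iff h).2 hs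
    · obtain ⟨s, hs, b, ⟨hb, -⟩, rfl⟩ := Set.mem_iUnion₂.1 ha
      exact mul_mem_sifted h (hF s hs) hb
  have hunion : ({1} ∪ P ∪ Q) ∪ T = sifted prec p := Set.union_sdiff_cancel hQsub
  have hPhi : Phi prec w r p = ∑' a : ({1} ∪ P ∪ Q ∪ T : Set (NzIdeal K)), f a := by
    rw [hunion]
    rfl
  -- An ideal of T has a nontrivial cofactor and a least prime s outside F, so its norm is at least
  -- N(s)², and `hF'` puts it in the tail.
  have hT : T ⊆ {a : NzIdeal K | X < nrm (a * r)} := by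
    rintro a ⟨ha, hna⟩
    have ha1 : a ≠ 1 := fun h1 => hna (Or.inl (Or.inl h1))
    obtain ⟨s, b, rfl, hb⟩ := exists_eq_least_prime_mul h ha1
    have hsp : ¬ prec s p := (mem_sifted_iff h).1 ha s (dvd_mul_right _ _)
    have hb1 : b ≠ 1 := by
      rintro rfl
      exact hna (Or.inl (Or.inr ⟨s, hsp, (mul_one _).symm⟩))
    have hsF : s ∉ F := fun hsF =>
      hna (Or.inr (Set.mem_iUnion₂.2 ⟨s, hsF, b, ⟨hb, hb1⟩, rfl⟩))
    have h1 := hF' s hsp hsF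
    have h2 := sq_le_nrm_mul h hb hb1
    change X < nrm (s.toNz * b * r)
    rw [nrm_mul _ r]
    exact h1.trans_le (mul_le_mul_of_nonneg_right h2 (nrm_pos r).le)
  have hT0 : 0 ≤ ∑' a : T, f a := tsum_nonneg fun a => hw _
  have hTE : ∑' a : T, f a ≤ E := by
    refine le_trans ?_ hE
    exact Summable.tsum_le_tsum_of_inj (Set.inclusion hT) (Set.inclusion_injective hT)
      (fun c _ => hw _) (fun a => le_rfl) (hsub T) (hsub _)
  have hPsum : ∑' a : P, f a = ∑' s : {s : PrimeId K | ¬ prec s p}, w (r * (s : PrimeId K).toNz) := by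
    rw [tsum_image f PrimeId.toNz_injective.injOn]
    simp only [hf, mul_comm r]
  have hMsum : ∀ s : PrimeId K, ∑' a : M s, f a = Phi prec w (r * s.toNz) s - w (r * s.toNz) := by
    intro s
    have hinj : Function.Injective (fun b : NzIdeal K => s.toNz * b) := mul_right_injective _
    rw [tsum_image f hinj.injOn]
    have hg : Summable fun b : NzIdeal K => f (s.toNz * b) := hsum.comp_injective hinj
    have h1 := (hg.subtype ({1} : Set (NzIdeal K))).tsum_union_disjoint (t := sifted prec s \ {1})
      Set.disjoint_sdiff_right (hg.subtype _)
    rw [Set.union_sdiff_cancel (Set.singleton_subset_iff.2 (one_mem_sifted h s)),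
      tsum_singleton (1 : NzIdeal K) (fun b => f (s.toNz * b))] at h1
    have h2 : ∀ b : NzIdeal K, f (s.toNz * b) = w (b * (r * s.toNz)) := fun b => by
      simp only [hf]
      congr 1
      rw [mul_comm s.toNz b, mul_assoc, mul_comm s.toNz r]
    simp only [h2, one_mul] at h1 ⊢
    rw [Phi, h1]
    ring
  have hQsum : ∑' a : Q, f a = ∑ s ∈ F, (Phi prec w (r * s.toNz) s - w (r * s.toNz)) := by
    rw [Summable.tsum_finset_bUnion_disjoint]
    · exact Finset.sum_congr rfl fun s _ => hMsum s
    · intro s _ s' _ hss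
      rw [Function.onFun, Set.disjoint_left]
      rintro _ ⟨b, ⟨hb, -⟩, rfl⟩ ⟨b', ⟨hb', -⟩, he⟩
      exact hss (least_prime_unique h hb hb' he.symm)
    · intro s _
      exact hsub _
  have hall : Phi prec w r p = w r + ∑' a : P, f a + ∑' a : Q, f a + ∑' a : T, f a := by
    rw [hPhi, tsum_union_four hsum hd1 hd2 hd3, tsum_singleton (1 : NzIdeal K) f]
    simp only [hf, one_mul]
  rw [hall, ← hPsum, ← hQsum, abs_le]
  constructor <;> linarith

theorem le_Phi (h : IsNormOrder prec) {w : NzIdeal K → ℝ} (hw : ∀ a, 0 ≤ w a)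
    {r : NzIdeal K} (hsum : Summable fun a : NzIdeal K => w (a * r)) (p : PrimeId K) :
    w r ≤ Phi prec w r p := by
  have h1 := (hsum.subtype (sifted prec p)).le_tsum ⟨1, one_mem_sifted h p⟩ fun a _ => hw _
  simpa using! h1

/-- Only finitely many ideals lie outside the tail. -/
theorem summable_of_tail {w : NzIdeal K → ℝ} {r : NzIdeal K} {X : ℝ}
    (htail : Summable fun a : {a : NzIdeal K | X < nrm (a * r)} => w ((a : NzIdeal K) * r)) :
    Summable fun a : NzIdeal K => w (a * r) := by
  have hfin : ({a : NzIdeal K | X < nrm (a * r)}ᶜ).Finite := by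
    refine (finite_setOf_nrm_le X).subset fun a ha => ?_
    have h1 : nrm (a * r) ≤ X := not_lt.1 ha
    exact (nrm_le_of_dvd (dvd_mul_right a r)).trans h1
  exact (htail.add_compl (f := fun a : NzIdeal K => w (a * r)) (by
    have := hfin.fintype
    exact (hasSum_fintype _).summable))

end Sieve
end IdealSieve
end

noncomputable section

namespace IdealSieve

/-! ### Mertens' theorem on ranges of primes -/

section Mass

variable {K : Type*} [Field K] [NumberField K] {prec : PrimeId K → PrimeId K → Prop}

open scoped Classical in
/-- The primes of norm at most `x` that do not precede `p`. -/
def primesFrom (prec : PrimeId K → PrimeId K → Prop) (p : PrimeId K) (x : ℝ) :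
    Finset (PrimeId K) :=
  {s ∈ primesLE K x | ¬ prec s p}

theorem mem_primesFrom {p s : PrimeId K} {x : ℝ} :
    s ∈ primesFrom prec p x ↔ nrm s.toNz ≤ x ∧ ¬ prec s p := by
  simp [primesFrom]

theorem log_nrm_div_nonneg (s : PrimeId K) : 0 ≤ Real.log (nrm s.toNz) / nrm s.toNz :=
  div_nonneg s.log_nrm_pos.le (nrm_pos _).le

variable (K) in
/-- Mertens' theorem for the primes not preceding `p`. -/
theorem exists_abs_sum_primesFrom_sub_le : ∃ C : ℝ, 0 ≤ C ∧
    ∀ prec : PrimeId K → PrimeId K → Prop, IsNormOrder prec → ∀ (p : PrimeId K) (x : ℝ),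
      nrm p.toNz ≤ x →
      |∑ s ∈ primesFrom prec p x, Real.log (nrm s.toNz) / nrm s.toNz
        - (Real.log x - Real.log (nrm p.toNz))| ≤ C := by
  classical
  obtain ⟨C, hC⟩ := exists_abs_sum_log_nrm_div_sub_log_le K
  have hC0 : 0 ≤ C := (abs_nonneg _).trans (hC 1 le_rfl)
  refine ⟨2 * C + Real.log 2, by positivity, fun prec h p x hx => ?_⟩
  have hp := p.two_le_nrm
  have h1 := abs_le.1 (hC x (by linarith))
  have h2 := abs_le.1 (hC (nrm p.toNz) (by linarith))
  have h3 := abs_le.1 (hC (nrm p.toNz / 2) (by linarith))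
  have hsplit := Finset.sum_filter_add_sum_filter_not (primesLE K x) (fun s => prec s p)
    (fun s => Real.log (nrm s.toNz) / nrm s.toNz)
  -- The primes before p lie between those of norm at most N(p)/2 and those of norm at most N(p), so
  -- the way the order breaks ties matters only up to O(1).
  have hup : ∑ s ∈ primesLE K x with prec s p, Real.log (nrm s.toNz) / nrm s.toNz
      ≤ ∑ s ∈ primesLE K (nrm p.toNz), Real.log (nrm s.toNz) / nrm s.toNz := by
    refine Finset.sum_le_sum_of_subset_of_nonneg (fun s hs => ?_)
      fun s _ _ => log_nrm_div_nonneg s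
    exact mem_primesLE.2 (h.nrm_le_of_prec (Finset.mem_filter.1 hs).2)
  have hlow : ∑ s ∈ primesLE K (nrm p.toNz / 2), Real.log (nrm s.toNz) / nrm s.toNz
      ≤ ∑ s ∈ primesLE K x with prec s p, Real.log (nrm s.toNz) / nrm s.toNz := by
    refine Finset.sum_le_sum_of_subset_of_nonneg (fun s hs => ?_)
      fun s _ _ => log_nrm_div_nonneg s
    have hs' := mem_primesLE.1 hs
    exact Finset.mem_filter.2 ⟨mem_primesLE.2 (by linarith), h.of_nrm_lt _ _ (by linarith)⟩
  rw [Real.log_div (by linarith) two_ne_zero] at h3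
  have hl2 : 0 ≤ Real.log 2 := Real.log_nonneg (by norm_num)
  change |∑ s ∈ primesLE K x with ¬ prec s p, Real.log (nrm s.toNz) / nrm s.toNz - _| ≤ _
  rw [abs_le]
  constructor <;> linarith

variable (K) in
theorem exists_sum_filter_lt_nrm_le : ∃ C : ℝ, 0 ≤ C ∧ ∀ (S : Finset (PrimeId K)) (z x : ℝ),
    1 ≤ z → z ≤ x → (∀ s ∈ S, z < nrm s.toNz ∧ nrm s.toNz ≤ x) →
      ∑ s ∈ S, Real.log (nrm s.toNz) / nrm s.toNz ≤ Real.log x - Real.log z + C := by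
  classical
  obtain ⟨C, hC⟩ := exists_abs_sum_log_nrm_div_sub_log_le K
  have hC0 : 0 ≤ C := (abs_nonneg _).trans (hC 1 le_rfl)
  refine ⟨2 * C, by positivity, fun S z x hz hzx hS => ?_⟩
  have h1 := abs_le.1 (hC x (by linarith))
  have h2 := abs_le.1 (hC z (by linarith))
  have hd : Disjoint S (primesLE K z) := by
    rw [Finset.disjoint_left]
    intro s hs hs'
    exact absurd (mem_primesLE.1 hs') (not_le.2 (hS s hs).1)
  have h3 : ∑ s ∈ S ∪ primesLE K z, Real.log (nrm s.toNz) / nrm s.toNz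
      ≤ ∑ s ∈ primesLE K x, Real.log (nrm s.toNz) / nrm s.toNz := by
    refine Finset.sum_le_sum_of_subset_of_nonneg (fun s hs => ?_)
      fun s _ _ => log_nrm_div_nonneg s
    rcases Finset.mem_union.1 hs with hs | hs
    · exact mem_primesLE.2 (hS s hs).2
    · exact mem_primesLE.2 ((mem_primesLE.1 hs).trans hzx)
  rw [Finset.sum_union hd] at h3
  linarith

end Mass

/-! ### Consequences of the hypotheses on the weight -/

section Weight

variable {K : Type*} [Field K] [NumberField K] {prec : PrimeId K → PrimeId K → Prop}

/-- The hypotheses on a weight `w` at a fixed `N`. -/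
structure IsSieveWeight (prec : PrimeId K → PrimeId K → Prop) (ξ A₁ : ℝ) (A₂ : ℝ → ℝ) (A₃ N : ℝ)
    (w : NzIdeal K → ℝ) : Prop where
  order : IsNormOrder prec
  ten_le : 10 ≤ N
  nonneg : ∀ a, 0 ≤ w a
  primeAverage : PrimeAverageCond A₁ N w
  partialSum : PartialSumCond prec A₂ N w
  tail : TailCond ξ A₃ N w

variable {ξ A₁ A₃ N : ℝ} {A₂ : ℝ → ℝ} {w : NzIdeal K → ℝ}

theorem two_lt_log {N : ℝ} (hN : 10 ≤ N) : 2 < Real.log N := by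
  rw [Real.lt_log_iff_exp_lt (by linarith)]
  have h1 := Real.exp_one_lt_d9
  have h2 : Real.exp 2 = Real.exp 1 * Real.exp 1 := by rw [← Real.exp_add]; norm_num
  have h3 := Real.exp_pos 1
  nlinarith

namespace IsSieveWeight

variable (hw : IsSieveWeight prec ξ A₁ A₂ A₃ N w)
include hw

theorem summable {r : NzIdeal K} (hr : nrm r ≤ N / 2) : Summable fun a : NzIdeal K => w (a * r) :=
  summable_of_tail (hw.tail r hr).1

theorem log_pos {r : NzIdeal K} (hr : nrm r ≤ N / 2) : 0 < Real.log (N / nrm r) := by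
  have h1 := nrm_pos r
  refine Real.log_pos ((one_lt_div h1).2 ?_)
  have := hw.ten_le
  linarith

theorem div_pos (r : NzIdeal K) : 0 < N / nrm r :=
  _root_.div_pos (by linarith [hw.ten_le]) (nrm_pos r)

theorem loglog_pos : 0 < Real.log (Real.log N) :=
  Real.log_pos (by linarith [two_lt_log hw.ten_le])

theorem abs_tsum_primes_sub_le {r : NzIdeal K} (hr : nrm r ≤ N / 2) :
    |∑' s : PrimeId K, w (r * s.toNz) - N / nrm r / Real.log (N / nrm r)|
      ≤ |A₁| * (N / nrm r * Real.log (Real.log N) / Real.log (N / nrm r) ^ 2) := by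
  obtain ⟨E, hE, hsum⟩ := hw.primeAverage r hr
  have hY := hw.log_pos hr
  have hy := hw.div_pos r
  have hL := hw.loglog_pos
  rw [hsum.tsum_eq]
  set y := N / nrm r
  have h1 : y / Real.log y * (1 + E) - y / Real.log y = y / Real.log y * E := by ring
  rw [h1, abs_mul, abs_of_pos (by positivity)]
  have h2 : |E| ≤ |A₁| * (Real.log (Real.log N) / Real.log y) :=
    hE.trans (mul_le_mul_of_nonneg_right (le_abs_self _) (by positivity))
  calc _ ≤ y / Real.log y * (|A₁| * (Real.log (Real.log N) / Real.log y)) := by gcongr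
    _ = _ := by ring

theorem abs_tsum_not_prec_sub_le {r : NzIdeal K} (hr : nrm r ≤ N / 2) {δ : ℝ} (hδ : 0 < δ)
    {p : PrimeId K} (hp : N ^ δ ≤ nrm p.toNz) :
    |∑' s : {s : PrimeId K | ¬ prec s p}, w (r * (s : PrimeId K).toNz)
        - N / nrm r / Real.log (N / nrm r)|
      ≤ |A₁| * (N / nrm r * Real.log (Real.log N) / Real.log (N / nrm r) ^ 2)
        + |A₂ δ| * (nrm p.toNz / Real.log (nrm p.toNz)) := by
  obtain ⟨E, hE, hsum⟩ := hw.primeAverage r hr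
  have h1 := abs_le.1 (hw.abs_tsum_primes_sub_le hr)
  have h2 : ∑' s : {s : PrimeId K | prec s p}, w (r * (s : PrimeId K).toNz)
      + ∑' s : {s : PrimeId K | ¬ prec s p}, w (r * (s : PrimeId K).toNz)
      = ∑' s : PrimeId K, w (r * s.toNz) :=
    hsum.summable.tsum_subtype_add_tsum_subtype_compl {s : PrimeId K | prec s p}
  have h3 : 0 ≤ ∑' s : {s : PrimeId K | prec s p}, w (r * (s : PrimeId K).toNz) :=
    tsum_nonneg fun s => hw.nonneg _
  have h4 := hw.partialSum δ hδ p r hp hr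
  have h5 : 0 ≤ nrm p.toNz / Real.log (nrm p.toNz) :=
    div_nonneg (nrm_pos _).le p.log_nrm_pos.le
  have h6 := mul_le_mul_of_nonneg_right (le_abs_self (A₂ δ)) h5
  have h7 : 0 ≤ |A₂ δ| * (nrm p.toNz / Real.log (nrm p.toNz)) := by positivity
  rw [abs_le]
  constructor <;> linarith

theorem tail_le {r : NzIdeal K} (hr : nrm r ≤ N / 2) :
    ∑' a : {a : NzIdeal K | N * Real.log N ^ ξ < nrm (a * r)}, w ((a : NzIdeal K) * r)
      ≤ |A₃| * (N / nrm r / Real.log (N / nrm r) ^ 2) := by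
  refine (hw.tail r hr).2.trans (mul_le_mul_of_nonneg_right (le_abs_self _) ?_)
  have := hw.div_pos r
  positivity

/-- The sifted sum beyond the level where only primes survive. -/
theorem Phi_sub_le {r : NzIdeal K} (hr : nrm r ≤ N / 2) {p : PrimeId K}
    (hp : N * Real.log N ^ ξ < nrm p.toNz ^ 2 * nrm r) :
    Phi prec w r p - w r ≤ N / nrm r / Real.log (N / nrm r)
      + |A₁| * (N / nrm r * Real.log (Real.log N) / Real.log (N / nrm r) ^ 2)
      + |A₃| * (N / nrm r / Real.log (N / nrm r) ^ 2) := by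
  -- No prime needs to be kept in F: for every s not before p, N(s)² N(r) already exceeds the tail
  -- level.
  have h1 := abs_Phi_sub_le hw.order hw.nonneg (hw.summable hr) (hw.tail_le hr) (p := p) (F := ∅)
    (by simp) (fun s hs _ => hp.trans_le (by
      have := hw.order.nrm_le hs
      have h2 := nrm_pos r
      have h3 := nrm_pos p.toNz
      gcongr))
  obtain ⟨E, hE, hsum⟩ := hw.primeAverage r hr
  have h2 : ∑' s : {s : PrimeId K | ¬ prec s p}, w (r * (s : PrimeId K).toNz)
      ≤ ∑' s : PrimeId K, w (r * s.toNz) :=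
    Summable.tsum_subtype_le _ _ (fun s => hw.nonneg _) hsum.summable
  have h3 := abs_le.1 (hw.abs_tsum_primes_sub_le hr)
  have h4 := abs_le.1 h1
  simp only [Finset.sum_empty] at h4
  linarith

theorem Phi_sub_nonneg {r : NzIdeal K} (hr : nrm r ≤ N / 2) (p : PrimeId K) :
    0 ≤ Phi prec w r p - w r :=
  sub_nonneg.2 (le_Phi hw.order hw.nonneg (hw.summable hr) p)

end IsSieveWeight

end Weight
end IdealSieve
end

noncomputable section

namespace IdealSieve

/-! ### Sums over the primes in Buchstab's identity -/

section Sums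

variable {K : Type*} [Field K] [NumberField K] {prec : PrimeId K → PrimeId K → Prop}

theorem nrm_le_exp_iff {s : PrimeId K} {x : ℝ} :
    nrm s.toNz ≤ Real.exp x ↔ Real.log (nrm s.toNz) ≤ x :=
  (Real.log_le_iff_le_exp (nrm_pos _)).symm

variable (K) in
theorem exists_abs_sum_primesFrom_buchstab_sub_le (b : ℝ) : ∃ C : ℝ, 0 ≤ C ∧
    ∀ prec : PrimeId K → PrimeId K → Prop, IsNormOrder prec → ∀ (p : PrimeId K) (Y : ℝ),
      2 * Real.log (nrm p.toNz) ≤ Y → Y ≤ b * Real.log (nrm p.toNz) →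
      |∑ s ∈ primesFrom prec p (Real.exp (Y / 2)), Real.log (nrm s.toNz) / nrm s.toNz *
          (buchstab (Y / Real.log (nrm s.toNz) - 1) / Real.log (nrm s.toNz) ^ 2)
        - (Y / Real.log (nrm p.toNz) * buchstab (Y / Real.log (nrm p.toNz)) - 1) / Y|
        ≤ C / Y ^ 2 := by
  classical
  obtain ⟨C, hC0, hC⟩ := exists_abs_sum_primesFrom_sub_le K
  refine ⟨C * (4 + |b| ^ 4 + |b| ^ 3), by positivity, fun prec h p Y hY hYb => ?_⟩
  have hp := p.log_nrm_pos
  have hY0 : 0 < Y := by linarith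
  have hYu : Y / (Y / Real.log (nrm p.toNz)) = Real.log (nrm p.toNz) := by field_simp
  refine abs_sum_buchstab_sub_le hY0 ((le_div_iff₀ hp).2 hY)
    (((div_le_iff₀ hp).2 hYb).trans (le_abs_self b)) (fun s hs => ?_) (fun x hx => ?_)
  · rw [hYu]
    obtain ⟨h1, h2⟩ := mem_primesFrom.1 hs
    exact ⟨Real.log_le_log (nrm_pos _) (h.nrm_le h2), nrm_le_exp_iff.1 h1⟩
  · rw [hYu] at hx ⊢
    have h1 := hC prec h p (Real.exp x) (nrm_le_exp_iff.2 hx.1)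
    rw [Real.log_exp] at h1
    have h2 : {s ∈ primesFrom prec p (Real.exp (Y / 2)) | Real.log (nrm s.toNz) ≤ x}
        = primesFrom prec p (Real.exp x) := by
      ext s
      simp only [Finset.mem_filter, mem_primesFrom, nrm_le_exp_iff]
      constructor
      · rintro ⟨⟨-, h3⟩, h4⟩
        exact ⟨h4, h3⟩
      · rintro ⟨h3, h4⟩
        exact ⟨⟨h3.trans hx.2, h4⟩, h3⟩
    rwa [h2]

/-- This absorbs the secondary error of the induction hypothesis: N(s) ≤ e^(Y/2) and log N(s) ≥ Y/b
reduce it to the Chebyshev bound. -/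
theorem sum_primesFrom_nrm_div_log_le {p : PrimeId K} {Y b : ℝ} (hY : 0 < Y) (hb : 0 < b)
    (h : IsNormOrder prec) (hp : Y ≤ b * Real.log (nrm p.toNz)) :
    ∑ s ∈ primesFrom prec p (Real.exp (Y / 2)), nrm s.toNz / Real.log (nrm s.toNz)
      ≤ Module.finrank ℚ K * Real.log 4 * b ^ 2 * (Real.exp Y / Y ^ 2) := by
  have h1 : ∀ s ∈ primesFrom prec p (Real.exp (Y / 2)), nrm s.toNz / Real.log (nrm s.toNz)
      ≤ Real.log (nrm s.toNz) * (Real.exp (Y / 2) * (b / Y) ^ 2) := by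
    intro s hs
    obtain ⟨h2, h3⟩ := mem_primesFrom.1 hs
    have h4 := Real.log_le_log (nrm_pos _) (h.nrm_le h3)
    have h5 := s.log_nrm_pos
    have h6 : Y ≤ b * Real.log (nrm s.toNz) := hp.trans (by gcongr)
    have h7 : 1 / Real.log (nrm s.toNz) ≤ b / Y := by
      rw [div_le_div_iff₀ h5 hY]
      linarith
    calc nrm s.toNz / Real.log (nrm s.toNz)
        = Real.log (nrm s.toNz) * (nrm s.toNz * (1 / Real.log (nrm s.toNz)) ^ 2) := by
          field_simp
      _ ≤ _ := by gcongr
  refine (Finset.sum_le_sum h1).trans ?_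
  rw [← Finset.sum_mul]
  have h2 : ∑ s ∈ primesFrom prec p (Real.exp (Y / 2)), Real.log (nrm s.toNz)
      ≤ Module.finrank ℚ K * Real.log 4 * Real.exp (Y / 2) := by
    refine le_trans ?_ (sum_log_nrm_primesLE_le (Real.exp_pos _).le)
    exact Finset.sum_le_sum_of_subset_of_nonneg
      (fun s hs => mem_primesLE.2 (mem_primesFrom.1 hs).1) fun s _ _ => s.log_nrm_pos.le
  have h3 : Real.exp Y = Real.exp (Y / 2) * Real.exp (Y / 2) := by
    rw [← Real.exp_add, add_halves]
  calc _ ≤ Module.finrank ℚ K * Real.log 4 * Real.exp (Y / 2) *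
        (Real.exp (Y / 2) * (b / Y) ^ 2) := by gcongr
    _ = _ := by rw [h3]; ring

end Sums

section Weight

variable {K : Type*} [Field K] [NumberField K] {prec : PrimeId K → PrimeId K → Prop}
  {ξ A₁ A₃ N : ℝ} {A₂ : ℝ → ℝ} {w : NzIdeal K → ℝ}

namespace IsSieveWeight

variable (hw : IsSieveWeight prec ξ A₁ A₂ A₃ N w)
include hw

theorem nrm_le_half {r : NzIdeal K} (hr : 1 ≤ Real.log (N / nrm r)) : nrm r ≤ N / 2 := by
  have h1 := (Real.le_log_iff_exp_le (hw.div_pos r)).1 hr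
  have h2 : (2 : ℝ) ≤ N / nrm r := by linarith [Real.add_one_le_exp (1 : ℝ)]
  rw [le_div_iff₀ (nrm_pos r)] at h2
  linarith

theorem log_div_nrm_mul (r : NzIdeal K) (s : PrimeId K) :
    Real.log (N / nrm (r * s.toNz)) = Real.log (N / nrm r) - Real.log (nrm s.toNz) := by
  rw [nrm_mul, ← div_div, Real.log_div (hw.div_pos r).ne' (nrm_pos _).ne']

/-- The contribution of a prime `s` with `y < N(s) ^ 2 ≤ y (log N) ^ ξ` in Buchstab's identity. -/
theorem Phi_mul_sub_le {ε : ℝ} (hε : 0 < ε) (hξ : 0 < ξ) (hξ1 : ξ < 1) {r : NzIdeal K}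
    {s : PrimeId K} (hY : 8 ≤ Real.log (N / nrm r)) (hεY : ε * Real.log N ≤ Real.log (N / nrm r))
    (hLY : Real.log (Real.log N) ≤ Real.log (N / nrm r) / 2)
    (hs : Real.log (N / nrm r) / 2 < Real.log (nrm s.toNz))
    (hs' : Real.log (nrm s.toNz) ≤ (Real.log (N / nrm r) + ξ * Real.log (Real.log N)) / 2) :
    |Phi prec w (r * s.toNz) s - w (r * s.toNz)| ≤ (1 + |A₁| * (4 / ε) + |A₃|) * 8 *
      (N / nrm r / Real.log (N / nrm r) ^ 2 * (Real.log (nrm s.toNz) / nrm s.toNz)) := by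
  set Y := Real.log (N / nrm r)
  set L := Real.log N
  set t := Real.log (nrm s.toNz)
  have hlL := hw.loglog_pos
  have hL : 0 < L := by linarith [two_lt_log hw.ten_le]
  have hξL : ξ * Real.log L ≤ Y / 2 := by nlinarith
  have hYs : Real.log (N / nrm (r * s.toNz)) = Y - t := hw.log_div_nrm_mul r s
  -- Here t ≤ (Y + Y/2)/2 = 3Y/4, so y / N(s) remains a fixed power of y.
  have hYs4 : Y / 4 ≤ Y - t := by linarith
  have hrs : nrm (r * s.toNz) ≤ N / 2 := hw.nrm_le_half (by rw [hYs]; linarith)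
  have hN : 0 < N := by linarith [hw.ten_le]
  -- The right side is N(s)³ N(r), and 3t > 3Y/2 ≥ Y + ξ log log N, so sifting rs at s leaves,
  -- outside the tail, only 1 and primes.
  have hbig : N * L ^ ξ < nrm s.toNz ^ 2 * nrm (r * s.toNz) := by
    have h1 : Real.log (L ^ ξ * (N / nrm r)) < Real.log (nrm s.toNz ^ 3) := by
      rw [Real.log_mul (by positivity) (hw.div_pos r).ne', Real.log_rpow hL, Real.log_pow]
      push_cast
      linarith
    have h2 := (Real.log_lt_log_iff (mul_pos (by positivity) (hw.div_pos r))
      (pow_pos (nrm_pos _) 3)).1 h1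
    have h3 := mul_lt_mul_of_pos_right h2 (nrm_pos r)
    rw [nrm_mul]
    have h4 : L ^ ξ * (N / nrm r) * nrm r = N * L ^ ξ := by
      have := (nrm_pos r).ne'
      field_simp
    rw [h4] at h3
    calc _ < _ := h3
      _ = _ := by ring
  have h1 := hw.Phi_sub_le hrs hbig
  rw [abs_of_nonneg (hw.Phi_sub_nonneg hrs s)]
  refine h1.trans ?_
  rw [hYs]
  set D := Y - t
  have hD : 2 ≤ D := by linarith
  have hys : N / nrm (r * s.toNz) = N / nrm r / nrm s.toNz := by rw [nrm_mul, div_div]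
  have hns := nrm_pos s.toNz
  have ht0 : 0 < t := by linarith
  have hy := hw.div_pos r
  have hLD : Real.log L ≤ 4 / ε * D := by
    have h2 : Real.log L ≤ L := (Real.log_le_sub_one_of_pos hL).trans (by linarith)
    have h3 : ε * L ≤ 4 * D := by linarith
    rw [div_mul_eq_mul_div, le_div_iff₀ hε]
    nlinarith
  rw [hys]
  set y := N / nrm r
  set q := nrm s.toNz
  have hD0 : 0 < D := by linarith
  have e1 : y / q * Real.log L / D ^ 2 ≤ 4 / ε * (y / q / D) := by
    calc _ ≤ y / q * (4 / ε * D) / D ^ 2 := by gcongr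
      _ = _ := by field_simp
  have e2 : y / q / D ^ 2 ≤ y / q / D := by
    gcongr
    nlinarith
  have e3 : y / q / D ≤ 8 * (y / Y ^ 2 * (t / q)) := by
    have hY0 : 0 < Y := by linarith
    have h2 : 1 / D ≤ 4 / Y := by
      rw [div_le_div_iff₀ hD0 hY0]; linarith
    have h3 : 1 ≤ 2 / Y * t := by
      rw [div_mul_eq_mul_div, le_div_iff₀ hY0]; linarith
    calc y / q / D = y / q * (1 / D) * 1 := by ring
      _ ≤ y / q * (4 / Y) * (2 / Y * t) := by gcongr
      _ = _ := by ring
  calc _ ≤ y / q / D + |A₁| * (4 / ε * (y / q / D)) + |A₃| * (y / q / D) := by gcongr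
    _ = (1 + |A₁| * (4 / ε) + |A₃|) * (y / q / D) := by ring
    _ ≤ (1 + |A₁| * (4 / ε) + |A₃|) * (8 * (y / Y ^ 2 * (t / q))) := by gcongr
    _ = _ := by ring

end IsSieveWeight

end Weight
end IdealSieve
end

noncomputable section

namespace IdealSieve

/-! ### Absorbing errors into powers of log y -/

section Powers

theorem one_div_sq_le_rpow {Y ξ : ℝ} (hY : 1 ≤ Y) (hξ : 0 < ξ) : 1 / Y ^ 2 ≤ Y ^ (ξ - 2) := by
  have h1 : 1 / Y ^ 2 = Y ^ (-2 : ℝ) := by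
    rw [Real.rpow_neg (by linarith), one_div, Real.rpow_two]
  rw [h1]
  exact Real.rpow_le_rpow_of_exponent_le hY (by linarith)

/-- With L = log N and Y = log y this absorbs the log log N of (1), as log L ≤ L^ξ / ξ and L ≤ Y /
ε. -/
theorem log_div_sq_le_rpow {Y L ε ξ : ℝ} (hL : 0 < L) (hε : 0 < ε) (hY : 0 < Y) (hLY : ε * L ≤ Y)
    (hξ : 0 < ξ) : Real.log L / Y ^ 2 ≤ (1 / ε) ^ ξ / ξ * Y ^ (ξ - 2) := by
  have h1 : Real.log L ≤ (1 / ε) ^ ξ / ξ * Y ^ ξ := by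
    calc Real.log L ≤ L ^ ξ / ξ := Real.log_le_rpow_div hL.le hξ
      _ ≤ (1 / ε * Y) ^ ξ / ξ := by
        gcongr
        rw [one_div_mul_eq_div, le_div_iff₀ hε]
        linarith
      _ = _ := by rw [Real.mul_rpow (by positivity) hY.le]; ring
  rw [Real.rpow_sub hY, Real.rpow_two]
  calc _ ≤ (1 / ε) ^ ξ / ξ * Y ^ ξ / Y ^ 2 := by gcongr
    _ = _ := by ring

theorem rpow_sub_two_le_four_mul {Y Z ξ : ℝ} (hY : 0 < Y) (hZ : Y / 2 ≤ Z) (hξ : 0 < ξ)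
    (hξ1 : ξ < 1) : Z ^ (ξ - 2) ≤ 4 * Y ^ (ξ - 2) := by
  have h1 : Z ^ (ξ - 2) ≤ (Y / 2) ^ (ξ - 2) :=
    Real.rpow_le_rpow_of_nonpos (by linarith) hZ (by linarith)
  refine h1.trans ?_
  have h2 : (Y / 2) ^ (ξ - 2) = (2 : ℝ) ^ (2 - ξ) * Y ^ (ξ - 2) := by
    rw [Real.div_rpow hY.le two_pos.le, show (2 : ℝ) - ξ = -(ξ - 2) by ring,
      Real.rpow_neg two_pos.le]
    ring
  have h3 : (2 : ℝ) ^ (2 - ξ) ≤ 2 ^ (2 : ℝ) :=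
    Real.rpow_le_rpow_of_exponent_le one_le_two (by linarith)
  rw [h2]
  have h4 : (2 : ℝ) ^ (2 : ℝ) = 4 := by rw [Real.rpow_two]; norm_num
  rw [h4] at h3
  gcongr

end Powers

variable {K : Type*} [Field K] [NumberField K] {prec : PrimeId K → PrimeId K → Prop}

variable (K) in
/-- Summing the Buchstab approximations over the primes `s` with `N(s) ^ 2 ≤ y`. -/
theorem exists_abs_sum_approx_sub_le {ξ b C : ℝ} (hξ : 0 < ξ) (hξ1 : ξ < 1) (hb : 0 < b)
    (hC : 0 ≤ C) : ∃ C' : ℝ, 0 ≤ C' ∧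
    ∀ prec : PrimeId K → PrimeId K → Prop, IsNormOrder prec → ∀ (p : PrimeId K) (Y : ℝ)
      (g : PrimeId K → ℝ), 1 ≤ Y → 2 * Real.log (nrm p.toNz) ≤ Y →
      Y ≤ b * Real.log (nrm p.toNz) →
      (∀ s ∈ primesFrom prec p (Real.exp (Y / 2)),
        |g s - buchstab (Y / Real.log (nrm s.toNz) - 1) *
            (Real.exp Y / nrm s.toNz / Real.log (nrm s.toNz))|
          ≤ C * (Real.exp Y / nrm s.toNz * (Y - Real.log (nrm s.toNz)) ^ (ξ - 2)
            + nrm s.toNz / Real.log (nrm s.toNz))) →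
      |∑ s ∈ primesFrom prec p (Real.exp (Y / 2)), g s
        - Real.exp Y * ((Y / Real.log (nrm p.toNz) * buchstab (Y / Real.log (nrm p.toNz)) - 1) / Y)|
        ≤ C' * (Real.exp Y * Y ^ (ξ - 2)) := by
  obtain ⟨C₁, hC₁0, hC₁⟩ := exists_abs_sum_primesFrom_sub_le K
  obtain ⟨C₂, hC₂0, hC₂⟩ := exists_abs_sum_primesFrom_buchstab_sub_le K b
  set C₃ : ℝ := Module.finrank ℚ K * Real.log 4 * b ^ 2
  have hl4 : 0 ≤ Real.log 4 := Real.log_nonneg (by norm_num)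
  have hC₃0 : 0 ≤ C₃ := by positivity
  refine ⟨C₂ + C * (4 * b * (1 + C₁) + C₃), by positivity,
    fun prec h p Y g hY hp2 hpb hg => ?_⟩
  have hY0 : 0 < Y := by linarith
  have hp := p.log_nrm_pos
  set F := primesFrom prec p (Real.exp (Y / 2))
  have hmain := hC₂ prec h p Y hp2 hpb
  have hmass := (abs_le.1 (hC₁ prec h p (Real.exp (Y / 2)) (nrm_le_exp_iff.2 (by linarith)))).2
  rw [Real.log_exp] at hmass
  have hmass' : ∑ s ∈ F, Real.log (nrm s.toNz) / nrm s.toNz ≤ (1 + C₁) * Y := by nlinarith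
  have hthird := sum_primesFrom_nrm_div_log_le hY0 hb h hpb
  have hsq := one_div_sq_le_rpow hY hξ
  have hpw : 0 < Y ^ (ξ - 2) := by positivity
  have herr : ∀ s ∈ F, |g s - Real.exp Y * (Real.log (nrm s.toNz) / nrm s.toNz *
      (buchstab (Y / Real.log (nrm s.toNz) - 1) / Real.log (nrm s.toNz) ^ 2))|
      ≤ C * (4 * b * (Real.exp Y * Y ^ (ξ - 2)) / Y * (Real.log (nrm s.toNz) / nrm s.toNz)
        + nrm s.toNz / Real.log (nrm s.toNz)) := by
    intro s hs
    obtain ⟨h1, h2⟩ := mem_primesFrom.1 hs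
    have ht := s.log_nrm_pos
    have hn := nrm_pos s.toNz
    have ht2 := nrm_le_exp_iff.1 h1
    have hts := Real.log_le_log (nrm_pos _) (h.nrm_le h2)
    have h3 := hg s hs
    have h4 : buchstab (Y / Real.log (nrm s.toNz) - 1) *
        (Real.exp Y / nrm s.toNz / Real.log (nrm s.toNz)) =
        Real.exp Y * (Real.log (nrm s.toNz) / nrm s.toNz *
        (buchstab (Y / Real.log (nrm s.toNz) - 1) / Real.log (nrm s.toNz) ^ 2)) := by
      field_simp
    rw [h4] at h3
    refine h3.trans (mul_le_mul_of_nonneg_left (add_le_add ?_ le_rfl) hC)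
    have h5 := rpow_sub_two_le_four_mul hY0 (Z := Y - Real.log (nrm s.toNz)) (by linarith) hξ hξ1
    -- Inserting this factor turns 1 / N(s) into the Mertens weight log N(s) / N(s), whose total
    -- mass is O(Y).
    have h6 : 1 ≤ b / Y * Real.log (nrm s.toNz) := by
      rw [div_mul_eq_mul_div, le_div_iff₀ hY0, one_mul]
      exact hpb.trans (by gcongr)
    calc Real.exp Y / nrm s.toNz * (Y - Real.log (nrm s.toNz)) ^ (ξ - 2)
        ≤ Real.exp Y / nrm s.toNz * (4 * Y ^ (ξ - 2)) * 1 := by rw [mul_one]; gcongr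
      _ ≤ Real.exp Y / nrm s.toNz * (4 * Y ^ (ξ - 2)) * (b / Y * Real.log (nrm s.toNz)) := by
        gcongr
      _ = _ := by ring
  have hsum : |∑ s ∈ F, g s - Real.exp Y * ∑ s ∈ F, Real.log (nrm s.toNz) / nrm s.toNz *
      (buchstab (Y / Real.log (nrm s.toNz) - 1) / Real.log (nrm s.toNz) ^ 2)|
      ≤ C * (4 * b * (1 + C₁) + C₃) * (Real.exp Y * Y ^ (ξ - 2)) := by
    rw [Finset.mul_sum, ← Finset.sum_sub_distrib]
    refine (Finset.abs_sum_le_sum_abs _ _).trans ((Finset.sum_le_sum herr).trans ?_)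
    rw [← Finset.mul_sum, Finset.sum_add_distrib, ← Finset.mul_sum, mul_assoc C]
    gcongr
    calc _ ≤ 4 * b * (Real.exp Y * Y ^ (ξ - 2)) / Y * ((1 + C₁) * Y)
          + C₃ * (Real.exp Y * (1 / Y ^ 2)) := by
            rw [mul_one_div]
            gcongr
      _ ≤ 4 * b * (Real.exp Y * Y ^ (ξ - 2)) / Y * ((1 + C₁) * Y)
          + C₃ * (Real.exp Y * Y ^ (ξ - 2)) := by gcongr
      _ = _ := by field_simp
  have hmain' : |Real.exp Y * (∑ s ∈ F, Real.log (nrm s.toNz) / nrm s.toNz *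
      (buchstab (Y / Real.log (nrm s.toNz) - 1) / Real.log (nrm s.toNz) ^ 2)) - Real.exp Y *
      ((Y / Real.log (nrm p.toNz) * buchstab (Y / Real.log (nrm p.toNz)) - 1) / Y)|
      ≤ C₂ * (Real.exp Y * Y ^ (ξ - 2)) := by
    rw [← mul_sub, abs_mul, abs_of_pos (Real.exp_pos Y)]
    calc _ ≤ Real.exp Y * (C₂ / Y ^ 2) := by gcongr
      _ = C₂ * (Real.exp Y * (1 / Y ^ 2)) := by ring
      _ ≤ _ := by gcongr
  calc _ ≤ _ := abs_sub_le _ _ _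
    _ ≤ _ := add_le_add hsum hmain'
    _ = _ := by ring

/-! ### The statement of the induction and its window terms -/

section Weight

variable {ξ A₁ A₃ N : ℝ} {A₂ : ℝ → ℝ} {w : NzIdeal K → ℝ}

variable (K) in
/-- The Buchstab approximation of the sifted sums with `N(p) ≥ y ^ (1 / n)`, `y ≥ N ^ ε`, up to a
secondary term of the size of the number of primes preceding `p`. -/
def SieveEstimate (ξ A₁ : ℝ) (A₂ : ℝ → ℝ) (A₃ : ℝ) (n : ℕ) (ε : ℝ) : Prop :=
  ∃ C N₀ : ℝ, 0 ≤ C ∧ ∀ (prec : PrimeId K → PrimeId K → Prop) (w : NzIdeal K → ℝ) (N : ℝ),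
    N₀ ≤ N → IsSieveWeight prec ξ A₁ A₂ A₃ N w → ∀ (p : PrimeId K) (r : NzIdeal K),
      ε * Real.log N ≤ Real.log (N / nrm r) → Real.log (nrm p.toNz) ≤ Real.log (N / nrm r) →
      Real.log (N / nrm r) ≤ n * Real.log (nrm p.toNz) →
      |Phi prec w r p - w r - buchstab (Real.log (N / nrm r) / Real.log (nrm p.toNz)) *
          (N / nrm r / Real.log (nrm p.toNz))|
        ≤ C * (N / nrm r * Real.log (N / nrm r) ^ (ξ - 2)
          + nrm p.toNz / Real.log (nrm p.toNz))

variable (K) in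
/-- The primes with `y < N(s) ^ 2 ≤ y (log N) ^ ξ` contribute to the error term only. -/
theorem exists_sum_abs_Phi_mul_sub_le {ε : ℝ} (hξ : 0 < ξ) (hξ1 : ξ < 1) (hε : 0 < ε) :
    ∃ C : ℝ, 0 ≤ C ∧ ∀ (prec : PrimeId K → PrimeId K → Prop) (w : NzIdeal K → ℝ) (N : ℝ),
      IsSieveWeight prec ξ A₁ A₂ A₃ N w → ∀ (r : NzIdeal K) (S : Finset (PrimeId K)),
      8 ≤ Real.log (N / nrm r) → ε * Real.log N ≤ Real.log (N / nrm r) →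
      Real.log (Real.log N) ≤ Real.log (N / nrm r) / 2 →
      (∀ s ∈ S, Real.log (N / nrm r) / 2 < Real.log (nrm s.toNz) ∧
        Real.log (nrm s.toNz) ≤ (Real.log (N / nrm r) + ξ * Real.log (Real.log N)) / 2) →
      |∑ s ∈ S, (Phi prec w (r * s.toNz) s - w (r * s.toNz))|
        ≤ C * (N / nrm r * Real.log (N / nrm r) ^ (ξ - 2)) := by
  obtain ⟨C, hC0, hC⟩ := exists_sum_filter_lt_nrm_le K
  refine ⟨(1 + |A₁| * (4 / ε) + |A₃|) * 8 * ((1 / ε) ^ ξ / ξ + C), by positivity,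
    fun prec w N hw r S hY hεY hLY hS => ?_⟩
  set Y := Real.log (N / nrm r)
  set L := Real.log N
  have hlL := hw.loglog_pos
  have hL : 0 < L := by linarith [two_lt_log hw.ten_le]
  have hy := hw.div_pos r
  have h1 := hC S (Real.exp (Y / 2)) (Real.exp ((Y + ξ * Real.log L) / 2))
    (Real.one_le_exp (by linarith)) (Real.exp_le_exp.2 (by nlinarith)) (fun s hs =>
      ⟨(Real.lt_log_iff_exp_lt (nrm_pos _)).1 (hS s hs).1, nrm_le_exp_iff.2 (hS s hs).2⟩)
  rw [Real.log_exp, Real.log_exp] at h1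
  -- On the logarithmic scale the window has length ξ log L / 2.
  have h2 : ∑ s ∈ S, Real.log (nrm s.toNz) / nrm s.toNz ≤ Real.log L + C := by nlinarith
  have h3 := one_div_sq_le_rpow (Y := Y) (by linarith) hξ
  have h4 := log_div_sq_le_rpow hL hε (by linarith) hεY hξ
  set y := N / nrm r
  calc _ ≤ ∑ s ∈ S, |Phi prec w (r * s.toNz) s - w (r * s.toNz)| :=
        Finset.abs_sum_le_sum_abs _ _
    _ ≤ ∑ s ∈ S, (1 + |A₁| * (4 / ε) + |A₃|) * 8 *
          (y / Y ^ 2 * (Real.log (nrm s.toNz) / nrm s.toNz)) :=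
        Finset.sum_le_sum fun s hs =>
          hw.Phi_mul_sub_le hε hξ hξ1 hY hεY hLY (hS s hs).1 (hS s hs).2
    _ = (1 + |A₁| * (4 / ε) + |A₃|) * 8 *
          (y / Y ^ 2 * ∑ s ∈ S, Real.log (nrm s.toNz) / nrm s.toNz) := by
        rw [← Finset.mul_sum, ← Finset.mul_sum]
    _ ≤ (1 + |A₁| * (4 / ε) + |A₃|) * 8 * (y / Y ^ 2 * (Real.log L + C)) := by gcongr
    _ = (1 + |A₁| * (4 / ε) + |A₃|) * 8 * (y * (Real.log L / Y ^ 2 + C * (1 / Y ^ 2))) := by ring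
    _ ≤ (1 + |A₁| * (4 / ε) + |A₃|) * 8 *
          (y * ((1 / ε) ^ ξ / ξ * Y ^ (ξ - 2) + C * Y ^ (ξ - 2))) := by gcongr
    _ = _ := by ring

theorem eventually_log_conditions {ε : ℝ} (hε : 0 < ε) :
    ∃ N₀ : ℝ, ∀ N, N₀ ≤ N → 8 ≤ ε * Real.log N ∧ Real.log (Real.log N) ≤ ε * Real.log N / 2 := by
  have h1 : ∀ᶠ N : ℝ in Filter.atTop, 8 / ε ≤ Real.log N :=
    Real.tendsto_log_atTop.eventually_ge_atTop _
  have h2 : ∀ᶠ x : ℝ in Filter.atTop, ‖Real.log x‖ ≤ ε / 2 * ‖x‖ :=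
    Real.isLittleO_log_id_atTop.bound (by positivity)
  have h3 := (Real.tendsto_log_atTop.eventually h2).and
    (h1.and (Real.tendsto_log_atTop.eventually_ge_atTop 0))
  obtain ⟨N₀, hN₀⟩ := Filter.eventually_atTop.1 h3
  refine ⟨N₀, fun N hN => ?_⟩
  obtain ⟨h4, h5, h6⟩ := hN₀ N hN
  rw [div_le_iff₀ hε] at h5
  rw [Real.norm_eq_abs, Real.norm_eq_abs, abs_of_nonneg h6] at h4
  exact ⟨by linarith, (le_abs_self _).trans (by linarith)⟩

end Weight
end IdealSieve
end

/-! ### The induction -/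

noncomputable section

namespace IdealSieve

variable {K : Type*} [Field K] [NumberField K] {ξ A₁ A₃ : ℝ} {A₂ : ℝ → ℝ}

/-- The induction hypothesis is applied to (rs, s) for N(s)² ≤ y. There log(y / N(s)) ≥ Y/2, which
costs a factor 2 in ε, and the ratio Y / log N(s) − 1 lies between 1 and n. -/
theorem SieveEstimate.succ (hξ : 0 < ξ) (hξ1 : ξ < 1) {n : ℕ}
    (ih : ∀ ε : ℝ, 0 < ε → SieveEstimate K ξ A₁ A₂ A₃ n ε) {ε : ℝ} (hε : 0 < ε) :
    SieveEstimate K ξ A₁ A₂ A₃ (n + 1) ε := by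
  classical
  obtain ⟨C, N₁, hC0, hC⟩ := ih (ε / 2) (by positivity)
  obtain ⟨N₂, hN₂⟩ := eventually_log_conditions hε
  have hn1 : (0 : ℝ) < n + 1 := by positivity
  obtain ⟨C₁, hC₁0, hC₁⟩ := exists_abs_sum_approx_sub_le K hξ hξ1 hn1 hC0
  obtain ⟨C₂, hC₂0, hC₂⟩ := exists_sum_abs_Phi_mul_sub_le K (A₁ := A₁) (A₂ := A₂) (A₃ := A₃)
    hξ hξ1 hε
  -- From log N(p) ≥ Y / (n + 1) and Y ≥ ε log N, so that (2) applies with this δ.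
  set δ := ε / (n + 1)
  have hδ : 0 < δ := by positivity
  refine ⟨|A₃| + |A₁| * ((1 / ε) ^ ξ / ξ) + C₁ + C₂ + |A₂ δ|, max N₁ N₂, by positivity,
    fun prec w N hN hw p r hεY hpY hYp => ?_⟩
  push_cast at hYp
  obtain ⟨h8, hLε⟩ := hN₂ N (le_trans (le_max_right _ _) hN)
  have hy := hw.div_pos r
  have hexp : Real.exp (Real.log (N / nrm r)) = N / nrm r := Real.exp_log hy
  set Y := Real.log (N / nrm r) with hYdef
  set L := Real.log N with hLdef
  set T := Real.log (nrm p.toNz) with hTdef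
  have hT : 0 < T := p.log_nrm_pos
  have hL : 0 < L := by linarith [two_lt_log hw.ten_le]
  have hY8 : 8 ≤ Y := by linarith
  have hY0 : 0 < Y := by linarith
  have hLY : Real.log L ≤ Y / 2 := by linarith
  have hlL := hw.loglog_pos
  have hr : nrm r ≤ N / 2 := hw.nrm_le_half (by linarith)
  have hN0 : 0 < N := by linarith [hw.ten_le]
  have hpδ : N ^ δ ≤ nrm p.toNz := by
    rw [← Real.log_le_log_iff (by positivity) (nrm_pos _), Real.log_rpow hN0, ← hLdef, ← hTdef,
      div_mul_eq_mul_div, div_le_iff₀ hn1]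
    linarith
  -- The cut is where N(s)² N(r) = N (log N)^ξ, the level at which (3) takes over.
  set F := primesFrom prec p (Real.exp ((Y + ξ * Real.log L) / 2))
  have hbuchstab := abs_Phi_sub_le hw.order hw.nonneg (hw.summable hr) (hw.tail_le hr) (p := p)
    (F := F) (fun s hs => (mem_primesFrom.1 hs).2) (fun s hs hsF => by
      have h1 : (Y + ξ * Real.log L) / 2 < Real.log (nrm s.toNz) := by
        by_contra! h2
        exact hsF (mem_primesFrom.2 ⟨nrm_le_exp_iff.2 h2, hs⟩)
      have h2 : Real.log (N * L ^ ξ) < Real.log (nrm s.toNz ^ 2 * nrm r) := by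
        have h3 : Y = L - Real.log (nrm r) := Real.log_div hN0.ne' (nrm_pos r).ne'
        rw [Real.log_mul hN0.ne' (by positivity), Real.log_rpow hL,
          Real.log_mul (pow_pos (nrm_pos _) 2).ne' (nrm_pos r).ne', Real.log_pow, ← hLdef]
        push_cast
        linarith
      exact (Real.log_lt_log_iff (by positivity)
        (mul_pos (pow_pos (nrm_pos _) 2) (nrm_pos r))).1 h2)
  have hprimes := hw.abs_tsum_not_prec_sub_le hr hδ hpδ
  set g : PrimeId K → ℝ := fun s => Phi prec w (r * s.toNz) s - w (r * s.toNz)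
  have hF1 : {s ∈ F | Real.log (nrm s.toNz) ≤ Y / 2} = primesFrom prec p (Real.exp (Y / 2)) := by
    ext s
    simp only [F, Finset.mem_filter, mem_primesFrom, nrm_le_exp_iff]
    constructor
    · rintro ⟨⟨-, h1⟩, h2⟩
      exact ⟨h2, h1⟩
    · rintro ⟨h1, h2⟩
      have : 0 < ξ * Real.log L := mul_pos hξ hlL
      exact ⟨⟨by linarith, h2⟩, h1⟩
  have hsplit := Finset.sum_filter_add_sum_filter_not F
    (fun s => Real.log (nrm s.toNz) ≤ Y / 2) g
  rw [hF1] at hsplit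
  have hlarge := hC₂ prec w N hw r {s ∈ F | ¬ Real.log (nrm s.toNz) ≤ Y / 2} hY8 hεY hLY
    (fun s hs => by
      obtain ⟨h1, h2⟩ := Finset.mem_filter.1 hs
      exact ⟨not_le.1 h2, nrm_le_exp_iff.1 (mem_primesFrom.1 h1).1⟩)
  have hsmall : |∑ s ∈ primesFrom prec p (Real.exp (Y / 2)), g s
      - N / nrm r * ((Y / T * buchstab (Y / T) - 1) / Y)|
      ≤ C₁ * (N / nrm r * Y ^ (ξ - 2)) := by
    rcases le_or_gt (2 * T) Y with h2 | h2
    · have h1 := hC₁ prec hw.order p Y g (by linarith) h2 hYp (fun s hs => by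
        obtain ⟨h3, h4⟩ := mem_primesFrom.1 hs
        have h5 := nrm_le_exp_iff.1 h3
        have h6 := Real.log_le_log (nrm_pos _) (hw.order.nrm_le h4)
        have h7 := s.log_nrm_pos
        have h8 : N / nrm (r * s.toNz) = N / nrm r / nrm s.toNz := by rw [nrm_mul, div_div]
        have h9 := hw.log_div_nrm_mul r s
        have h10 := hC prec w N (le_trans (le_max_left _ _) hN) hw s (r * s.toNz)
          (by rw [h9]; linarith) (by rw [h9]; linarith) (by
            rw [h9]
            have : Y ≤ (n + 1) * Real.log (nrm s.toNz) := hYp.trans (by gcongr)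
            linarith)
        rw [h9, h8, sub_div, div_self h7.ne'] at h10
        rw [hexp]
        exact h10)
      rwa [hexp] at h1
    -- For u < 2 no prime not before p has N(s)² ≤ y, and u B(u) − 1 = 0 matches the empty sum.
    · have h1 : primesFrom prec p (Real.exp (Y / 2)) = ∅ := by
        refine Finset.eq_empty_of_forall_notMem fun s hs => ?_
        obtain ⟨h3, h4⟩ := mem_primesFrom.1 hs
        have h5 := nrm_le_exp_iff.1 h3
        have h6 := Real.log_le_log (nrm_pos _) (hw.order.nrm_le h4)
        linarith
      rw [h1, isBuchstab_buchstab.eq_inv (Y / T) ((one_le_div hT).2 hpY)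
        ((div_le_iff₀ hT).2 h2.le), mul_one_div_cancel (by positivity)]
      simp only [Finset.sum_empty, sub_self, zero_div, mul_zero, abs_zero]
      positivity
  -- The main term is the contribution y / Y of the primes plus that of the least primes s with
  -- N(s)² ≤ y.
  have hid : buchstab (Y / T) * (N / nrm r / T)
      = N / nrm r / Y + N / nrm r * ((Y / T * buchstab (Y / T) - 1) / Y) := by
    field_simp
    ring
  have hsq := one_div_sq_le_rpow (Y := Y) (by linarith) hξ
  have hlog := log_div_sq_le_rpow hL hε hY0 hεY hξ
  have e1 : |A₃| * (N / nrm r / Y ^ 2) ≤ |A₃| * (N / nrm r * Y ^ (ξ - 2)) := by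
    rw [← mul_one_div (N / nrm r)]
    gcongr
  have e2 : |A₁| * (N / nrm r * Real.log L / Y ^ 2)
      ≤ |A₁| * ((1 / ε) ^ ξ / ξ) * (N / nrm r * Y ^ (ξ - 2)) := by
    rw [mul_div_assoc]
    calc _ ≤ |A₁| * (N / nrm r * ((1 / ε) ^ ξ / ξ * Y ^ (ξ - 2))) := by gcongr
      _ = _ := by ring
  have e3 : 0 ≤ N / nrm r * Y ^ (ξ - 2) := by positivity
  have e4 : 0 ≤ nrm p.toNz / T := div_nonneg (nrm_pos _).le hT.le
  -- One constant multiplies both error terms, so the surplus products must be known to be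
  -- nonnegative.
  have e5 : 0 ≤ |A₂ δ| * (N / nrm r * Y ^ (ξ - 2)) := by positivity
  have e6 : 0 ≤ (|A₃| + |A₁| * ((1 / ε) ^ ξ / ξ) + C₁ + C₂) * (nrm p.toNz / T) := by positivity
  rw [hid]
  obtain ⟨a1, a2⟩ := abs_le.1 hbuchstab
  obtain ⟨b1, b2⟩ := abs_le.1 hprimes
  obtain ⟨c1, c2⟩ := abs_le.1 hlarge
  obtain ⟨d1, d2⟩ := abs_le.1 hsmall
  rw [abs_le]
  constructor <;> linarith

theorem sieveEstimate (hξ : 0 < ξ) (hξ1 : ξ < 1) (n : ℕ) :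
    ∀ ε : ℝ, 0 < ε → SieveEstimate K ξ A₁ A₂ A₃ n ε := by
  induction n with
  | zero =>
    -- For n = 0 the range is empty: 0 < log N(p) ≤ Y ≤ 0 is impossible.
    refine fun ε hε => ⟨0, 0, le_rfl, fun prec w N _ _ p r _ h1 h2 => ?_⟩
    have := p.log_nrm_pos
    rw [Nat.cast_zero, zero_mul] at h2
    linarith
  | succ n ih => exact fun ε hε => SieveEstimate.succ hξ hξ1 ih hε

end IdealSieve
end

/-! ### From the sieve estimate to the theorem -/

noncomputable section

namespace IdealSieve

/-- This is where α > 1 is used: N(p) ≤ y^(1/α) saves the factor exp(−(1 − 1/α)Y), which outweighs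
Y^(1−ξ). -/
theorem exp_div_le_mul_rpow {α β ξ Y T : ℝ} (hα : 1 < α) (hβ : 0 < β) (hξ : 0 < ξ)
    (hY : 1 ≤ Y) (hT : α * T ≤ Y) (hTβ : Y ≤ β * T) :
    Real.exp T / T ≤ β / (1 - 1 / α) * (Real.exp Y * Y ^ (ξ - 2)) := by
  have hα0 : 0 < α := by linarith
  have hY0 : 0 < Y := by linarith
  have hT0 : 0 < T := by nlinarith
  have hc : 0 < 1 - 1 / α := sub_pos.2 ((div_lt_one hα0).2 hα)
  have h1 : T ≤ Y - (1 - 1 / α) * Y := by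
    have : T ≤ Y / α := (le_div_iff₀ hα0).2 (by linarith)
    calc T ≤ Y / α := this
      _ = _ := by ring
  have h2 : Y ^ (1 - ξ) ≤ Real.exp ((1 - 1 / α) * Y) / (1 - 1 / α) := by
    rw [le_div_iff₀ hc]
    calc Y ^ (1 - ξ) * (1 - 1 / α) ≤ Y ^ (1 : ℝ) * (1 - 1 / α) := by
          gcongr
          linarith
      _ = (1 - 1 / α) * Y := by rw [Real.rpow_one]; ring
      _ ≤ _ := (le_add_of_nonneg_right zero_le_one).trans (Real.add_one_le_exp _)
  have h3 : 1 / T ≤ β / Y := by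
    rw [div_le_div_iff₀ hT0 hY0]
    linarith
  have h4 : 1 / Y = Y ^ (1 - ξ) * Y ^ (ξ - 2) := by
    rw [← Real.rpow_add hY0, show 1 - ξ + (ξ - 2) = -1 by ring, Real.rpow_neg_one, one_div]
  calc Real.exp T / T = Real.exp T * (1 / T) := by ring
    _ ≤ Real.exp (Y - (1 - 1 / α) * Y) * (β / Y) := by gcongr
    _ = Real.exp Y / Real.exp ((1 - 1 / α) * Y) * β * (Y ^ (1 - ξ) * Y ^ (ξ - 2)) := by
      rw [Real.exp_sub, ← h4]; ring
    _ ≤ Real.exp Y / Real.exp ((1 - 1 / α) * Y) * β *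
        (Real.exp ((1 - 1 / α) * Y) / (1 - 1 / α) * Y ^ (ξ - 2)) := by gcongr
    _ = _ := by
      have := (Real.exp_pos ((1 - 1 / α) * Y)).ne'
      field_simp

theorem exists_eq_mul_one_add {x M D y Y ξ : ℝ} (hy : 0 < y) (hY : 0 < Y) (hM : y / Y ≤ 2 * M)
    (hx : |x - M| ≤ D * (y * Y ^ (ξ - 2))) :
    ∃ E : ℝ, |E| ≤ 2 * D * Y ^ (ξ - 1) ∧ x = M * (1 + E) := by
  have hyY : 0 < y / Y := by positivity
  have hM0 : 0 < M := by linarith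
  refine ⟨(x - M) / M, ?_, by field_simp; ring⟩
  rw [abs_div, abs_of_pos hM0, div_le_iff₀ hM0]
  have h1 : y * Y ^ (ξ - 2) = y / Y * Y ^ (ξ - 1) := by
    rw [show ξ - 2 = ξ - 1 - 1 by ring, Real.rpow_sub_one hY.ne' (ξ - 1)]
    ring
  rw [h1] at hx
  have hD : 0 ≤ D := by
    by_contra! hD
    have h2 : 0 < y / Y * Y ^ (ξ - 1) := by positivity
    nlinarith [abs_nonneg (x - M)]
  calc _ ≤ _ := hx
    _ ≤ D * (2 * M * Y ^ (ξ - 1)) := by gcongr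
    _ = _ := by ring

end IdealSieve
end

theorem theorem4p4 (K : Type*) [Field K] [NumberField K]
    (ε ξ α β : ℝ) (hε : 0 < ε) (hε1 : ε < 1) (hξ : 0 < ξ) (hξ1 : ξ < 1)
    (hα : 1 < α) (hα2 : α < 2) (hβ : 2 < β)
    -- the implied constants in the hypotheses on the weight
    (A₁ : ℝ) (A₂ : ℝ → ℝ) (A₃ A₄ : ℝ) :
    ∃ C N₀ : ℝ,
      ∀ prec : IdealSieve.PrimeId K → IdealSieve.PrimeId K → Prop, IdealSieve.IsNormOrder prec →
      ∀ W : ℝ → IdealSieve.NzIdeal K → ℝ,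
        (∀ N : ℝ, 10 ≤ N → ∀ a, 0 ≤ W N a) →
        (∀ N : ℝ, 10 ≤ N → IdealSieve.PrimeAverageCond A₁ N (W N)) →
        (∀ N : ℝ, 10 ≤ N → IdealSieve.PartialSumCond prec A₂ N (W N)) →
        (∀ N : ℝ, 10 ≤ N → IdealSieve.TailCond ξ A₃ N (W N)) →
      ∀ N : ℝ, 10 ≤ N → N₀ ≤ N →
      ∀ (p : IdealSieve.PrimeId K) (r : IdealSieve.NzIdeal K) (y u : ℝ),
        y = N / IdealSieve.nrm r →
        u = Real.log y / Real.log (IdealSieve.nrm p.toNz) →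
        IdealSieve.nrm r ≤ N ^ (1 - ε) → α ≤ u → u ≤ β →
        Summable (fun a : IdealSieve.sifted prec p => W N ((a : IdealSieve.NzIdeal K) * r)) ∧
        (∃ E : ℝ, |E| ≤ C * Real.log y ^ (ξ - 1) ∧
          IdealSieve.Phi prec (W N) r p = W N r +
            IdealSieve.buchstab u * (y / Real.log (IdealSieve.nrm p.toNz)) * (1 + E)) ∧
        (W N r ≤ A₄ * (y / Real.log y ^ (2 - ξ)) →
          ∃ E : ℝ, |E| ≤ C * Real.log y ^ (ξ - 1) ∧
            IdealSieve.Phi prec (W N) r p =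
              IdealSieve.buchstab u * (y / Real.log (IdealSieve.nrm p.toNz)) * (1 + E)) := by
  obtain ⟨C, N₁, hC0, hC⟩ :=
    IdealSieve.sieveEstimate (K := K) (A₁ := A₁) (A₂ := A₂) (A₃ := A₃) hξ hξ1 ⌈β⌉₊ ε hε
  obtain ⟨N₂, hN₂⟩ := IdealSieve.eventually_log_conditions hε
  have hα0 : 0 < α := by linarith
  have hα1 : 0 < 1 - 1 / α := sub_pos.2 ((div_lt_one hα0).2 hα)
  set D := C * (1 + β / (1 - 1 / α))
  -- `D` bounds the absolute error, |A₄| covers dropping W(r), and the 2 comes from dividing by a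
  -- main term that is at least y / (2 log y).
  refine ⟨2 * (D + |A₄|), max N₁ N₂, fun prec hprec W hW h1 h2 h3 N hN hN₀ p r y u hy hu hr hαu
    huβ => ?_⟩
  have hw : IdealSieve.IsSieveWeight prec ξ A₁ A₂ A₃ N (W N) :=
    ⟨hprec, hN, hW N hN, h1 N hN, h2 N hN, h3 N hN⟩
  have h8 := (hN₂ N (le_trans (le_max_right _ _) hN₀)).1
  have hN0 : 0 < N := by linarith
  have hy0 : 0 < y := hy ▸ hw.div_pos r
  have hexp := Real.exp_log hy0
  have hT := p.log_nrm_pos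
  have hexpT := Real.exp_log (IdealSieve.nrm_pos p.toNz)
  have hεY : ε * Real.log N ≤ Real.log y := by
    rw [hy, Real.log_div hN0.ne' (IdealSieve.nrm_pos r).ne']
    have h4 := Real.log_le_log (IdealSieve.nrm_pos r) hr
    rw [Real.log_rpow hN0] at h4
    linarith
  have hu2 : α * Real.log (IdealSieve.nrm p.toNz) ≤ Real.log y := by
    rwa [hu, le_div_iff₀ hT] at hαu
  have huβ2 : Real.log y ≤ β * Real.log (IdealSieve.nrm p.toNz) := by
    rwa [hu, div_le_iff₀ hT] at huβ
  have hhalf : IdealSieve.nrm r ≤ N / 2 := hw.nrm_le_half (by rw [← hy]; linarith)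
  have hest := hC prec (W N) N (le_trans (le_max_left _ _) hN₀) hw p r
  rw [← hy, ← hu] at hest
  set Y := Real.log y
  set T := Real.log (IdealSieve.nrm p.toNz)
  have hY0 : 0 < Y := by linarith
  have hmain := hest hεY (by nlinarith) (huβ2.trans (by gcongr; exact Nat.le_ceil β))
  have hsec := IdealSieve.exp_div_le_mul_rpow hα (by linarith) hξ (by linarith) hu2 huβ2
  rw [hexp, hexpT] at hsec
  have hmain' : |IdealSieve.Phi prec (W N) r p - W N r - IdealSieve.buchstab u * (y / T)|
      ≤ D * (y * Y ^ (ξ - 2)) := by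
    refine hmain.trans ?_
    calc _ ≤ C * (y * Y ^ (ξ - 2) + β / (1 - 1 / α) * (y * Y ^ (ξ - 2))) := by gcongr
      _ = _ := by ring
  -- Since B(u) ≥ 1/2 and log N(p) ≤ log y.
  have hM : y / Y ≤ 2 * (IdealSieve.buchstab u * (y / T)) := by
    have h4 := (IdealSieve.buchstab_mem_Icc (hα.le.trans hαu)).1
    have h5 : y / Y ≤ y / T := by
      gcongr
      nlinarith
    have h6 : 0 < y / T := by positivity
    nlinarith
  have hpw : 0 < y * Y ^ (ξ - 2) := by positivity
  have hA : 0 ≤ |A₄| * (y * Y ^ (ξ - 2)) := by positivity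
  refine ⟨(hw.summable hhalf).subtype (IdealSieve.sifted prec p), ?_, fun hr4 => ?_⟩
  · obtain ⟨E, hE, hE'⟩ := IdealSieve.exists_eq_mul_one_add hy0 hY0 hM
      (D := D + |A₄|) (hmain'.trans (by linarith))
    exact ⟨E, hE, by linarith⟩
  · refine IdealSieve.exists_eq_mul_one_add hy0 hY0 hM (D := D + |A₄|) ?_
    have h4 : y / Y ^ (2 - ξ) = y * Y ^ (ξ - 2) := by
      rw [show 2 - ξ = -(ξ - 2) by ring, Real.rpow_neg hY0.le, div_inv_eq_mul]
    rw [h4] at hr4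
    have h5 := mul_le_mul_of_nonneg_right (le_abs_self A₄) hpw.le
    have h6 := hW N hN r
    obtain ⟨h7, h9⟩ := abs_le.1 hmain'
    rw [abs_le]
    constructor <;> linarith
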